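/- Let $d,m\in\mathbb N=\{1,2,\dots\}$, let $\mathbb T=\mathbb R/\mathbb Z$ carry Lebesgue measure of total mass one, and let $\psi:\mathbb R\to\mathbb R$ be a bounded measurable function. For $j\in\mathbb N_0$ and $k\in\mathcal I_j:=\{0,\dots,2^j-1\}$ put $\psi_{j,k}(x)=2^{j/2}\psi(2^jx-k)$ and $\psi^{\mathrm{per}}_{j,k}(x)=\sum_{\ell\in\mathbb Z}\psi_{j,k}(x+\ell)$; for $j=-1$ put $\mathcal I_{-1}=\{0\}$ and $\psi^{\mathrm{per}}_{-1,0}=1$. Assume that * $\operatorname{supp}\psi=[0,S]$ for some $S>0$; * $\int_{\mathbb R}\psi(x)x^\beta\,dx=0$ for $\beta=0,\dots,m-1$; * there are $\gamma,\delta>0$ such that for all $j\ge 0$ and all $(c_k)\in\mathbb C^{\mathcal I_j}$, $\gamma\sum_k|c_k|^2\le\big\|\sum_k c_k\psi^{\mathrm{per}}_{j,k}\big\|^2_{L_2(\mathbb T)}\le\delta\sum_k|c_k|^2$; * with $V_0^{\mathrm{per}}=\operatorname{span}\{1\}$ and $W_j^{\mathrm{per}}=\operatorname{span}\{\psi^{\mathrm{per}}_{j,k}:k\in\mathcal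 I_j\}$ one has the orthogonal decomposition $L_2(\mathbb T)=V_0^{\mathrm{per}}\oplus W_0^{\mathrm{per}}\oplus W_1^{\mathrm{per}}\oplus\cdots$ (closed direct sum). Let $(\psi^{\mathrm{per}*}_{j,k})_{k\in\mathcal I_j}$ be the dual basis of $(\psi^{\mathrm{per}}_{j,k})_{k\in\mathcal I_j}$ in its span. For $\mathbf j\in\{-1,0,1,\dots\}^d$ let $|\mathbf j|_1=\sum_{i:\,j_i\ge0}j_i$ and $\mathcal I_{\mathbf j}=\prod_i\mathcal I_{j_i}$, and for $\mathbf k\in\mathcal I_{\mathbf j}$ let $\psi^{\mathrm{per}}_{\mathbf j,\mathbf k}(\mathbf x)=\prod_i\psi^{\mathrm{per}}_{j_i,k_i}(x_i)$ and $\psi^{\mathrm{per}*}_{\mathbf j,\mathbf k}(\mathbf x)=\prod_i\psi^{\mathrm{per}*}_{j_i,k_i}(x_i)$. For $f\in L_2(\mathbb T^d)$ define $$P_nf=\sum_{\mathbf j\ge-\mathbf 1,\ |\mathbf j|_1\le n}\ \sum_{\mathbf k\in\mathcal I_{\mathbf j}}\langle f,\psi^{\mathrm{per}*}_{\mathbf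 j,\mathbf k}\rangle\,\psi^{\mathrm{per}}_{\mathbf j,\mathbf k}.$$ For $s>0$ let $H^s_{\mathrm{mix}}(\mathbb T^d)$ be the space of $f\in L_2(\mathbb T^d)$ with finite norm given by $\|f\|^2_{H^s_{\mathrm{mix}}}=\sum_{\mathbf k\in\mathbb Z^d}|c_{\mathbf k}(f)|^2\prod_{i=1}^d(1+|k_i|^2)^s$, where $c_{\mathbf k}(f)$ are the Fourier coefficients. For an integer $r>s$ let $\mathbf B^s_{2,\infty}(\mathbb T^d)$ be the space of $f\in L_2(\mathbb T^d)$ with finite norm $$\|f\|_{\mathbf B^s_{2,\infty}}=\sum_{u\subseteq\{1,\dots,d\}}\ \sup_{0<|h_i|\le1,\ i\in u}\ \prod_{i\in u}|h_i|^{-s}\ \Big\|\prod_{i\in u}\Delta^r_{h_i,i}f\Big\|_{L_2(\mathbb T^d)},$$ where $\Delta^r_{h,i}$ is the $r$-th order difference with step $h$ in the $i$-th variable. **Theorem.** (a) For every $s$ with $1/2<s<m$ there is a constant $C>0$, not depending on $n$ and $f$, such that for all integers $n\ge1$ and all $f\in H^s_{\mathrm{mix}}(\mathbb T^d)$ $$\|f-P_nf\|_{L_\infty(\mathbb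 T^d)}\le C\,2^{-n(s-1/2)}\,n^{(d-1)/2}\,\|f\|_{H^s_{\mathrm{mix}}(\mathbb T^d)}.$$ (b) For every $s$ with $1/2<s<m$ and every integer $r>s$ used in the definition of $\mathbf B^s_{2,\infty}$ there is a constant $C>0$, not depending on $n$ and $f$, such that for all integers $n\ge1$ and all $f\in \mathbf B^s_{2,\infty}(\mathbb T^d)$ $$\|f-P_nf\|_{L_\infty(\mathbb T^d)}\le C\,2^{-n(s-1/2)}\,n^{d-1}\,\|f\|_{\mathbf B^s_{2,\infty}(\mathbb T^d)}.$$ (c) For $s=m$ there is a constant $C>0$, not depending on $n$ and $f$, such that for all integers $n\ge1$ and all $f\in H^m_{\mathrm{mix}}(\mathbb T^d)$ $$\|f-P_nf\|_{L_\infty(\mathbb T^d)}\le C\,2^{-n(m-1/2)}\,n^{d-1}\,\|f\|_{H^m_{\mathrm{mix}}(\mathbb T^d)}.$$ Here $\|\cdot\|_{L_\infty}$ is the (essential) supremum norm. -/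

import Mathlib

open MeasureTheory
open scoped ENNReal

namespace HyperbolicWavelet

noncomputable section

/-! ### The torus `𝕋 = ℝ / ℤ` and `𝕋ᵈ`, with normalised Lebesgue (Haar) measure -/

/-- The Lebesgue measure on `𝕋 = ℝ / ℤ`, of total mass one. -/
abbrev vol₁ : Measure UnitAddCircle := AddCircle.haarAddCircle

/-- The Lebesgue measure on `𝕋ᵈ`, the product measure. -/
abbrev vol (d : ℕ) : Measure (UnitAddTorus (Fin d)) := Measure.pi fun _ => vol₁

/-! ### Periodised wavelets -/

theorem periodic_tsum (g : ℝ → ℝ) : Function.Periodic (fun x : ℝ => ∑' l : ℤ, g (x + l)) 1 := by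
  intro x
  have h := (Equiv.addRight (1 : ℤ)).tsum_eq (fun l : ℤ => g (x + l))
  simp only [Equiv.coe_addRight] at h
  refine Eq.trans ?_ h
  refine tsum_congr fun l => ?_
  congr 1
  push_cast
  ring

/-- The `1`-periodisation `x ↦ ∑_{l ∈ ℤ} g (x + l)`, as a function on `𝕋`. -/
def periodization (g : ℝ → ℝ) : UnitAddCircle → ℝ := (periodic_tsum g).lift

/-- `ψ_{j,k}(x) = 2^{j/2} ψ(2^j x - k)`. -/
def dilate (ψ : ℝ → ℝ) (j k : ℤ) (x : ℝ) : ℝ :=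
  (2 : ℝ) ^ ((j : ℝ) / 2) * ψ ((2 : ℝ) ^ j * x - k)

/-- The translation parameters on level `j ≥ -1`: `{0, …, 2^j - 1}` for `j ≥ 0`, and the one-point
set `{0}` for `j = -1` (where `j.toNat = 0`). -/
abbrev Shift (j : ℤ) : Type := Fin (2 ^ j.toNat)

/-- `ψ^per_{j,k}` on `𝕋`; level `-1` carries the constant function `1`. -/
def wavelet (ψ : ℝ → ℝ) (j : ℤ) (k : Shift j) : UnitAddCircle → ℝ :=
  if j = -1 then fun _ => 1 else periodization (dilate ψ j ((k : ℕ) : ℤ))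

/-- The Gram matrix of level `j`. -/
def gram (ψ : ℝ → ℝ) (j : ℤ) : Matrix (Shift j) (Shift j) ℝ :=
  Matrix.of fun k l => ∫ x, wavelet ψ j k x * wavelet ψ j l x ∂vol₁

/-- The dual wavelets `ψ^{per*}_{j,k}`: the dual basis of `(ψ^per_{j,k})_k` in its linear span,
obtained from the inverse of the Gram matrix. -/
def dualWavelet (ψ : ℝ → ℝ) (j : ℤ) (k : Shift j) (x : UnitAddCircle) : ℝ :=
  ∑ l, (gram ψ j)⁻¹ k l * wavelet ψ j l x

/-! ### Assumptions on the wavelet -/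

/-- Compact support: `supp ψ = [0, S]`. -/
def HasSupport (ψ : ℝ → ℝ) : Prop := ∃ S : ℝ, 0 < S ∧ tsupport ψ = Set.Icc 0 S

/-- Vanishing moments of order `m`. -/
def VanishingMoments (ψ : ℝ → ℝ) (m : ℕ) : Prop := ∀ β < m, ∫ x : ℝ, ψ x * x ^ β = 0

/-- On every level `j ≥ 0` the periodised wavelets form a Riesz basis of their span, with constants
`γ`, `δ` independent of the level. -/
def RieszBasis (ψ : ℝ → ℝ) : Prop :=
  ∃ γ δ : ℝ, 0 < γ ∧ 0 < δ ∧ ∀ (j : ℤ), 0 ≤ j → ∀ c : Shift j → ℂ,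
    γ * ∑ k, ‖c k‖ ^ 2 ≤ ∫ x, ‖∑ k, c k * (wavelet ψ j k x : ℂ)‖ ^ 2 ∂vol₁ ∧
    ∫ x, ‖∑ k, c k * (wavelet ψ j k x : ℂ)‖ ^ 2 ∂vol₁ ≤ δ * ∑ k, ‖c k‖ ^ 2

/-- The orthogonal decomposition `L₂(𝕋) = V₀^per ⊕ W₀^per ⊕ W₁^per ⊕ ⋯`, where `V₀^per` consists of
the constants and `W_j^per` is spanned by the `ψ^per_{j,k}`: different levels are orthogonal, and
finite linear combinations are dense in `L₂(𝕋)`. -/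
structure WaveletDecomposition (ψ : ℝ → ℝ) : Prop where
  orthogonal : ∀ i j : ℤ, -1 ≤ i → -1 ≤ j → i ≠ j → ∀ (k : Shift i) (l : Shift j),
    ∫ x, wavelet ψ i k x * wavelet ψ j l x ∂vol₁ = 0
  dense : ∀ g : UnitAddCircle → ℂ, MemLp g 2 vol₁ → ∀ ε : ℝ≥0∞, 0 < ε →
    ∃ (N : ℤ) (c : (j : ℤ) → Shift j → ℂ),
      eLpNorm (fun x => g x - ∑ j ∈ Finset.Icc (-1) N, ∑ k, c j k * (wavelet ψ j k x : ℂ)) 2 vol₁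
        < ε

/-- A bounded measurable semi-orthogonal wavelet that is compactly supported, has vanishing moments
of order `m`, and whose periodisations form a Riesz basis on every level. -/
structure IsWavelet (ψ : ℝ → ℝ) (m : ℕ) : Prop where
  measurable : Measurable ψ
  bounded : ∃ B : ℝ, ∀ x, |ψ x| ≤ B
  support : HasSupport ψ
  moments : VanishingMoments ψ m
  riesz : RieszBasis ψ
  decomposition : WaveletDecomposition ψ

/-! ### The hyperbolic wavelet projection -/

variable {d : ℕ}

/-- The tensor product `ψ^per_{𝐣,𝐤}`. -/
def tensorWavelet (ψ : ℝ → ℝ) (j : Fin d → ℤ) (k : (i : Fin d) → Shift (j i))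
    (x : UnitAddTorus (Fin d)) : ℝ :=
  ∏ i, wavelet ψ (j i) (k i) (x i)

/-- The tensor product `ψ^{per*}_{𝐣,𝐤}`. -/
def tensorDualWavelet (ψ : ℝ → ℝ) (j : Fin d → ℤ) (k : (i : Fin d) → Shift (j i))
    (x : UnitAddTorus (Fin d)) : ℝ :=
  ∏ i, dualWavelet ψ (j i) (k i) (x i)

/-- The coefficient `⟨f, ψ^{per*}_{𝐣,𝐤}⟩` (the dual wavelet is real valued). -/
def coefficient (ψ : ℝ → ℝ) (f : UnitAddTorus (Fin d) → ℂ) (j : Fin d → ℤ)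
    (k : (i : Fin d) → Shift (j i)) : ℂ :=
  ∫ x, f x * (tensorDualWavelet ψ j k x : ℂ) ∂vol d

/-- `𝒥_n = {𝐣 ∈ ℤᵈ : 𝐣 ≥ -𝟏, |𝐣|₁ ≤ n}`, where `|𝐣|₁ = ∑_{i : j_i ≥ 0} j_i`; these conditions
force `j_i ≤ n`. -/
def levels (d n : ℕ) : Finset (Fin d → ℤ) :=
  (Fintype.piFinset fun _ => Finset.Icc (-1) (n : ℤ)).filter
    fun j => ∑ i with 0 ≤ j i, j i ≤ n

/-- The operator `P_n`. -/
def proj (ψ : ℝ → ℝ) (n : ℕ) (f : UnitAddTorus (Fin d) → ℂ) (x : UnitAddTorus (Fin d)) : ℂ :=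
  ∑ j ∈ levels d n, ∑ k : (i : Fin d) → Shift (j i),
    coefficient ψ f j k * (tensorWavelet ψ j k x : ℂ)

/-! ### Function spaces of dominating mixed smoothness -/

/-- The norm of `H^s_mix(𝕋ᵈ)`,
`‖f‖² = ∑_{𝐤 ∈ ℤᵈ} |c_𝐤(f)|² ∏_i (1 + |k_i|²)^s`, with values in `[0, ∞]`. -/
def sobolevNorm (s : ℝ) (f : UnitAddTorus (Fin d) → ℂ) : ℝ≥0∞ :=
  (∑' k : Fin d → ℤ, ‖UnitAddTorus.mFourierCoeff f k‖ₑ ^ 2 *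
    ENNReal.ofReal (∏ i, (1 + (k i : ℝ) ^ 2) ^ s)) ^ (1 / 2 : ℝ)

/-- `f ∈ H^s_mix(𝕋ᵈ)`. -/
def MemSobolev (s : ℝ) (f : UnitAddTorus (Fin d) → ℂ) : Prop :=
  MemLp f 2 (vol d) ∧ sobolevNorm s f < ∞

/-- The `r`-th order difference with step `h` in the `i`-th coordinate. -/
def coordDifference (r : ℕ) (h : ℝ) (i : Fin d) (f : UnitAddTorus (Fin d) → ℂ)
    (x : UnitAddTorus (Fin d)) : ℂ :=
  ∑ a ∈ Finset.range (r + 1), (-1) ^ (r - a) * (r.choose a : ℂ) *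
    f (x + Pi.single i ((a * h : ℝ) : UnitAddCircle))

/-- The mixed difference `Δ_𝐡^{r,u} = ∏_{i ∈ u} Δ_{h_i,i}^r` (a composition of commuting operators;
the identity for `u = ∅`). -/
def mixedDifference (r : ℕ) (u : Finset (Fin d)) (h : Fin d → ℝ)
    (f : UnitAddTorus (Fin d) → ℂ) : UnitAddTorus (Fin d) → ℂ :=
  ((List.finRange d).filter (fun i => i ∈ u)).foldr (fun i g => coordDifference r (h i) i g) f

/-- The seminorm `|f|_{𝐁^s_{2,∞}(u)}`, formed with differences of order `r`. -/
def besovSeminorm (s : ℝ) (r : ℕ) (u : Finset (Fin d)) (f : UnitAddTorus (Fin d) → ℂ) : ℝ≥0∞ :=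
  ⨆ (h : Fin d → ℝ) (_ : ∀ i ∈ u, 0 < |h i| ∧ |h i| ≤ 1),
    ENNReal.ofReal (∏ i ∈ u, |h i| ^ (-s)) * eLpNorm (mixedDifference r u h f) 2 (vol d)

/-- The norm of `𝐁^s_{2,∞}(𝕋ᵈ)`, formed with differences of order `r`. -/
def besovNorm (s : ℝ) (r : ℕ) (f : UnitAddTorus (Fin d) → ℂ) : ℝ≥0∞ :=
  ∑ u : Finset (Fin d), besovSeminorm s r u f

/-- `f ∈ 𝐁^s_{2,∞}(𝕋ᵈ)`. -/
def MemBesov (s : ℝ) (r : ℕ) (f : UnitAddTorus (Fin d) → ℂ) : Prop :=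
  MemLp f 2 (vol d) ∧ besovNorm s r f < ∞

/-- The norm `‖f - P_n f‖_{L_∞(𝕋ᵈ)}`. -/
def uniformError (ψ : ℝ → ℝ) (n : ℕ) (f : UnitAddTorus (Fin d) → ℂ) : ℝ≥0∞ :=
  eLpNorm (fun x => f x - proj ψ n f x) ∞ (vol d)

end

end HyperbolicWavelet

namespace HyperbolicWavelet

/-! The error is bounded by the uniform norms of the level components that $P_n$ leaves out, and
these are estimated through wavelet coefficients. Cauchy–Schwarz in $\mathbf k$, together with
$\sum_{\mathbf k}|\psi^{\mathrm{per}}_{\mathbf j,\mathbf k}|^2\lesssim 2^{|\mathbf j|_1}$, costs a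
factor $2^{|\mathbf j|_1/2}$. The smoothness of $f$ gives $2^{-s|\mathbf j|_1}$ for the $\ell_2$
norm of the coefficients. There are $O((q+1)^{d-1})$ levels with $|\mathbf j|_1=q$, so the tail over
$q>n$ is a geometric series with a polynomial weight (`exists_tsum_tail_le`).

The coefficient bounds are obtained on the Fourier side. By its moments and compact support, $\psi$
is the weak $m$-th derivative of a bounded function with the same support bound
(`exists_antiderivative`). On level $j$ this gives the multiplier $(n/2^j)^m$, up to constants, at
frequency $n$. A Schur-type Bessel inequality, uniform in $j$, then bounds the coefficients by the
Fourier coefficients damped with `freqWeight`, that is with $\min(1,((1+n^2)/4^j)^m)$. The Riesz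
lower bound makes the inverse Gram matrices uniformly bounded, which transfers this to the dual
wavelets, and bounded matrices tensorise (`sum_enorm_tensor_sq_le`).

For $0<s<m$ the quantity $4^{sj}\min(1,((1+n^2)/4^j)^m)$ decays geometrically in the distance from
$j$ to the dyadic block of $n$ (`two_rpow_mul_freqWeight_le`). In the Sobolev case the weighted
level norms are therefore square summable, and Cauchy–Schwarz over the tail needs only the square
root of the number of levels: exponent $(d-1)/2$. The Besov norm controls each dyadic block
separately, so the level norms are only bounded and all levels are counted: exponent $d-1$. For
$s=m$ the decay towards fine levels is lost, and again only a uniform bound on each level remains.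

To turn this into an error bound, $f$ must equal the sum of its level components almost everywhere.
Both have the same pairings with all tensor wavelets, by orthogonality of levels and the Gram
inverse, and tensor wavelets are total (`uniformError_le_tsum`). -/

/-- A measurable function bounded by `B` that vanishes outside `[0, S]`. -/
structure BoundedOn (φ : ℝ → ℝ) (B S : ℝ) : Prop where
  measurable : Measurable φ
  bound : ∀ x, |φ x| ≤ B
  zero : ∀ x, x ∉ Set.Icc 0 S → φ x = 0

/-! ### Repeated antiderivatives from vanishing moments -/

namespace BoundedOn

variable {φ : ℝ → ℝ} {B S : ℝ}

theorem nonneg (h : BoundedOn φ B S) : 0 ≤ B := (abs_nonneg _).trans (h.bound 0)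

theorem integrable_mul (h : BoundedOn φ B S) {g : ℝ → ℂ} (hg : Continuous g) :
    Integrable fun x => (φ x : ℂ) * g x := by
  have h1 : IntegrableOn (fun x => (φ x : ℂ) * g x) (Set.Icc 0 S) := by
    refine (hg.integrableOn_Icc).bdd_mul (c := B)
      (Complex.measurable_ofReal.comp h.measurable).aestronglyMeasurable ?_
    exact Filter.Eventually.of_forall fun x => by simpa using h.bound x
  refine (integrableOn_iff_integrable_of_support_subset ?_).1 h1
  intro x hx
  by_contra hc
  simp [h.zero x hc] at hx

theorem integrable (h : BoundedOn φ B S) : Integrable φ := by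
  have := (h.integrable_mul (g := fun _ => 1) continuous_const).re
  simpa using this

theorem integral_mul_eq (h : BoundedOn φ B S) (g : ℝ → ℂ) :
    ∫ x, (φ x : ℂ) * g x = ∫ x in Set.Ioc 0 S, (φ x : ℂ) * g x := by
  rw [← integral_Icc_eq_integral_Ioc]
  symm
  apply setIntegral_eq_integral_of_forall_compl_eq_zero
  intro x hx
  simp [h.zero x hx]

theorem integral_eq (h : BoundedOn φ B S) : ∫ x, φ x = ∫ x in Set.Ioc 0 S, φ x := by
  rw [← integral_Icc_eq_integral_Ioc]
  symm
  apply setIntegral_eq_integral_of_forall_compl_eq_zero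
  intro x hx
  simp [h.zero x hx]

/-- The zero mean is what makes the primitive vanish again to the right of `S`; so integration stays
within the same class of functions and can be iterated. -/
theorem primitive (h : BoundedOn φ B S) (hS : 0 ≤ S) (h0 : ∫ x, φ x = 0) :
    BoundedOn (fun x => ∫ t in (0 : ℝ)..x, φ t) (B * S) S := by
  have hz : ∀ x, x ∉ Set.Icc 0 S → (∫ t in (0 : ℝ)..x, φ t) = 0 := by
    intro x hx
    rcases lt_or_ge x 0 with hx0 | hx0
    · rw [intervalIntegral.integral_symm, intervalIntegral.integral_of_le hx0.le,
        integral_Ioc_eq_integral_Ioo, setIntegral_eq_zero_of_forall_eq_zero, neg_zero]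
      intro t ht
      exact h.zero t fun hc => absurd hc.1 (not_le.2 ht.2)
    · have hxS : S < x := by
        by_contra hc
        exact hx ⟨hx0, not_lt.1 hc⟩
      rw [intervalIntegral.integral_of_le hx0]
      refine Eq.trans ?_ (h.integral_eq.symm.trans h0)
      refine setIntegral_eq_of_subset_of_forall_sdiff_eq_zero measurableSet_Ioc
        (Set.Ioc_subset_Ioc_right hxS.le) ?_
      intro t ht
      refine h.zero t fun hc => ht.2 ⟨ht.1.1, hc.2⟩
  refine ⟨?_, ?_, hz⟩
  · exact (intervalIntegral.continuous_primitive
      (fun a b => h.integrable.intervalIntegrable) 0).measurable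
  · intro x
    by_cases hx : x ∈ Set.Icc 0 S
    · have := intervalIntegral.norm_integral_le_of_norm_le_const (a := 0) (b := x) (f := φ)
        (C := B) fun t _ => h.bound t
      rw [Real.norm_eq_abs, sub_zero, abs_of_nonneg hx.1] at this
      exact this.trans (mul_le_mul_of_nonneg_left hx.2 h.nonneg)
    · rw [hz x hx, abs_zero]
      exact mul_nonneg h.nonneg hS

/-- Integration by parts when `φ` is only bounded and measurable: Fubini replaces differentiation of
the primitive. -/
theorem integral_mul_eq_neg_integral_primitive (h : BoundedOn φ B S) (hS : 0 ≤ S)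
    (h0 : ∫ x, φ x = 0) {g g' : ℝ → ℂ} (hg : ∀ x, HasDerivAt g (g' x) x) (hg' : Continuous g') :
    ∫ x, (φ x : ℂ) * g x = -∫ x, ((∫ t in (0 : ℝ)..x, φ t : ℝ) : ℂ) * g' x := by
  have hp := h.primitive hS h0
  have hgc : Continuous g := continuous_iff_continuousAt.2 fun x => (hg x).continuousAt
  rw [hp.integral_mul_eq]
  set ν : Measure ℝ := volume.restrict (Set.Ioc 0 S) with hν
  -- The integrand $\varphi(t)g'(x)$ restricted to the triangle $t\le x$. Integrating first in $t$
  -- gives the primitive, integrating first in $x$ gives $g(S)-g(t)$.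
  let F : ℝ → ℝ → ℂ := fun x t => (Set.indicator {p : ℝ × ℝ | p.2 ≤ p.1} (fun p => (φ p.2 : ℂ)) (x, t)) * g' x
  have hFi : Integrable (Function.uncurry F) (ν.prod ν) := by
    have h1 : Integrable (fun p : ℝ × ℝ => g' p.1) (ν.prod ν) := by
      have : Integrable g' ν := (hg'.integrableOn_Icc).mono_set Set.Ioc_subset_Icc_self
      exact this.comp_fst ν
    refine h1.bdd_mul (c := B) (f := Set.indicator {p : ℝ × ℝ | p.2 ≤ p.1} (fun p => (φ p.2 : ℂ)))
      ?_ ?_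
    · refine Measurable.aestronglyMeasurable ?_
      refine Measurable.indicator ?_ (measurableSet_le measurable_snd measurable_fst)
      exact Complex.measurable_ofReal.comp (h.measurable.comp measurable_snd)
    · refine Filter.Eventually.of_forall fun p => ?_
      by_cases hp : p ∈ {p : ℝ × ℝ | p.2 ≤ p.1}
      · rw [Set.indicator_of_mem hp]
        simpa using h.bound p.2
      · rw [Set.indicator_of_notMem hp]
        simpa using h.nonneg
  have e1 : ∫ x in Set.Ioc 0 S, ((∫ t in (0 : ℝ)..x, φ t : ℝ) : ℂ) * g' x
      = ∫ x, ∫ t, F x t ∂ν ∂ν := by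
    refine setIntegral_congr_fun measurableSet_Ioc fun x hx => ?_
    simp only [F]
    rw [integral_mul_const]
    congr 1
    rw [intervalIntegral.integral_of_le hx.1.le, ← integral_complex_ofReal, hν]
    have : ∀ t, Set.indicator {p : ℝ × ℝ | p.2 ≤ p.1} (fun p => (φ p.2 : ℂ)) (x, t)
        = Set.indicator (Set.Iic x) (fun t => (φ t : ℂ)) t := by
      intro t
      simp [Set.indicator_apply]
    simp only [this]
    rw [setIntegral_indicator measurableSet_Iic, Set.Ioc_inter_Iic, min_eq_right hx.2]
  have e2 : ∫ t, ∫ x, F x t ∂ν ∂ν = ∫ t in Set.Ioc 0 S, (φ t : ℂ) * (g S - g t) := by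
    refine setIntegral_congr_fun measurableSet_Ioc fun t ht => ?_
    have : ∀ x, F x t = (φ t : ℂ) * Set.indicator (Set.Ici t) g' x := by
      intro x
      simp only [F, Set.indicator_apply, Set.mem_ofPred_eq, Set.mem_Ici]
      split_ifs <;> simp
    simp only [this]
    rw [integral_const_mul]
    congr 1
    rw [hν, setIntegral_indicator measurableSet_Ici]
    have hset : Set.Ioc 0 S ∩ Set.Ici t = Set.Icc t S := by
      ext y
      simp only [Set.mem_inter_iff, Set.mem_Ioc, Set.mem_Ici, Set.mem_Icc]
      exact ⟨fun hy => ⟨hy.2, hy.1.2⟩, fun hy => ⟨⟨ht.1.trans_le hy.1, hy.2⟩, hy.1⟩⟩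
    rw [hset, integral_Icc_eq_integral_Ioc, ← intervalIntegral.integral_of_le ht.2]
    exact intervalIntegral.integral_eq_sub_of_hasDerivAt (fun x _ => hg x)
      (hg'.intervalIntegrable _ _)
  -- The boundary term $g(S)\int\varphi$ drops out because `φ` has mean zero.
  rw [e1, integral_integral_swap hFi, e2, ← h.integral_mul_eq (fun t => g S - g t)]
  simp only [mul_sub]
  rw [integral_sub (h.integrable_mul continuous_const) (h.integrable_mul hgc), integral_mul_const,
    integral_complex_ofReal, h0]
  simp

/-- A bounded compactly supported function with `m` vanishing moments is, in the weak sense, the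
`m`-th derivative of a bounded function supported in the same interval. -/
theorem exists_antiderivative (hS : 0 ≤ S) (m : ℕ) : ∀ {φ : ℝ → ℝ} {B : ℝ}, BoundedOn φ B S →
    (∀ β < m, ∫ x : ℝ, φ x * x ^ β = 0) →
    ∃ (Φ : ℝ → ℝ) (B' : ℝ), BoundedOn Φ B' S ∧ ∀ ω : ℝ,
      ∫ y, (φ y : ℂ) * Complex.exp (Complex.I * ω * y)
        = (-(Complex.I * ω)) ^ m * ∫ y, (Φ y : ℂ) * Complex.exp (Complex.I * ω * y) := by
  induction m with
  | zero =>
    intro φ B h _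
    exact ⟨φ, B, h, fun ω => by simp⟩
  | succ m ih =>
    intro φ B h hmom
    have h0 : ∫ x, φ x = 0 := by simpa using hmom 0 (Nat.succ_pos m)
    have hp := h.primitive hS h0
    -- The primitive has one vanishing moment fewer: integration by parts against $x^{\beta+1}$
    -- identifies its moment of order $\beta$ with $-(\beta+1)^{-1}$ times the moment of order
    -- $\beta+1$ of `φ`.
    obtain ⟨Φ, B', hΦ, hΦe⟩ := ih hp (by
      intro β hβ
      have hd : ∀ x : ℝ, HasDerivAt (fun x : ℝ => (x : ℂ) ^ (β + 1)) ((β + 1 : ℂ) * (x : ℂ) ^ β) x := by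
        intro x
        have := ((hasDerivAt_id (x : ℂ)).pow (β + 1)).comp_ofReal
        simpa using this
      have := h.integral_mul_eq_neg_integral_primitive hS h0 hd (by fun_prop)
      have e1 : ∫ x, (φ x : ℂ) * (x : ℂ) ^ (β + 1) = 0 := by
        have := congrArg (fun r : ℝ => (r : ℂ)) (hmom (β + 1) (by omega))
        simp only [← integral_complex_ofReal] at this
        simpa using this
      rw [e1, eq_comm, neg_eq_zero] at this
      have e2 : ∀ x : ℝ, ((∫ t in (0 : ℝ)..x, φ t : ℝ) : ℂ) * ((β + 1 : ℂ) * (x : ℂ) ^ β)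
          = (β + 1 : ℂ) * (((∫ t in (0 : ℝ)..x, φ t) * x ^ β : ℝ) : ℂ) := by
        intro x; push_cast; ring
      simp only [e2] at this
      rw [integral_const_mul, mul_eq_zero] at this
      rcases this with hb | hb
      · exact absurd hb (by exact_mod_cast Nat.succ_ne_zero β)
      · rw [integral_complex_ofReal] at hb
        exact_mod_cast hb)
    refine ⟨Φ, B', hΦ, fun ω => ?_⟩
    have hd : ∀ x : ℝ, HasDerivAt (fun x : ℝ => Complex.exp (Complex.I * ω * x))
        (Complex.I * ω * Complex.exp (Complex.I * ω * x)) x := by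
      intro x
      have := (((hasDerivAt_id (x : ℂ)).const_mul (Complex.I * ω)).cexp).comp_ofReal
      simpa [mul_comm] using this
    rw [h.integral_mul_eq_neg_integral_primitive hS h0 hd (by fun_prop)]
    have e : ∀ x : ℝ, ((∫ t in (0 : ℝ)..x, φ t : ℝ) : ℂ) * (Complex.I * ω * Complex.exp (Complex.I * ω * x))
        = (Complex.I * ω) * (((∫ t in (0 : ℝ)..x, φ t : ℝ) : ℂ) * Complex.exp (Complex.I * ω * x)) := by
      intro x; ring
    simp only [e]
    rw [integral_const_mul, hΦe ω]
    ring

end BoundedOn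

/-! ### Periodisation -/

theorem periodization_coe (g : ℝ → ℝ) (x : ℝ) :
    periodization g (x : UnitAddCircle) = ∑' l : ℤ, g (x + l) := rfl

theorem volume_eq_vol₁ : (volume : Measure UnitAddCircle) = vol₁ := by
  rw [AddCircle.volume_eq_smul_haarAddCircle]
  simp

theorem lintegral_vol₁ (f : UnitAddCircle → ℝ≥0∞) :
    ∫⁻ x, f x ∂vol₁ = ∫⁻ x in Set.Ioc (0 : ℝ) 1, f x := by
  rw [← volume_eq_vol₁, ← UnitAddCircle.lintegral_preimage 0]
  simp

theorem integral_vol₁ {E : Type*} [NormedAddCommGroup E] [NormedSpace ℝ E]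
    (f : UnitAddCircle → E) :
    ∫ x, f x ∂vol₁ = ∫ x in Set.Ioc (0 : ℝ) 1, f x := by
  rw [← volume_eq_vol₁, ← UnitAddCircle.integral_preimage 0]
  simp

theorem measurable_periodization {g : ℝ → ℝ} (hg : Measurable g) :
    Measurable (periodization g) := by
  refine measurable_from_quotient.2 ?_
  change Measurable fun x : ℝ => ∑' l : ℤ, g (x + l)
  exact Measurable.tsum fun l => hg.comp (measurable_id.add_const _)

theorem enorm_periodization_le (g : ℝ → ℝ) (x : ℝ) :
    ‖periodization g (x : UnitAddCircle)‖ₑ ≤ ∑' l : ℤ, ‖g (x + l)‖ₑ := by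
  rw [periodization_coe]
  exact enorm_tsum_le_tsum_enorm

theorem tsum_lintegral_Ioc_comp_add_int (f : ℝ → ℝ≥0∞) :
    ∑' l : ℤ, ∫⁻ x in Set.Ioc (0 : ℝ) 1, f (x + l) = ∫⁻ x, f x := by
  have h1 : ∀ l : ℤ, ∫⁻ x in Set.Ioc (0 : ℝ) 1, f (x + l)
      = ∫⁻ x in Set.Ioc (0 + (l : ℝ)) (0 + l + 1), f x := by
    intro l
    have := (measurePreserving_add_right volume (l : ℝ)).setLIntegral_comp_preimage_emb
      (measurableEmbedding_addRight (l : ℝ)) f (Set.Ioc (0 + (l : ℝ)) (0 + l + 1))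
    rw [← this]
    congr 2
    ext x
    simp [add_comm]
  simp only [h1]
  rw [← lintegral_iUnion (fun _ => measurableSet_Ioc) (Set.pairwise_disjoint_Ioc_add_intCast 0),
    iUnion_Ioc_add_intCast, setLIntegral_univ]

theorem lintegral_periodization_le {g : ℝ → ℝ} (hg : Measurable g) :
    ∫⁻ x, ‖periodization g x‖ₑ ∂vol₁ ≤ ∫⁻ x, ‖g x‖ₑ := by
  have hm : ∀ l : ℤ, AEMeasurable (fun x : ℝ => ‖g (x + l)‖ₑ)
      (volume.restrict (Set.Ioc (0 : ℝ) 1)) :=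
    fun l => (hg.comp (measurable_id.add_const _)).enorm.aemeasurable
  rw [lintegral_vol₁, ← tsum_lintegral_Ioc_comp_add_int, ← lintegral_tsum hm]
  exact lintegral_mono fun x => enorm_periodization_le g x

theorem fourier_coe_add_int (n l : ℤ) (x : ℝ) :
    fourier n ((x + l : ℝ) : UnitAddCircle) = fourier n (x : UnitAddCircle) := by
  congr 1
  exact QuotientAddGroup.eq.2 ⟨-l, by simp⟩

theorem norm_fourier_apply (n : ℤ) (x : UnitAddCircle) : ‖fourier n x‖ = 1 := by
  rw [fourier_apply, Circle.norm_coe]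

/-- Unfolding: the character is 1-periodic, so the periods of the line reassemble; integrability of
`g` justifies exchanging sum and integral. -/
theorem integral_periodization_mul_fourier {g : ℝ → ℝ} (hg : Integrable g) (hm : Measurable g)
    (n : ℤ) :
    ∫ x, (periodization g x : ℂ) * fourier n x ∂vol₁
      = ∫ x : ℝ, (g x : ℂ) * fourier n (x : UnitAddCircle) := by
  have hmeas : ∀ l : ℤ, AEStronglyMeasurable
      (fun x : ℝ => ((g (x + l) : ℝ) : ℂ) * fourier n ((x + l : ℝ) : UnitAddCircle))
      (volume.restrict (Set.Ioc 0 1)) := by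
    intro l
    refine (Measurable.mul ?_ ?_).aestronglyMeasurable
    · exact Complex.measurable_ofReal.comp (hm.comp (measurable_id.add_const _))
    · exact (fourier n).continuous.measurable.comp
        (AddCircle.measurable_mk'.comp (measurable_id.add_const _))
  have hen : ∀ l : ℤ, ∀ x : ℝ, ‖((g (x + l) : ℝ) : ℂ) * fourier n ((x + l : ℝ) : UnitAddCircle)‖ₑ
      = ‖g (x + l)‖ₑ := by
    intro l x
    rw [enorm_mul, ← ofReal_norm (fourier n _), norm_fourier_apply, ENNReal.ofReal_one, mul_one,
      ← ofReal_norm, Complex.norm_real, ofReal_norm]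
  have hfin : ∫⁻ x, ‖g x‖ₑ ≠ ∞ := hg.2.ne
  rw [integral_vol₁]
  have e1 : ∫ x in Set.Ioc (0 : ℝ) 1, (periodization g (x : UnitAddCircle) : ℂ) *
        fourier n (x : UnitAddCircle)
      = ∫ x in Set.Ioc (0 : ℝ) 1, ∑' l : ℤ, ((g (x + l) : ℝ) : ℂ) *
          fourier n ((x + l : ℝ) : UnitAddCircle) := by
    refine integral_congr_ae (Filter.Eventually.of_forall fun x => ?_)
    simp only [fourier_coe_add_int]
    rw [tsum_mul_right, periodization_coe, Complex.ofReal_tsum]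
  rw [e1, integral_tsum hmeas]
  · have hint : Integrable (fun x : ℝ => (g x : ℂ) * fourier n (x : UnitAddCircle)) := by
      refine ⟨(Measurable.mul (Complex.measurable_ofReal.comp hm)
        ((fourier n).continuous.measurable.comp AddCircle.measurable_mk')).aestronglyMeasurable, ?_⟩
      have := fun x => hen 0 x
      simp only [Int.cast_zero, add_zero] at this
      rw [HasFiniteIntegral]
      simp only [this]
      exact hg.2
    have := hint.hasSum_intervalIntegral_comp_add_int.tsum_eq
    rw [← this]
    refine tsum_congr fun l => ?_
    rw [intervalIntegral.integral_of_le zero_le_one]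
  · simp only [hen]
    rw [tsum_lintegral_Ioc_comp_add_int (fun x => ‖g x‖ₑ)]
    exact hfin

/-! ### Periodised dilates of a bounded compactly supported function -/

theorem measurable_dilate {φ : ℝ → ℝ} (hφ : Measurable φ) (j k : ℤ) :
    Measurable (dilate φ j k) := by
  unfold dilate
  exact (hφ.comp ((measurable_id.const_mul _).sub_const _)).const_mul _

namespace BoundedOn

variable {φ : ℝ → ℝ} {B S : ℝ}

theorem lintegral_enorm_le (h : BoundedOn φ B S) : ∫⁻ x, ‖φ x‖ₑ ≤ ENNReal.ofReal (B * S) := by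
  have : ∀ x, ‖φ x‖ₑ ≤ Set.indicator (Set.Icc 0 S) (fun _ => ENNReal.ofReal B) x := by
    intro x
    by_cases hx : x ∈ Set.Icc 0 S
    · rw [Set.indicator_of_mem hx, ← ofReal_norm]
      exact ENNReal.ofReal_le_ofReal (h.bound x)
    · rw [h.zero x hx]
      simp
  refine (lintegral_mono this).trans ?_
  rw [lintegral_indicator measurableSet_Icc, setLIntegral_const, Real.volume_Icc, sub_zero,
    ENNReal.ofReal_mul h.nonneg]

/-- At most $S+1$ integer translates of a point fall into $[0,S]$. -/
theorem tsum_enorm_add_int_le (h : BoundedOn φ B S) (hS : 0 ≤ S) (y : ℝ) :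
    ∑' n : ℤ, ‖φ (y + n)‖ₑ ≤ ENNReal.ofReal (B * (S + 1)) := by
  set F : Finset ℤ := Finset.Icc ⌈-y⌉ ⌊S - y⌋ with hF
  rw [tsum_eq_sum (s := F)]
  · calc ∑ n ∈ F, ‖φ (y + n)‖ₑ ≤ ∑ _n ∈ F, ENNReal.ofReal B := by
          refine Finset.sum_le_sum fun n _ => ?_
          rw [← ofReal_norm]
          exact ENNReal.ofReal_le_ofReal (h.bound _)
      _ = ENNReal.ofReal (B * F.card) := by
          rw [Finset.sum_const, nsmul_eq_mul, ENNReal.ofReal_mul h.nonneg, mul_comm]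
          simp
      _ ≤ _ := by
          refine ENNReal.ofReal_le_ofReal (mul_le_mul_of_nonneg_left ?_ h.nonneg)
          rw [hF, Int.card_Icc]
          have h1 := Int.floor_le (S - y)
          have h2 := Int.le_ceil (-y)
          have h3 : (((⌊S - y⌋ + 1 - ⌈-y⌉).toNat : ℤ) : ℝ) ≤ S + 1 := by
            rw [Int.toNat_eq_max]
            push_cast
            exact max_le (by linarith) (by linarith)
          exact_mod_cast h3
  · intro n hn
    rw [h.zero, enorm_zero]
    intro hc
    apply hn
    rw [hF, Finset.mem_Icc]
    exact ⟨Int.ceil_le.2 (by linarith [hc.1]), Int.le_floor.2 (by linarith [hc.2])⟩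

theorem lintegral_enorm_dilate_le (h : BoundedOn φ B S) (j k : ℤ) :
    ∫⁻ x, ‖dilate φ j k x‖ₑ ≤ ENNReal.ofReal ((2 : ℝ) ^ (-(j : ℝ) / 2) * (B * S)) := by
  have ha : (0 : ℝ) < (2 : ℝ) ^ j := by positivity
  have e : ∀ x, ‖dilate φ j k x‖ₑ
      = ENNReal.ofReal ((2 : ℝ) ^ ((j : ℝ) / 2)) * ‖φ ((2 : ℝ) ^ j * x - k)‖ₑ := by
    intro x
    rw [dilate, enorm_mul, Real.enorm_of_nonneg (by positivity)]
  simp only [e]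
  have h1 : ∫⁻ x, ‖φ ((2 : ℝ) ^ j * x - k)‖ₑ = ENNReal.ofReal ((2 : ℝ) ^ j)⁻¹ * ∫⁻ x, ‖φ x‖ₑ := by
    have : ∫⁻ x, ‖φ (x - k)‖ₑ = ∫⁻ x, ‖φ x‖ₑ :=
      lintegral_sub_right_eq_self (fun x => ‖φ x‖ₑ) (k : ℝ)
    rw [← this, ← abs_of_pos (inv_pos.2 ha)]
    have hm : Measurable fun x => ‖φ (x - k)‖ₑ := (h.measurable.comp (measurable_id.sub_const _)).enorm
    rw [← lintegral_map (f := fun x => ‖φ (x - k)‖ₑ) hm (measurable_const_mul _),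
      Real.map_volume_mul_left ha.ne', lintegral_smul_measure, smul_eq_mul]
  have hm : Measurable fun x : ℝ => ‖φ ((2 : ℝ) ^ j * x - k)‖ₑ :=
    (h.measurable.comp ((measurable_id.const_mul _).sub_const _)).enorm
  rw [lintegral_const_mul _ hm, h1,
    ← mul_assoc, ← ENNReal.ofReal_mul (by positivity),
    ENNReal.ofReal_mul (p := (2 : ℝ) ^ (-(j : ℝ) / 2)) (by positivity)]
  refine mul_le_mul' (ENNReal.ofReal_le_ofReal (le_of_eq ?_)) h.lintegral_enorm_le
  rw [← Real.rpow_intCast, ← Real.rpow_neg zero_le_two, ← Real.rpow_add zero_lt_two]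
  congr 1
  ring

theorem sum_enorm_periodization_dilate_le (h : BoundedOn φ B S) (hS : 0 ≤ S) {j : ℤ} (hj : 0 ≤ j)
    (x : UnitAddCircle) :
    ∑ k : Shift j, ‖periodization (dilate φ j ((k : ℕ) : ℤ)) x‖ₑ
      ≤ ENNReal.ofReal ((2 : ℝ) ^ ((j : ℝ) / 2) * (B * (S + 1))) := by
  induction x using QuotientAddGroup.induction_on with
  | H x =>
  obtain ⟨J, rfl⟩ := Int.eq_ofNat_of_zero_le hj
  calc ∑ k : Shift J, ‖periodization (dilate φ J ((k : ℕ) : ℤ)) (x : UnitAddCircle)‖ₑ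
      ≤ ∑ k : Shift J, ∑' l : ℤ, ENNReal.ofReal ((2 : ℝ) ^ ((J : ℝ) / 2)) *
          ‖φ ((2 : ℝ) ^ J * x + ((2 ^ J * l - (k : ℕ) : ℤ) : ℝ))‖ₑ := by
        refine Finset.sum_le_sum fun k _ => (enorm_periodization_le _ x).trans (le_of_eq ?_)
        refine tsum_congr fun l => ?_
        rw [dilate, enorm_mul, Real.enorm_of_nonneg (by positivity)]
        congr 3
        push_cast
        rw [zpow_natCast]
        ring
    _ = ENNReal.ofReal ((2 : ℝ) ^ ((J : ℝ) / 2)) * ∑' p : Shift J × ℤ,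
          ‖φ ((2 : ℝ) ^ J * x + ((2 ^ J * p.2 - (p.1 : ℕ) : ℤ) : ℝ))‖ₑ := by
        rw [ENNReal.tsum_prod', tsum_fintype, Finset.mul_sum]
        simp only [ENNReal.tsum_mul_left]
    _ ≤ ENNReal.ofReal ((2 : ℝ) ^ ((J : ℝ) / 2)) * ENNReal.ofReal (B * (S + 1)) := by
        -- Since $0\le k<2^J$, the map $(k,l)\mapsto 2^Jl-k$ is injective. All shifts and all
        -- periods together therefore form part of a single sum over integer translates, and the
        -- bound does not grow with the number of shifts.
        refine mul_le_mul' le_rfl (le_trans ?_ (h.tsum_enorm_add_int_le hS ((2 : ℝ) ^ J * x)))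
        refine ENNReal.tsum_comp_le_tsum_of_injective
          (f := fun p : Shift J × ℤ => 2 ^ J * p.2 - ((p.1 : ℕ) : ℤ)) ?_
          (fun n : ℤ => ‖φ ((2 : ℝ) ^ J * x + n)‖ₑ)
        rintro ⟨k, l⟩ ⟨k', l'⟩ hkl
        simp only at hkl
        have hk : (k : ℕ) < 2 ^ J := k.2
        have hk' : (k' : ℕ) < 2 ^ J := k'.2
        zify at hk hk'
        have hll : l = l' := by
          rcases lt_trichotomy l l' with hl | hl | hl
          · nlinarith [mul_le_mul_of_nonneg_left (Int.add_one_le_iff.2 hl) (by positivity : (0:ℤ) ≤ 2 ^ J)]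
          · exact hl
          · nlinarith [mul_le_mul_of_nonneg_left (Int.add_one_le_iff.2 hl) (by positivity : (0:ℤ) ≤ 2 ^ J)]
        subst hll
        have : (k : ℕ) = k' := by omega
        exact Prod.ext (Fin.ext this) rfl
    _ = _ := by
        rw [← ENNReal.ofReal_mul (by positivity)]
        simp

end BoundedOn

/-! ### Bessel inequalities -/

/-- Cauchy–Schwarz for the measure with density `w`, obtained by splitting $w=w^{1/2}w^{1/2}$. -/
theorem sq_lintegral_mul_le {α : Type*} [MeasurableSpace α] {μ : Measure α} {a w : α → ℝ≥0∞}
    (ha : AEMeasurable a μ) (hw : AEMeasurable w μ) :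
    (∫⁻ x, a x * w x ∂μ) ^ 2 ≤ (∫⁻ x, a x ^ 2 * w x ∂μ) * ∫⁻ x, w x ∂μ := by
  have hs : ∀ x, w x ^ (1 / 2 : ℝ) * w x ^ (1 / 2 : ℝ) = w x := by
    intro x
    rw [← ENNReal.rpow_add_of_nonneg _ _ (by norm_num) (by norm_num)]
    norm_num
  have h := ENNReal.lintegral_mul_le_Lp_mul_Lq μ (p := 2) (q := 2)
    (by constructor <;> norm_num) (f := fun x => a x * w x ^ (1 / 2 : ℝ))
    (g := fun x => w x ^ (1 / 2 : ℝ)) (ha.mul (hw.pow_const _)) (hw.pow_const _)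
  simp only [Pi.mul_apply, mul_assoc, hs, ENNReal.rpow_two, mul_pow] at h
  simp only [pow_two (w _ ^ (1 / 2 : ℝ)), hs] at h
  calc _ ≤ _ := pow_le_pow_left' h 2
    _ = _ := by
      rw [mul_pow, ← ENNReal.rpow_two, ← ENNReal.rpow_two, ← ENNReal.rpow_mul, ← ENNReal.rpow_mul]
      norm_num

/-- A Bessel inequality for a family that is bounded pointwise in `ℓ₁` and uniformly in `L₁`. -/
theorem sum_enorm_integral_mul_sq_le {α κ : Type*} [MeasurableSpace α] {μ : Measure α} [Fintype κ]
    {w : κ → α → ℝ} (hw : ∀ k, Measurable (w k)) {a b : ℝ≥0∞} (ha : ∀ x, ∑ k, ‖w k x‖ₑ ≤ a)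
    (hb : ∀ k, ∫⁻ x, ‖w k x‖ₑ ∂μ ≤ b) {f : α → ℂ} (hf : Measurable f) :
    ∑ k, ‖∫ x, (w k x : ℂ) * f x ∂μ‖ₑ ^ 2 ≤ a * b * ∫⁻ x, ‖f x‖ₑ ^ 2 ∂μ := by
  -- Schur test: half of $|w_k|$ stays with `f`, to be summed over `k` pointwise, and the other half
  -- is integrated out.
  have h1 : ∀ k, ‖∫ x, (w k x : ℂ) * f x ∂μ‖ₑ ^ 2 ≤ (∫⁻ x, ‖f x‖ₑ ^ 2 * ‖w k x‖ₑ ∂μ) * b := by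
    intro k
    refine le_trans (pow_le_pow_left' (enorm_integral_le_lintegral_enorm _) 2) ?_
    have e : ∀ x, ‖(w k x : ℂ) * f x‖ₑ = ‖f x‖ₑ * ‖w k x‖ₑ := by
      intro x
      rw [enorm_mul, mul_comm, ← ofReal_norm (w k x : ℂ), Complex.norm_real, ofReal_norm]
    simp only [e]
    exact (sq_lintegral_mul_le hf.enorm.aemeasurable (hw k).enorm.aemeasurable).trans
      (mul_le_mul' le_rfl (hb k))
  refine (Finset.sum_le_sum fun k _ => h1 k).trans ?_
  have hm : ∀ k ∈ Finset.univ, Measurable fun x => ‖f x‖ₑ ^ 2 * ‖w k x‖ₑ :=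
    fun k _ => (hf.enorm.pow_const 2).mul (hw k).enorm
  rw [← Finset.sum_mul, ← lintegral_finsetSum _ hm, mul_right_comm]
  refine mul_le_mul' ?_ le_rfl
  rw [← lintegral_const_mul _ (hf.enorm.pow_const 2)]
  refine lintegral_mono fun x => ?_
  simp only
  rw [← Finset.mul_sum, mul_comm]
  exact mul_le_mul' (ha x) le_rfl

/-- A trigonometric polynomial. -/
noncomputable def trigPoly (K : Finset ℤ) (c : ℤ → ℂ) (x : UnitAddCircle) : ℂ :=
  ∑ n ∈ K, c n * fourier n x

theorem continuous_trigPoly (K : Finset ℤ) (c : ℤ → ℂ) : Continuous (trigPoly K c) := by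
  unfold trigPoly
  fun_prop

theorem lintegral_trigPoly (K : Finset ℤ) (c : ℤ → ℂ) :
    ∫⁻ x, ‖trigPoly K c x‖ₑ ^ 2 ∂vol₁ = ∑ n ∈ K, ‖c n‖ₑ ^ 2 := by
  set F : Lp ℂ 2 vol₁ := ∑ n ∈ K, c n • fourierLp 2 n with hF
  have hae : F =ᵐ[vol₁] trigPoly K c := by
    have h1 := Lp.coeFn_fun_finsetSum K (fun n => c n • (fourierLp 2 n : Lp ℂ 2 vol₁))
    have h2 : ∀ᵐ x ∂vol₁, ∀ n : ℤ, (c n • (fourierLp 2 n : Lp ℂ 2 vol₁)) x = c n * fourier n x := by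
      rw [ae_all_iff]
      intro n
      filter_upwards [Lp.coeFn_smul (c n) (fourierLp 2 n : Lp ℂ 2 vol₁), coeFn_fourierLp 2 n]
        with x hx hx'
      rw [hx, Pi.smul_apply, hx', smul_eq_mul]
    filter_upwards [h1, h2] with x hx hx'
    rw [hF, hx, trigPoly]
    exact Finset.sum_congr rfl fun n _ => hx' n
  have hn : ‖F‖ ^ 2 = ∑ n ∈ K, ‖c n‖ ^ 2 := by
    have := (orthonormal_fourier (T := 1)).inner_sum c c K
    have h3 := inner_self_eq_norm_sq (𝕜 := ℂ) F
    rw [hF, this] at h3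
    rw [hF, ← h3]
    simp [Complex.conj_mul', ← Complex.ofReal_pow]
  have h4 : ∫⁻ x, ‖trigPoly K c x‖ₑ ^ 2 ∂vol₁ = eLpNorm F 2 vol₁ ^ 2 := by
    rw [eLpNorm_congr_ae hae, eLpNorm_eq_lintegral_rpow_enorm_toReal (by norm_num) (by norm_num), ← ENNReal.rpow_two,
      ← ENNReal.rpow_mul]
    simp
  rw [h4, ← Lp.enorm_def, ← ofReal_norm, ← ENNReal.ofReal_pow (norm_nonneg _), hn,
    ENNReal.ofReal_sum_of_nonneg fun _ _ => by positivity]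
  refine Finset.sum_congr rfl fun n _ => ?_
  rw [ENNReal.ofReal_pow (norm_nonneg _), ofReal_norm]

theorem integral_mul_trigPoly {w : UnitAddCircle → ℝ} (hw : Integrable w vol₁) (K : Finset ℤ)
    (c : ℤ → ℂ) :
    ∫ x, (w x : ℂ) * trigPoly K c x ∂vol₁ = ∑ n ∈ K, c n * ∫ x, (w x : ℂ) * fourier n x ∂vol₁ := by
  have hi : ∀ n ∈ K, Integrable (fun x => c n * ((w x : ℂ) * fourier n x)) vol₁ := by
    intro n _
    refine Integrable.const_mul ?_ _
    refine Integrable.mul_bdd (c := 1) hw.ofReal (fourier n).continuous.aestronglyMeasurable ?_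
    exact Filter.Eventually.of_forall fun x => (norm_fourier_apply n x).le
  simp only [← integral_const_mul]
  rw [← integral_finsetSum _ hi]
  refine integral_congr_ae (Filter.Eventually.of_forall fun x => ?_)
  simp only [trigPoly, Finset.mul_sum]
  exact Finset.sum_congr rfl fun n _ => by ring

theorem sum_enorm_fourier_sq_le {κ : Type*} [Fintype κ]
    {w : κ → UnitAddCircle → ℝ} (hw : ∀ k, Measurable (w k)) {a b : ℝ≥0∞} (hbt : b ≠ ∞)
    (ha : ∀ x, ∑ k, ‖w k x‖ₑ ≤ a)
    (hb : ∀ k, ∫⁻ x, ‖w k x‖ₑ ∂vol₁ ≤ b) (K : Finset ℤ) (c : ℤ → ℂ) :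
    ∑ k, ‖∑ n ∈ K, c n * ∫ x, (w k x : ℂ) * fourier n x ∂vol₁‖ₑ ^ 2
      ≤ a * b * ∑ n ∈ K, ‖c n‖ₑ ^ 2 := by
  have hi : ∀ k, Integrable (w k) vol₁ := fun k =>
    ⟨(hw k).aestronglyMeasurable, (hb k).trans_lt hbt.lt_top⟩
  rw [← lintegral_trigPoly]
  simp only [← integral_mul_trigPoly (hi _)]
  exact sum_enorm_integral_mul_sq_le hw ha hb (continuous_trigPoly K c).measurable

/-! ### Fourier coefficients of periodised wavelets -/

namespace BoundedOn

variable {φ : ℝ → ℝ} {B S : ℝ}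

theorem integrable_dilate (h : BoundedOn φ B S) (j k : ℤ) : Integrable (dilate φ j k) :=
  ⟨(measurable_dilate h.measurable j k).aestronglyMeasurable,
    (h.lintegral_enorm_dilate_le j k).trans_lt ENNReal.ofReal_lt_top⟩

theorem lintegral_periodization_dilate_le (h : BoundedOn φ B S) (j k : ℤ) :
    ∫⁻ x, ‖periodization (dilate φ j k) x‖ₑ ∂vol₁
      ≤ ENNReal.ofReal ((2 : ℝ) ^ (-(j : ℝ) / 2) * (B * S)) :=
  (lintegral_periodization_le (measurable_dilate h.measurable j k)).trans
    (h.lintegral_enorm_dilate_le j k)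

/-- Only the last integral involves `φ`. Replacing a function by its iterated antiderivative thus
changes the coefficient by a factor depending on `j` and `n` but not on the shift `k`. -/
theorem integral_periodization_dilate_mul_fourier (h : BoundedOn φ B S) (j k n : ℤ) :
    ∫ x, (periodization (dilate φ j k) x : ℂ) * fourier n x ∂vol₁
      = (((2 : ℝ) ^ ((j : ℝ) / 2) * |((2 : ℝ) ^ j)⁻¹| : ℝ) : ℂ) *
        Complex.exp (Complex.I * ((2 * Real.pi * n / 2 ^ j : ℝ) : ℂ) * k) *
        ∫ y, (φ y : ℂ) * Complex.exp (Complex.I * ((2 * Real.pi * n / 2 ^ j : ℝ) : ℂ) * y) := by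
  rw [integral_periodization_mul_fourier (h.integrable_dilate j k)
    (measurable_dilate h.measurable j k)]
  set ω : ℝ := 2 * Real.pi * n / 2 ^ j with hω
  have h2 : ((2 : ℝ) ^ j) ≠ 0 := by positivity
  have e1 : ∀ x : ℝ, (dilate φ j k x : ℂ) * fourier n (x : UnitAddCircle)
      = (((2 : ℝ) ^ ((j : ℝ) / 2) : ℝ) : ℂ) * (fun y : ℝ => (φ (y - k) : ℂ) *
        Complex.exp (Complex.I * ω * y)) ((2 : ℝ) ^ j * x) := by
    intro x
    rw [fourier_coe_apply, dilate]
    have : (2 * Real.pi * Complex.I * n * x / (1 : ℝ) : ℂ) = Complex.I * ω * ((2 : ℝ) ^ j * x : ℝ) := by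
      rw [hω]
      push_cast
      have h3 : ((2 : ℂ) ^ j) ≠ 0 := zpow_ne_zero _ two_ne_zero
      field_simp
    rw [this]
    push_cast
    ring
  simp only [e1]
  rw [integral_const_mul, Measure.integral_comp_mul_left (fun y : ℝ => (φ (y - k) : ℂ) *
        Complex.exp (Complex.I * ω * y))]
  have e2 : ∫ y : ℝ, (φ (y - k) : ℂ) * Complex.exp (Complex.I * ω * y)
      = Complex.exp (Complex.I * ω * k) * ∫ y, (φ y : ℂ) * Complex.exp (Complex.I * ω * y) := by
    rw [← integral_const_mul, ← integral_sub_right_eq_self (μ := volume) (fun y : ℝ =>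
      Complex.exp (Complex.I * ω * k) * ((φ y : ℂ) * Complex.exp (Complex.I * ω * y))) (k : ℝ)]
    refine integral_congr_ae (Filter.Eventually.of_forall fun y => ?_)
    simp only
    rw [mul_left_comm, ← Complex.exp_add]
    congr 2
    push_cast
    ring
  rw [e2, Complex.real_smul]
  push_cast
  ring

/-- The pointwise $\ell_1$ bound grows like $2^{j/2}$ and the $L_1$ bound decays like $2^{-j/2}$, so
the Bessel constant is independent of the level. -/
theorem sum_enorm_periodization_fourier_sq_le (h : BoundedOn φ B S) (hS : 0 ≤ S) {j : ℤ}
    (hj : 0 ≤ j) (K : Finset ℤ) (c : ℤ → ℂ) :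
    ∑ k : Shift j, ‖∑ n ∈ K, c n *
        ∫ x, (periodization (dilate φ j ((k : ℕ) : ℤ)) x : ℂ) * fourier n x ∂vol₁‖ₑ ^ 2
      ≤ ENNReal.ofReal (B * (S + 1) * (B * S)) * ∑ n ∈ K, ‖c n‖ₑ ^ 2 := by
  refine (sum_enorm_fourier_sq_le
    (fun k : Shift j => measurable_periodization (measurable_dilate h.measurable j ((k : ℕ) : ℤ)))
    ENNReal.ofReal_ne_top
    (h.sum_enorm_periodization_dilate_le hS hj)
    (fun k => h.lintegral_periodization_dilate_le j _) K c).trans (le_of_eq ?_)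
  have := h.nonneg
  rw [← ENNReal.ofReal_mul (by positivity)]
  congr 2
  have : (2 : ℝ) ^ ((j : ℝ) / 2) * (2 : ℝ) ^ (-(j : ℝ) / 2) = 1 := by
    rw [← Real.rpow_add zero_lt_two, neg_div, add_neg_cancel, Real.rpow_zero]
  linear_combination (B * (S + 1) * (B * S)) * this

end BoundedOn

/-! ### Univariate wavelet coefficients of trigonometric polynomials -/

/-- The damping of the frequency `n` on level `j` by `m` vanishing moments. -/
noncomputable def freqWeight (m : ℕ) (j n : ℤ) : ℝ :=
  min 1 (((1 + (n : ℝ) ^ 2) / 4 ^ j.toNat) ^ m)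

theorem wavelet_neg_one (ψ : ℝ → ℝ) (k : Shift (-1)) (x : UnitAddCircle) :
    wavelet ψ (-1) k x = 1 := by
  simp [wavelet]

theorem wavelet_of_nonneg (ψ : ℝ → ℝ) {j : ℤ} (hj : 0 ≤ j) (k : Shift j) :
    wavelet ψ j k = periodization (dilate ψ j ((k : ℕ) : ℤ)) := by
  rw [wavelet, if_neg (by omega)]

theorem measurable_wavelet {ψ : ℝ → ℝ} (hψ : Measurable ψ) (j : ℤ) (k : Shift j) :
    Measurable (wavelet ψ j k) := by
  unfold wavelet
  split_ifs
  · exact measurable_const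
  · exact measurable_periodization (measurable_dilate hψ _ _)

theorem enorm_add_sq_le {E : Type*} [SeminormedAddCommGroup E] (a b : E) :
    ‖a + b‖ₑ ^ 2 ≤ 2 * (‖a‖ₑ ^ 2 + ‖b‖ₑ ^ 2) := by
  have h : ‖a + b‖ ^ 2 ≤ 2 * (‖a‖ ^ 2 + ‖b‖ ^ 2) := by
    nlinarith [norm_add_le a b, norm_nonneg (a + b), sq_nonneg (‖a‖ - ‖b‖), norm_nonneg a,
      norm_nonneg b]
  have := ENNReal.ofReal_le_ofReal h
  rw [ENNReal.ofReal_mul zero_le_two, ENNReal.ofReal_add (by positivity) (by positivity),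
    ENNReal.ofReal_pow (norm_nonneg _), ENNReal.ofReal_pow (norm_nonneg _),
    ENNReal.ofReal_pow (norm_nonneg _)] at this
  simpa only [ofReal_norm, ENNReal.ofReal_ofNat] using this

/-- Frequencies are split at $1+n^2=4^j$. Above this threshold the plain Bessel inequality suffices;
below it the moments are used, through the Bessel inequality for the antiderivative. -/
theorem BoundedOn.sum_enorm_wavelet_sq_le {ψ : ℝ → ℝ} {B S : ℝ} (h : BoundedOn ψ B S) (hS : 0 ≤ S)
    {m : ℕ} (hmom : ∀ β < m, ∫ x : ℝ, ψ x * x ^ β = 0) :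
    ∃ C : ℝ≥0∞, C ≠ ∞ ∧ ∀ j : ℤ, -1 ≤ j → ∀ (K : Finset ℤ) (c : ℤ → ℂ),
      ∑ k : Shift j, ‖∑ n ∈ K, c n * ∫ x, (wavelet ψ j k x : ℂ) * fourier n x ∂vol₁‖ₑ ^ 2
        ≤ C * ∑ n ∈ K, ENNReal.ofReal (freqWeight m j n) * ‖c n‖ₑ ^ 2 := by
  obtain ⟨Φ, B', hΦ, hΦe⟩ := BoundedOn.exists_antiderivative hS m h hmom
  set D : ℝ≥0∞ := ENNReal.ofReal (B * (S + 1) * (B * S)) with hD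
  set D' : ℝ≥0∞ := ENNReal.ofReal (B' * (S + 1) * (B' * S)) with hD'
  set M : ℝ := (2 * Real.pi) ^ (2 * m) with hM
  refine ⟨1 + 2 * (D' * ENNReal.ofReal M + D), by finiteness, fun j hj K c => ?_⟩
  rcases eq_or_lt_of_le hj with rfl | hj1
  · have h1 := sum_enorm_fourier_sq_le (κ := Shift (-1)) (w := wavelet ψ (-1))
      (measurable_wavelet h.measurable (-1)) (a := 1) (b := 1) (by simp)
      (fun x => by simp [wavelet_neg_one]) (fun k => by simp [wavelet_neg_one]) K c
    refine h1.trans (mul_le_mul' ?_ (le_of_eq (Finset.sum_congr rfl fun n _ => ?_)))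
    · rw [one_mul]; exact le_self_add
    -- Level $-1$ has `toNat` equal to zero, so no damping is claimed there.
    · have : freqWeight m (-1) n = 1 := by
        refine min_eq_left ?_
        have : (1 : ℝ) ≤ (1 + (n : ℝ) ^ 2) / 4 ^ (-1 : ℤ).toNat := by
          simp; positivity
        exact one_le_pow₀ this
      rw [this, ENNReal.ofReal_one, one_mul]
  have hj0 : 0 ≤ j := by omega
  classical
  let P : ℤ → Prop := fun n => (1 + (n : ℝ) ^ 2) / 4 ^ j.toNat ≤ 1
  let a : Shift j → ℤ → ℂ := fun k n => ∫ x, (wavelet ψ j k x : ℂ) * fourier n x ∂vol₁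
  have hlow : ∑ k : Shift j, ‖∑ n ∈ K with P n, c n * a k n‖ₑ ^ 2
      ≤ D' * ENNReal.ofReal M * ∑ n ∈ K with P n, ENNReal.ofReal (freqWeight m j n) * ‖c n‖ₑ ^ 2 := by
    -- The multiplier produced by `m` antiderivatives. As it does not depend on `k`, it can be
    -- absorbed into the coefficients `c` before the Bessel inequality is applied.
    let θ : ℤ → ℂ := fun n => (-(Complex.I * ((2 * Real.pi * n / 2 ^ j : ℝ) : ℂ))) ^ m
    have ha : ∀ k n, c n * a k n = (c n * θ n) *
        ∫ x, (periodization (dilate Φ j ((k : ℕ) : ℤ)) x : ℂ) * fourier n x ∂vol₁ := by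
      intro k n
      simp only [a, wavelet_of_nonneg ψ hj0]
      rw [h.integral_periodization_dilate_mul_fourier, hΦ.integral_periodization_dilate_mul_fourier,
        hΦe]
      ring
    simp only [ha]
    refine (hΦ.sum_enorm_periodization_fourier_sq_le hS hj0 _ _).trans ?_
    rw [mul_assoc D']
    refine mul_le_mul' le_rfl ?_
    rw [Finset.mul_sum]
    refine Finset.sum_le_sum fun n hn => ?_
    rw [enorm_mul, mul_pow, mul_comm, ← mul_assoc]
    refine mul_le_mul' ?_ le_rfl
    rw [← ofReal_norm, ← ENNReal.ofReal_pow (norm_nonneg _), ← ENNReal.ofReal_mul (by positivity)]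
    refine ENNReal.ofReal_le_ofReal ?_
    have hw : freqWeight m j n = ((1 + (n : ℝ) ^ 2) / 4 ^ j.toNat) ^ m :=
      min_eq_right (pow_le_one₀ (by positivity) (Finset.mem_filter.1 hn).2)
    have h4 : ((2 : ℝ) ^ j) ^ 2 = 4 ^ j.toNat := by
      rw [← zpow_natCast 4 j.toNat, Int.toNat_of_nonneg hj0, ← zpow_natCast, ← zpow_mul, mul_comm,
        zpow_mul]
      norm_num
    rw [hw, hM, norm_pow, norm_neg, norm_mul, Complex.norm_I, one_mul, Complex.norm_real,
      ← pow_mul, mul_comm m 2, pow_mul, Real.norm_eq_abs, sq_abs, div_pow, h4, pow_mul (2 * Real.pi),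
      ← mul_pow]
    refine pow_le_pow_left₀ (by positivity) ?_ m
    rw [mul_pow (2 * Real.pi), ← mul_div_assoc]
    gcongr
    linarith
  have hhigh : ∑ k : Shift j, ‖∑ n ∈ K with ¬ P n, c n * a k n‖ₑ ^ 2
      ≤ D * ∑ n ∈ K with ¬ P n, ENNReal.ofReal (freqWeight m j n) * ‖c n‖ₑ ^ 2 := by
    have h1 := h.sum_enorm_periodization_fourier_sq_le hS hj0 (K.filter fun n => ¬ P n) c
    simp only [a, wavelet_of_nonneg ψ hj0]
    refine h1.trans (mul_le_mul' le_rfl (le_of_eq (Finset.sum_congr rfl fun n hn => ?_)))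
    have : freqWeight m j n = 1 :=
      min_eq_left (one_le_pow₀ (not_le.1 (Finset.mem_filter.1 hn).2).le)
    rw [this, ENNReal.ofReal_one, one_mul]
  calc ∑ k : Shift j, ‖∑ n ∈ K, c n * a k n‖ₑ ^ 2
      ≤ ∑ k : Shift j, 2 * (‖∑ n ∈ K with P n, c n * a k n‖ₑ ^ 2 +
          ‖∑ n ∈ K with ¬ P n, c n * a k n‖ₑ ^ 2) := by
        refine Finset.sum_le_sum fun k _ => ?_
        rw [← Finset.sum_filter_add_sum_filter_not K P]
        exact enorm_add_sq_le _ _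
    _ ≤ 2 * ((D' * ENNReal.ofReal M) * ∑ n ∈ K, ENNReal.ofReal (freqWeight m j n) * ‖c n‖ₑ ^ 2 +
          D * ∑ n ∈ K, ENNReal.ofReal (freqWeight m j n) * ‖c n‖ₑ ^ 2) := by
        rw [← Finset.mul_sum, Finset.sum_add_distrib]
        refine mul_le_mul' le_rfl (add_le_add ?_ ?_)
        · exact hlow.trans (mul_le_mul' le_rfl
            (Finset.sum_le_sum_of_subset (Finset.filter_subset _ _)))
        · exact hhigh.trans (mul_le_mul' le_rfl
            (Finset.sum_le_sum_of_subset (Finset.filter_subset _ _)))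
    _ ≤ _ := by
        rw [← add_mul, ← mul_assoc]
        exact mul_le_mul' le_add_self le_rfl

/-! ### Consequences of the wavelet assumptions -/

namespace IsWavelet

variable {ψ : ℝ → ℝ} {m : ℕ}

theorem exists_boundedOn (h : IsWavelet ψ m) : ∃ B S : ℝ, 0 ≤ S ∧ BoundedOn ψ B S := by
  obtain ⟨S, hS, hsupp⟩ := h.support
  obtain ⟨B, hB⟩ := h.bounded
  refine ⟨B, S, hS.le, h.measurable, hB, fun x hx => ?_⟩
  rw [← hsupp] at hx
  exact image_eq_zero_of_notMem_tsupport hx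

/-- The $\ell_2$ norm over shifts is at most the $\ell_1$ norm, which is of order $2^{j/2}$. -/
theorem exists_sum_enorm_le (h : IsWavelet ψ m) : ∃ C : ℝ≥0∞, C ≠ ∞ ∧ ∀ j : ℤ, -1 ≤ j → ∀ x,
    ∑ k : Shift j, ‖wavelet ψ j k x‖ₑ ^ 2 ≤ C * 2 ^ j.toNat := by
  obtain ⟨B, S, hS, hB⟩ := h.exists_boundedOn
  refine ⟨1 + ENNReal.ofReal (B * (S + 1)) ^ 2, by finiteness, fun j hj x => ?_⟩
  rcases eq_or_lt_of_le hj with rfl | hj1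
  · simp [wavelet_neg_one]
  have hj0 : 0 ≤ j := by omega
  simp only [wavelet_of_nonneg ψ hj0]
  have h1 := hB.sum_enorm_periodization_dilate_le hS hj0 x
  have h2 : ∑ k : Shift j, ‖periodization (dilate ψ j ((k : ℕ) : ℤ)) x‖ₑ ^ 2
      ≤ (∑ k : Shift j, ‖periodization (dilate ψ j ((k : ℕ) : ℤ)) x‖ₑ) ^ 2 := by
    rw [pow_two, Finset.sum_mul]
    refine Finset.sum_le_sum fun k hk => ?_
    rw [pow_two]
    exact mul_le_mul' le_rfl (Finset.single_le_sum (f := fun k : Shift j =>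
      ‖periodization (dilate ψ j ((k : ℕ) : ℤ)) x‖ₑ) (fun _ _ => zero_le) hk)
  refine (h2.trans (pow_le_pow_left' h1 2)).trans ?_
  have := hB.nonneg
  rw [ENNReal.ofReal_mul (by positivity), mul_pow, mul_comm]
  refine mul_le_mul' le_add_self (le_of_eq ?_)
  rw [← ENNReal.ofReal_pow (by positivity), ← Real.rpow_natCast, ← Real.rpow_mul zero_le_two]
  have : (j : ℝ) / 2 * (2 : ℕ) = (j.toNat : ℕ) := by
    push_cast
    rw [div_mul_cancel₀ _ two_ne_zero]
    exact_mod_cast (Int.toNat_of_nonneg hj0).symm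
  rw [this, Real.rpow_natCast, ENNReal.ofReal_pow zero_le_two]
  simp

theorem exists_enorm_wavelet_le (h : IsWavelet ψ m) {j : ℤ} (hj : -1 ≤ j) :
    ∃ C : ℝ, ∀ k x, ‖wavelet ψ j k x‖ ≤ C := by
  obtain ⟨C, hC, hle⟩ := h.exists_sum_enorm_le
  refine ⟨1 + (C * 2 ^ j.toNat).toReal, fun k x => ?_⟩
  have h1 : ‖wavelet ψ j k x‖ₑ ^ 2 ≤ C * 2 ^ j.toNat :=
    (Finset.single_le_sum (f := fun k : Shift j => ‖wavelet ψ j k x‖ₑ ^ 2) (fun _ _ => zero_le)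
      (Finset.mem_univ k)).trans (hle j hj x)
  have h2 := ENNReal.toReal_mono (by finiteness) h1
  rw [ENNReal.toReal_pow, toReal_enorm] at h2
  nlinarith [norm_nonneg (wavelet ψ j k x)]

theorem integrable_wavelet_mul (h : IsWavelet ψ m) {i j : ℤ} (hi : -1 ≤ i) (hj : -1 ≤ j)
    (k : Shift i) (l : Shift j) : Integrable (fun x => wavelet ψ i k x * wavelet ψ j l x) vol₁ := by
  obtain ⟨C, hC⟩ := h.exists_enorm_wavelet_le hi
  obtain ⟨C', hC'⟩ := h.exists_enorm_wavelet_le hj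
  have h1 : Integrable (wavelet ψ j l) vol₁ :=
    Integrable.of_bound (measurable_wavelet h.measurable j l).aestronglyMeasurable C'
      (Filter.Eventually.of_forall fun x => hC' l x)
  exact h1.bdd_mul (c := C) (measurable_wavelet h.measurable i k).aestronglyMeasurable
    (Filter.Eventually.of_forall fun x => hC k x)

theorem integrable_wavelet (h : IsWavelet ψ m) {j : ℤ} (hj : -1 ≤ j) (k : Shift j) :
    Integrable (wavelet ψ j k) vol₁ := by
  obtain ⟨C, hC⟩ := h.exists_enorm_wavelet_le hj
  exact Integrable.of_bound (measurable_wavelet h.measurable j k).aestronglyMeasurable C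
      (Filter.Eventually.of_forall fun x => hC k x)

/-! ### Gram matrices and dual wavelets -/

theorem exists_riesz_lower (h : IsWavelet ψ m) : ∃ γ : ℝ, 0 < γ ∧ ∀ j : ℤ, -1 ≤ j →
    ∀ c : Shift j → ℂ, γ * ∑ k, ‖c k‖ ^ 2 ≤ ∫ x, ‖∑ k, c k * (wavelet ψ j k x : ℂ)‖ ^ 2 ∂vol₁ := by
  obtain ⟨γ, δ, hγ, hδ, hr⟩ := h.riesz
  -- The Riesz assumption starts at level $0$; the constant function on level $-1$ contributes the
  -- bound $1$.
  refine ⟨min γ 1, lt_min hγ one_pos, fun j hj c => ?_⟩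
  rcases eq_or_lt_of_le hj with rfl | hj1
  · have e : ∀ f : Shift (-1) → ℝ, ∑ k, f k = f 0 := fun f => Fin.sum_univ_one f
    have e' : ∀ f : Shift (-1) → ℂ, ∑ k, f k = f 0 := fun f => Fin.sum_univ_one f
    simp only [wavelet_neg_one, e, e']
    simp only [Complex.ofReal_one, mul_one, integral_const, probReal_univ, one_smul]
    exact mul_le_of_le_one_left (by positivity) (min_le_right _ _)
  · exact (mul_le_mul_of_nonneg_right (min_le_left _ _) (by positivity)).trans
      (hr j (by omega) c).1

theorem integral_normSq_eq (h : IsWavelet ψ m) {j : ℤ} (hj : -1 ≤ j) (c : Shift j → ℂ) :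
    ((∫ x, ‖∑ k, c k * (wavelet ψ j k x : ℂ)‖ ^ 2 ∂vol₁ : ℝ) : ℂ)
      = ∑ k, (starRingEnd ℂ) (c k) * ∑ l, (gram ψ j k l : ℂ) * c l := by
  rw [← integral_complex_ofReal]
  have e : ∀ x, ((‖∑ k, c k * (wavelet ψ j k x : ℂ)‖ ^ 2 : ℝ) : ℂ)
      = ∑ k, ∑ l, ((starRingEnd ℂ) (c k) * c l) * ((wavelet ψ j k x * wavelet ψ j l x : ℝ) : ℂ) := by
    intro x
    push_cast
    rw [← Complex.conj_mul', map_sum, Finset.sum_mul_sum]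
    refine Finset.sum_congr rfl fun k _ => Finset.sum_congr rfl fun l _ => ?_
    rw [map_mul, Complex.conj_ofReal]
    ring
  simp only [e]
  have hi : ∀ k l : Shift j, Integrable (fun x => ((starRingEnd ℂ) (c k) * c l) *
      ((wavelet ψ j k x * wavelet ψ j l x : ℝ) : ℂ)) vol₁ := fun k l =>
    ((h.integrable_wavelet_mul hj hj k l).ofReal).const_mul _
  rw [integral_finsetSum _ fun k _ => integrable_finsetSum _ fun l _ => hi k l]
  refine Finset.sum_congr rfl fun k _ => ?_
  rw [integral_finsetSum _ fun l _ => hi k l, Finset.mul_sum]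
  refine Finset.sum_congr rfl fun l _ => ?_
  rw [integral_const_mul, integral_complex_ofReal]
  simp only [gram, Matrix.of_apply]
  ring

/-- A kernel vector would be the coefficient vector of a combination of zero norm, against the Riesz
lower bound. -/
theorem isUnit_det_gram (h : IsWavelet ψ m) {j : ℤ} (hj : -1 ≤ j) : IsUnit (gram ψ j).det := by
  rw [isUnit_iff_ne_zero]
  intro h0
  obtain ⟨v, hv, hv0⟩ := Matrix.exists_mulVec_eq_zero_iff.2 h0
  obtain ⟨γ, hγ, hr⟩ := h.exists_riesz_lower
  have h1 := h.integral_normSq_eq hj (fun k => (v k : ℂ))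
  have h2 : ∀ k, ∑ l, (gram ψ j k l : ℂ) * (v l : ℂ) = 0 := by
    intro k
    have := congrFun hv0 k
    simp only [Matrix.mulVec, dotProduct, Pi.zero_apply] at this
    exact_mod_cast this
  simp only [h2, mul_zero, Finset.sum_const_zero, Complex.ofReal_eq_zero] at h1
  have h3 := hr j hj (fun k => (v k : ℂ))
  rw [h1] at h3
  have h4 : ∑ k, ‖(v k : ℂ)‖ ^ 2 = 0 :=
    le_antisymm (nonpos_of_mul_nonpos_right h3 hγ) (Finset.sum_nonneg fun _ _ => by positivity)
  refine hv (funext fun k => ?_)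
  have := (Finset.sum_eq_zero_iff_of_nonneg fun _ _ => by positivity).1 h4 k (Finset.mem_univ k)
  simpa using this

theorem gram_symm (ψ : ℝ → ℝ) (j : ℤ) (k l : Shift j) : gram ψ j k l = gram ψ j l k := by
  simp only [gram, Matrix.of_apply, mul_comm]

theorem sum_gram_mul_dualWavelet (h : IsWavelet ψ m) {j : ℤ} (hj : -1 ≤ j) (k : Shift j)
    (x : UnitAddCircle) : ∑ l, gram ψ j k l * dualWavelet ψ j l x = wavelet ψ j k x := by
  have h1 := Matrix.mul_nonsing_inv (gram ψ j) (h.isUnit_det_gram hj)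
  have h2 : (dualWavelet ψ j · x) = (gram ψ j)⁻¹.mulVec (wavelet ψ j · x) := rfl
  have h3 : (gram ψ j).mulVec (dualWavelet ψ j · x) = (wavelet ψ j · x) := by
    rw [h2, Matrix.mulVec_mulVec, h1, Matrix.one_mulVec]
  exact congrFun h3 k

/-- The inverse Gram matrices are uniformly bounded. -/
theorem exists_sum_inv_gram_sq_le (h : IsWavelet ψ m) : ∃ C : ℝ≥0∞, C ≠ ∞ ∧ ∀ j : ℤ, -1 ≤ j →
    ∀ v : Shift j → ℂ, ∑ k, ‖∑ l, ((gram ψ j)⁻¹ k l : ℂ) * v l‖ₑ ^ 2 ≤ C * ∑ k, ‖v k‖ₑ ^ 2 := by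
  obtain ⟨γ, hγ, hr⟩ := h.exists_riesz_lower
  refine ⟨ENNReal.ofReal (γ⁻¹ ^ 2), ENNReal.ofReal_ne_top, fun j hj v => ?_⟩
  set c : Shift j → ℂ := fun k => ∑ l, ((gram ψ j)⁻¹ k l : ℂ) * v l with hc
  have hG : ∀ k, ∑ l, (gram ψ j k l : ℂ) * c l = v k := by
    intro k
    have h1 := Matrix.mul_nonsing_inv (gram ψ j) (h.isUnit_det_gram hj)
    have h2 : (gram ψ j).map (Complex.ofRealHom) * (gram ψ j)⁻¹.map Complex.ofRealHom = 1 := by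
      rw [← Matrix.map_mul, h1, Matrix.map_one _ (map_zero _) (map_one _)]
    have h3 : ((gram ψ j).map (Complex.ofRealHom)).mulVec
        (((gram ψ j)⁻¹.map Complex.ofRealHom).mulVec v) = v := by
      rw [Matrix.mulVec_mulVec, h2, Matrix.one_mulVec]
    exact congrFun h3 k
  have h1 := h.integral_normSq_eq hj c
  simp only [hG] at h1
  have h2 := hr j hj c
  set X : ℝ := ∑ k, ‖c k‖ ^ 2 with hX
  set Y : ℝ := ∑ k, ‖v k‖ ^ 2 with hY
  have hX0 : 0 ≤ X := Finset.sum_nonneg fun _ _ => by positivity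
  have hY0 : 0 ≤ Y := Finset.sum_nonneg fun _ _ => by positivity
  have h3 : ∫ x, ‖∑ k, c k * (wavelet ψ j k x : ℂ)‖ ^ 2 ∂vol₁ ≤ ∑ k, ‖c k‖ * ‖v k‖ := by
    have := congrArg norm h1
    rw [Complex.norm_real, Real.norm_eq_abs] at this
    refine (le_abs_self _).trans (this.le.trans ((norm_sum_le _ _).trans (le_of_eq ?_)))
    exact Finset.sum_congr rfl fun k _ => by rw [norm_mul, RCLike.norm_conj]
  -- With $v=Gc$ one has $\gamma\|c\|^2\le c^*Gc=c^*v$, and Cauchy–Schwarz finishes.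
  have h4 : (γ * X) ^ 2 ≤ X * Y :=
    (pow_le_pow_left₀ (by positivity) (h2.trans h3) 2).trans
      (Finset.sum_mul_sq_le_sq_mul_sq _ _ _)
  have h5 : X ≤ γ⁻¹ ^ 2 * Y := by
    rcases hX0.eq_or_lt with h0 | h0
    · rw [← h0]; positivity
    · rw [inv_pow, inv_mul_eq_div, le_div_iff₀ (by positivity)]
      nlinarith
  have h6 := ENNReal.ofReal_le_ofReal h5
  rw [ENNReal.ofReal_mul (by positivity), hX, hY,
    ENNReal.ofReal_sum_of_nonneg fun _ _ => by positivity,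
    ENNReal.ofReal_sum_of_nonneg fun _ _ => by positivity] at h6
  simpa only [ENNReal.ofReal_pow (norm_nonneg _), ofReal_norm] using h6

theorem measurable_dualWavelet (h : IsWavelet ψ m) (j : ℤ) (k : Shift j) :
    Measurable (dualWavelet ψ j k) := by
  unfold dualWavelet
  exact Finset.measurable_fun_sum _ fun l _ => (measurable_wavelet h.measurable j l).const_mul _

theorem exists_enorm_dualWavelet_le (h : IsWavelet ψ m) {j : ℤ} (hj : -1 ≤ j) (k : Shift j) :
    ∃ C : ℝ, ∀ x, ‖dualWavelet ψ j k x‖ ≤ C := by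
  obtain ⟨C, hC⟩ := h.exists_enorm_wavelet_le hj
  refine ⟨∑ l, ‖(gram ψ j)⁻¹ k l‖ * C, fun x => (norm_sum_le _ _).trans ?_⟩
  refine Finset.sum_le_sum fun l _ => ?_
  rw [norm_mul]
  exact mul_le_mul_of_nonneg_left (hC l x) (norm_nonneg _)

/-- The pairing of a univariate dual wavelet with an exponential. -/
noncomputable def _root_.HyperbolicWavelet.dualFourier (ψ : ℝ → ℝ) (j : ℤ) (k : Shift j) (n : ℤ) :
    ℂ :=
  ∫ x, (dualWavelet ψ j k x : ℂ) * fourier n x ∂vol₁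

theorem dualFourier_eq (h : IsWavelet ψ m) {j : ℤ} (hj : -1 ≤ j) (k : Shift j) (n : ℤ) :
    dualFourier ψ j k n
      = ∑ l, ((gram ψ j)⁻¹ k l : ℂ) * ∫ x, (wavelet ψ j l x : ℂ) * fourier n x ∂vol₁ := by
  simp only [← integral_const_mul]
  rw [← integral_finsetSum, dualFourier]
  · refine integral_congr_ae (Filter.Eventually.of_forall fun x => ?_)
    simp only [dualWavelet]
    push_cast
    rw [Finset.sum_mul]
    exact Finset.sum_congr rfl fun l _ => by ring
  · intro l _
    refine Integrable.const_mul ?_ _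
    exact Integrable.mul_bdd (c := 1) (h.integrable_wavelet hj l).ofReal
      (fourier n).continuous.aestronglyMeasurable
      (Filter.Eventually.of_forall fun x => (norm_fourier_apply n x).le)

/-- The inverse Gram matrix acts on the shifts only, so its uniform bound carries the frequency
damping from wavelets to dual wavelets. -/
theorem exists_sum_dualFourier_sq_le (h : IsWavelet ψ m) : ∃ C : ℝ≥0∞, C ≠ ∞ ∧ ∀ j : ℤ, -1 ≤ j →
    ∀ (K : Finset ℤ) (c : ℤ → ℂ), ∑ k : Shift j, ‖∑ n ∈ K, c n * dualFourier ψ j k n‖ₑ ^ 2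
      ≤ C * ∑ n ∈ K, ENNReal.ofReal (freqWeight m j n) * ‖c n‖ₑ ^ 2 := by
  obtain ⟨B, S, hS, hB⟩ := h.exists_boundedOn
  obtain ⟨C, hC, hle⟩ := hB.sum_enorm_wavelet_sq_le hS h.moments
  obtain ⟨C', hC', hle'⟩ := h.exists_sum_inv_gram_sq_le
  refine ⟨C' * C, by finiteness, fun j hj K c => ?_⟩
  have e : ∀ k : Shift j, ∑ n ∈ K, c n * dualFourier ψ j k n = ∑ l, ((gram ψ j)⁻¹ k l : ℂ) *
      ∑ n ∈ K, c n * ∫ x, (wavelet ψ j l x : ℂ) * fourier n x ∂vol₁ := by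
    intro k
    simp only [h.dualFourier_eq hj, Finset.mul_sum]
    rw [Finset.sum_comm]
    exact Finset.sum_congr rfl fun l _ => Finset.sum_congr rfl fun n _ => by ring
  simp only [e]
  refine (hle' j hj _).trans ?_
  rw [mul_assoc]
  exact mul_le_mul' le_rfl (hle j hj K c)

end IsWavelet

/-! ### Fourier series on the torus -/

variable {d : ℕ}

theorem mFourierCoeff_eq (f : UnitAddTorus (Fin d) → ℂ) (n : Fin d → ℤ) :
    UnitAddTorus.mFourierCoeff f n = ∫ x, UnitAddTorus.mFourier (-n) x * f x ∂vol d := rfl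

theorem mFourierCoeff_congr_ae {f g : UnitAddTorus (Fin d) → ℂ} (h : f =ᵐ[vol d] g)
    (n : Fin d → ℤ) : UnitAddTorus.mFourierCoeff f n = UnitAddTorus.mFourierCoeff g n := by
  rw [mFourierCoeff_eq, mFourierCoeff_eq]
  refine integral_congr_ae ?_
  filter_upwards [h] with x hx
  rw [hx]

theorem hasSum_mFourierCoeff_mul {f g : UnitAddTorus (Fin d) → ℂ} (hf : MemLp f 2 (vol d))
    (hg : MemLp g 2 (vol d)) :
    HasSum (fun n => (starRingEnd ℂ) (UnitAddTorus.mFourierCoeff g n) *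
      UnitAddTorus.mFourierCoeff f n) (∫ x, (starRingEnd ℂ) (g x) * f x ∂vol d) := by
  have h : HasSum (fun n => (starRingEnd ℂ) (UnitAddTorus.mFourierCoeff (hg.toLp g) n) *
      UnitAddTorus.mFourierCoeff (hf.toLp f) n)
      (∫ x, (starRingEnd ℂ) (hg.toLp g x) * hf.toLp f x ∂vol d) :=
    UnitAddTorus.hasSum_prod_mFourierCoeff (d := Fin d) (hg.toLp g) (hf.toLp f)
  simp only [mFourierCoeff_congr_ae hg.coeFn_toLp, mFourierCoeff_congr_ae hf.coeFn_toLp] at h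
  convert! h using 1
  refine integral_congr_ae ?_
  filter_upwards [hg.coeFn_toLp, hf.coeFn_toLp] with x hx hx'
  rw [hx, hx']

theorem tsum_enorm_mFourierCoeff_sq {f : UnitAddTorus (Fin d) → ℂ} (hf : MemLp f 2 (vol d)) :
    ∑' n, ‖UnitAddTorus.mFourierCoeff f n‖ₑ ^ 2 = eLpNorm f 2 (vol d) ^ 2 := by
  have h : HasSum (fun n => ‖UnitAddTorus.mFourierCoeff (hf.toLp f) n‖ ^ 2)
      (∫ x, ‖hf.toLp f x‖ ^ 2 ∂vol d) :=
    UnitAddTorus.hasSum_sq_mFourierCoeff (d := Fin d) (hf.toLp f)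
  simp only [mFourierCoeff_congr_ae hf.coeFn_toLp] at h
  have h1 := congrArg ENNReal.ofReal h.tsum_eq
  rw [ENNReal.ofReal_tsum_of_nonneg (fun _ => by positivity) h.summable] at h1
  simp only [ENNReal.ofReal_pow (norm_nonneg _), ofReal_norm] at h1
  rw [h1]
  have h2 : ∫ x, ‖hf.toLp f x‖ ^ 2 ∂vol d = ∫ x, ‖f x‖ ^ 2 ∂vol d := by
    refine integral_congr_ae ?_
    filter_upwards [hf.coeFn_toLp] with x hx
    rw [hx]
  rw [h2, ofReal_integral_eq_lintegral_ofReal hf.integrable_norm_pow'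
    (Filter.Eventually.of_forall fun _ => by positivity),
    eLpNorm_eq_lintegral_rpow_enorm_toReal (by norm_num) (by norm_num), ← ENNReal.rpow_two,
      ← ENNReal.rpow_mul]
  simp [ENNReal.ofReal_pow (norm_nonneg _)]

theorem ae_eq_zero_of_mFourierCoeff_eq_zero {f : UnitAddTorus (Fin d) → ℂ}
    (hf : MemLp f 2 (vol d)) (h : ∀ n, UnitAddTorus.mFourierCoeff f n = 0) : f =ᵐ[vol d] 0 := by
  have h1 := tsum_enorm_mFourierCoeff_sq hf
  simp only [h, enorm_zero, ne_eq, OfNat.ofNat_ne_zero, not_false_eq_true, zero_pow,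
    tsum_zero] at h1
  exact (eLpNorm_eq_zero_iff hf.1 two_ne_zero).1 (eq_zero_of_pow_eq_zero h1.symm)

/-- Pairing with a real valued tensor product, in terms of Fourier coefficients. -/
theorem hasSum_mFourierCoeff_mul_prod {f : UnitAddTorus (Fin d) → ℂ} (hf : MemLp f 2 (vol d))
    {w : Fin d → UnitAddCircle → ℝ} (hw : ∀ i, Measurable (w i)) {C : Fin d → ℝ}
    (hC : ∀ i x, ‖w i x‖ ≤ C i) :
    HasSum (fun n => UnitAddTorus.mFourierCoeff f n * ∏ i, ∫ x, (w i x : ℂ) * fourier (n i) x ∂vol₁)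
      (∫ x, f x * ((∏ i, w i (x i) : ℝ) : ℂ) ∂vol d) := by
  have hg : MemLp (fun x : UnitAddTorus (Fin d) => ((∏ i, w i (x i) : ℝ) : ℂ)) 2 (vol d) := by
    refine MemLp.of_bound (C := ∏ i, C i) ?_ (Filter.Eventually.of_forall fun x => ?_)
    · refine (Complex.measurable_ofReal.comp ?_).aestronglyMeasurable
      exact Finset.measurable_fun_prod _ fun i _ => (hw i).comp (measurable_pi_apply i)
    · rw [Complex.norm_real, norm_prod]
      exact Finset.prod_le_prod (fun _ _ => norm_nonneg _) fun i _ => hC i _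
  have h := hasSum_mFourierCoeff_mul hf hg
  simp only [Complex.conj_ofReal] at h
  convert! h using 1
  · funext n
    rw [mul_comm]
    congr 1
    rw [mFourierCoeff_eq, ← integral_conj, ← integral_fintype_prod_eq_prod
      (μ := fun _ : Fin d => vol₁) (fun i x => (w i x : ℂ) * fourier (n i) x)]
    refine integral_congr_ae (Filter.Eventually.of_forall fun x => ?_)
    simp only [map_mul, UnitAddTorus.mFourier_neg, Complex.conj_conj, Complex.conj_ofReal]
    rw [Finset.prod_mul_distrib, mul_comm]
    simp [UnitAddTorus.mFourier]
  · refine integral_congr_ae (Filter.Eventually.of_forall fun x => ?_)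
    simp only [mul_comm]

/-! ### Tensor products of bounded matrices -/

theorem sum_piFinset_succ {M : Type*} [AddCommMonoid M] (K : Finset ℤ)
    (f : (Fin (d + 1) → ℤ) → M) :
    ∑ l ∈ Fintype.piFinset fun _ : Fin (d + 1) => K, f l
      = ∑ l ∈ Fintype.piFinset fun _ : Fin d => K, ∑ a ∈ K, f (Fin.cons a l) := by
  rw [← Finset.sum_product']
  refine Finset.sum_nbij' (fun l => (Fin.tail l, l 0)) (fun p => Fin.cons p.2 p.1) ?_ ?_ ?_ ?_ ?_
  · intro l hl
    rw [Fintype.mem_piFinset] at hl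
    simp only [Finset.mem_product, Fintype.mem_piFinset]
    exact ⟨fun i => hl i.succ, hl 0⟩
  · intro p hp
    simp only [Finset.mem_product, Fintype.mem_piFinset] at hp
    rw [Fintype.mem_piFinset]
    intro i
    refine Fin.cases ?_ (fun i => ?_) i
    · simpa using hp.2
    · simpa using hp.1 i
  · intro l _
    simp
  · intro p _
    simp
  · intro l _
    simp

/-- A tensor product of operators bounded between weighted $\ell_2$ spaces is bounded by the product
of the bounds. In the induction the first variable is contracted, the bound for the others is
applied for each fixed `k0`, and after exchanging sums the univariate bound is used for each
remaining frequency. -/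
theorem sum_enorm_tensor_sq_le {C : ℝ≥0∞} (K : Finset ℤ) : ∀ {d : ℕ} {κ : Fin d → Type}
    [∀ i, Fintype (κ i)] (A : (i : Fin d) → κ i → ℤ → ℂ) (w : Fin d → ℤ → ℝ≥0∞),
    (∀ i (c : ℤ → ℂ), ∑ k, ‖∑ n ∈ K, c n * A i k n‖ₑ ^ 2 ≤ C * ∑ n ∈ K, w i n * ‖c n‖ₑ ^ 2) →
    ∀ c : (Fin d → ℤ) → ℂ,
      ∑ k : (i : Fin d) → κ i, ‖∑ l ∈ Fintype.piFinset fun _ => K, c l * ∏ i, A i (k i) (l i)‖ₑ ^ 2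
        ≤ C ^ d * ∑ l ∈ Fintype.piFinset fun _ => K, (∏ i, w i (l i)) * ‖c l‖ₑ ^ 2 := by
  intro d
  induction d with
  | zero =>
    intro κ _ A w _ c
    simp
  | succ d ih =>
    intro κ _ A w hA c
    have ih' := ih (fun i => A i.succ) (fun i => w i.succ) (fun i => hA i.succ)
    rw [← (Fin.consEquiv κ).sum_comp, Fintype.sum_prod_type]
    calc ∑ k0 : κ 0, ∑ k : (i : Fin d) → κ i.succ,
          ‖∑ l ∈ Fintype.piFinset fun _ => K, c l * ∏ i, A i (Fin.consEquiv κ (k0, k) i) (l i)‖ₑ ^ 2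
        = ∑ k0 : κ 0, ∑ k : (i : Fin d) → κ i.succ,
          ‖∑ l ∈ Fintype.piFinset fun _ : Fin d => K, (∑ a ∈ K, c (Fin.cons a l) * A 0 k0 a) *
            ∏ i : Fin d, A i.succ (k i) (l i)‖ₑ ^ 2 := by
          refine Finset.sum_congr rfl fun k0 _ => Finset.sum_congr rfl fun k _ => ?_
          rw [sum_piFinset_succ]
          congr 2
          refine Finset.sum_congr rfl fun l _ => ?_
          rw [Finset.sum_mul]
          refine Finset.sum_congr rfl fun a _ => ?_
          rw [Fin.prod_univ_succ]
          simp [Fin.consEquiv, mul_assoc]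
      _ ≤ ∑ k0 : κ 0, C ^ d * ∑ l ∈ Fintype.piFinset fun _ : Fin d => K,
            (∏ i : Fin d, w i.succ (l i)) * ‖∑ a ∈ K, c (Fin.cons a l) * A 0 k0 a‖ₑ ^ 2 :=
          Finset.sum_le_sum fun k0 _ => ih' fun l => ∑ a ∈ K, c (Fin.cons a l) * A 0 k0 a
      _ = C ^ d * ∑ l ∈ Fintype.piFinset fun _ : Fin d => K, (∏ i : Fin d, w i.succ (l i)) *
            ∑ k0 : κ 0, ‖∑ a ∈ K, c (Fin.cons a l) * A 0 k0 a‖ₑ ^ 2 := by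
          rw [← Finset.mul_sum, Finset.sum_comm]
          simp only [Finset.mul_sum]
      _ ≤ C ^ d * ∑ l ∈ Fintype.piFinset fun _ : Fin d => K, (∏ i : Fin d, w i.succ (l i)) *
            (C * ∑ a ∈ K, w 0 a * ‖c (Fin.cons a l)‖ₑ ^ 2) :=
          mul_le_mul' le_rfl (Finset.sum_le_sum fun l _ => mul_le_mul' le_rfl
            (hA 0 fun a => c (Fin.cons a l)))
      _ = _ := by
          rw [sum_piFinset_succ, pow_succ, mul_assoc, Finset.mul_sum _ _ C]
          congr 1
          refine Finset.sum_congr rfl fun l _ => ?_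
          rw [mul_left_comm]
          congr 1
          rw [Finset.mul_sum]
          refine Finset.sum_congr rfl fun a _ => ?_
          rw [Fin.prod_univ_succ]
          simp only [Fin.cons_zero, Fin.cons_succ]
          ring

theorem tendsto_piFinset_atTop :
    Filter.Tendsto (fun K : Finset ℤ => Fintype.piFinset fun _ : Fin d => K) Filter.atTop
      Filter.atTop := by
  refine Filter.tendsto_atTop_finset_of_monotone ?_ ?_
  · intro K K' h
    exact Fintype.piFinset_subset _ _ fun _ => h
  · intro l
    refine ⟨Finset.univ.image l, ?_⟩
    rw [Fintype.mem_piFinset]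
    exact fun i => Finset.mem_image_of_mem l (Finset.mem_univ i)

namespace IsWavelet

variable {ψ : ℝ → ℝ} {m : ℕ}

/-- The wavelet coefficients of level `𝐣` are controlled by the damped Fourier coefficients. -/
theorem exists_sum_coefficient_sq_le (h : IsWavelet ψ m) (d : ℕ) : ∃ C : ℝ≥0∞, C ≠ ∞ ∧
    ∀ f : UnitAddTorus (Fin d) → ℂ, MemLp f 2 (vol d) → ∀ j : Fin d → ℤ, (∀ i, -1 ≤ j i) →
      ∑ k, ‖coefficient ψ f j k‖ₑ ^ 2 ≤ C * ∑' l : Fin d → ℤ,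
        (∏ i, ENNReal.ofReal (freqWeight m (j i) (l i))) *
          ‖UnitAddTorus.mFourierCoeff f l‖ₑ ^ 2 := by
  obtain ⟨C, hC, hle⟩ := h.exists_sum_dualFourier_sq_le
  refine ⟨C ^ d, by finiteness, fun f hf j hj => ?_⟩
  have hlim : ∀ k : (i : Fin d) → Shift (j i), Filter.Tendsto (fun K : Finset ℤ =>
      ∑ l ∈ Fintype.piFinset fun _ : Fin d => K, UnitAddTorus.mFourierCoeff f l *
        ∏ i, dualFourier ψ (j i) (k i) (l i)) Filter.atTop (nhds (coefficient ψ f j k)) := by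
    intro k
    choose B hB using fun i => h.exists_enorm_dualWavelet_le (hj i) (k i)
    exact (hasSum_mFourierCoeff_mul_prod hf (fun i => h.measurable_dualWavelet (j i) (k i))
      hB).comp tendsto_piFinset_atTop
  -- The tensor estimate holds for frequencies in a cube, with a right side at most the full series;
  -- the cubes then exhaust $\mathbb Z^d$.
  refine le_of_tendsto (tendsto_finsetSum _ fun k _ =>
    ((ENNReal.continuous_pow 2).tendsto _).comp (hlim k).enorm) (Filter.Eventually.of_forall
    fun K => ?_)
  refine (sum_enorm_tensor_sq_le K (fun i => dualFourier ψ (j i))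
    (fun i n => ENNReal.ofReal (freqWeight m (j i) n)) (fun i c => hle (j i) (hj i) K c)
    (UnitAddTorus.mFourierCoeff f)).trans ?_
  exact mul_le_mul' le_rfl (ENNReal.sum_le_tsum _)

end IsWavelet

/-! ### Totality of the tensor wavelets -/

theorem lintegral_enorm_mul_le {α : Type*} [MeasurableSpace α] {μ : Measure α} {f g : α → ℂ}
    (hf : AEStronglyMeasurable f μ) (hg : AEStronglyMeasurable g μ) :
    ∫⁻ x, ‖f x * g x‖ₑ ∂μ ≤ eLpNorm f 2 μ * eLpNorm g 2 μ := by
  have h := ENNReal.lintegral_mul_le_Lp_mul_Lq μ (p := 2) (q := 2)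
    (by constructor <;> norm_num) hf.enorm hg.enorm
  rw [eLpNorm_eq_lintegral_rpow_enorm_toReal (by norm_num) (by norm_num),
    eLpNorm_eq_lintegral_rpow_enorm_toReal (by norm_num) (by norm_num)]
  simpa [enorm_mul] using h

namespace IsWavelet

variable {ψ : ℝ → ℝ} {m : ℕ}

/-- Density in one variable suffices: composing with a coordinate projection preserves $L_2$ norms,
so an approximation of the exponential on the circle pairs with `G` up to an arbitrarily small
error. -/
theorem integral_mul_fourier_eval_eq_zero (h : IsWavelet ψ m) {G : UnitAddTorus (Fin d) → ℂ}
    (hG : MemLp G 2 (vol d)) (i : Fin d)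
    (h0 : ∀ j : ℤ, -1 ≤ j → ∀ k, ∫ x, G x * (wavelet ψ j k (x i) : ℂ) ∂vol d = 0) (n : ℤ) :
    ∫ x, G x * fourier n (x i) ∂vol d = 0 := by
  have hmp : MeasurePreserving (fun x : UnitAddTorus (Fin d) => x i) (vol d) vol₁ :=
    measurePreserving_eval (fun _ : Fin d => vol₁) i
  have hF : MemLp (fourier n : UnitAddCircle → ℂ) 2 vol₁ :=
    MemLp.of_bound (fourier n).continuous.aestronglyMeasurable 1
      (Filter.Eventually.of_forall fun x => (norm_fourier_apply n x).le)
  have key : ∀ ε : ℝ≥0∞, 0 < ε →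
      ‖∫ x, G x * fourier n (x i) ∂vol d‖ₑ ≤ eLpNorm G 2 (vol d) * ε := by
    intro ε hε
    obtain ⟨N, c, hc⟩ := h.decomposition.dense _ hF ε hε
    set H : UnitAddCircle → ℂ := fun x =>
      ∑ j ∈ Finset.Icc (-1) N, ∑ k, c j k * (wavelet ψ j k x : ℂ) with hH
    have hHm : Measurable H := by
      refine Finset.measurable_fun_sum _ fun j _ => Finset.measurable_fun_sum _ fun k _ => ?_
      exact (Complex.measurable_ofReal.comp (measurable_wavelet h.measurable j k)).const_mul _
    have hGi : Integrable G (vol d) := hG.integrable (by norm_num)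
    have hi : ∀ j ∈ Finset.Icc (-1) N, ∀ k : Shift j,
        Integrable (fun x => c j k * (G x * (wavelet ψ j k (x i) : ℂ))) (vol d) := by
      intro j hj k
      obtain ⟨C, hC⟩ := h.exists_enorm_wavelet_le (Finset.mem_Icc.1 hj).1
      refine Integrable.const_mul (hGi.mul_bdd (c := C) ?_ ?_) _
      · exact (Complex.measurable_ofReal.comp ((measurable_wavelet h.measurable j k).comp
          (measurable_pi_apply i))).aestronglyMeasurable
      · exact Filter.Eventually.of_forall fun x => by simpa using hC k (x i)
    have eH : ∀ x : UnitAddTorus (Fin d), G x * H (x i)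
        = ∑ j ∈ Finset.Icc (-1) N, ∑ k, c j k * (G x * (wavelet ψ j k (x i) : ℂ)) := by
      intro x
      simp only [hH, Finset.mul_sum]
      exact Finset.sum_congr rfl fun j _ => Finset.sum_congr rfl fun k _ => by ring
    have hGH : Integrable (fun x => G x * H (x i)) (vol d) := by
      simp only [eH]
      exact integrable_finsetSum _ fun j hj => integrable_finsetSum _ fun k _ => hi j hj k
    have hGF : Integrable (fun x => G x * fourier n (x i)) (vol d) := by
      refine hGi.mul_bdd (c := 1) ?_ ?_
      · exact ((fourier n).continuous.comp (continuous_apply i)).aestronglyMeasurable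
      · exact Filter.Eventually.of_forall fun x => (norm_fourier_apply n (x i)).le
    have h1 : ∫ x, G x * H (x i) ∂vol d = 0 := by
      simp only [eH]
      rw [integral_finsetSum _ fun j hj => integrable_finsetSum _ fun k _ => hi j hj k]
      refine Finset.sum_eq_zero fun j hj => ?_
      rw [integral_finsetSum _ fun k _ => hi j hj k]
      refine Finset.sum_eq_zero fun k _ => ?_
      rw [integral_const_mul, h0 j (Finset.mem_Icc.1 hj).1 k, mul_zero]
    have h2 : ∫ x, G x * fourier n (x i) ∂vol d
        = ∫ x, G x * (fourier n (x i) - H (x i)) ∂vol d := by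
      simp only [mul_sub]
      rw [integral_sub hGF hGH, h1, sub_zero]
    have hsm : AEStronglyMeasurable (fun x => fourier n x - H x) vol₁ :=
      ((fourier n).continuous.measurable.sub hHm).aestronglyMeasurable
    rw [h2]
    refine (enorm_integral_le_lintegral_enorm _).trans ?_
    refine (lintegral_enorm_mul_le hG.1 (hsm.comp_measurePreserving hmp)).trans ?_
    rw [eLpNorm_comp_measurePreserving hsm hmp]
    exact mul_le_mul' le_rfl hc.le
  have hz : ‖∫ x, G x * fourier n (x i) ∂vol d‖ₑ ≤ 0 := by
    refine ENNReal.le_of_forall_pos_le_add fun ε hε _ => ?_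
    rw [zero_add]
    have hGt : eLpNorm G 2 (vol d) ≠ ∞ := hG.2.ne
    -- The added $1$ avoids division by zero when `G` is null.
    have hε' : (0 : ℝ≥0∞) < ε / (eLpNorm G 2 (vol d) + 1) :=
      ENNReal.div_pos (by exact_mod_cast hε.ne') (by finiteness)
    refine (key _ hε').trans ?_
    rw [← mul_div_assoc]
    refine ENNReal.div_le_of_le_mul ?_
    rw [mul_comm]
    exact mul_le_mul' le_rfl le_self_add
  simpa using hz

theorem memLp_mul_prod {g : UnitAddTorus (Fin d) → ℂ} (hg : MemLp g 2 (vol d)) (s : Finset (Fin d))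
    {w : Fin d → UnitAddCircle → ℂ} (hw : ∀ i, Measurable (w i)) {C : Fin d → ℝ}
    (hC : ∀ i x, ‖w i x‖ ≤ C i) : MemLp (fun x => g x * ∏ i ∈ s, w i (x i)) 2 (vol d) := by
  refine hg.of_le_mul (c := ∏ i ∈ s, C i) ?_ (Filter.Eventually.of_forall fun x => ?_)
  · exact hg.1.mul (Finset.measurable_fun_prod s fun i _ =>
      (hw i).comp (measurable_pi_apply i)).aestronglyMeasurable
  · rw [norm_mul, mul_comm, norm_prod]
    exact mul_le_mul_of_nonneg_right
      (Finset.prod_le_prod (fun _ _ => norm_nonneg _) fun i _ => hC i _) (norm_nonneg _)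

/-- Wavelet factors are traded for exponentials one coordinate at a time; `u` is the set of
coordinates already traded. -/
theorem integral_mul_prod_eq_zero (h : IsWavelet ψ m) {g : UnitAddTorus (Fin d) → ℂ}
    (hg : MemLp g 2 (vol d))
    (h0 : ∀ j : Fin d → ℤ, (∀ i, -1 ≤ j i) → ∀ k,
      ∫ x, g x * (tensorWavelet ψ j k x : ℂ) ∂vol d = 0) (u : Finset (Fin d)) :
    ∀ w : Fin d → UnitAddCircle → ℂ, (∀ i ∈ u, ∃ n : ℤ, w i = fourier n) →
      (∀ i ∉ u, ∃ j : ℤ, -1 ≤ j ∧ ∃ k : Shift j, w i = fun x => (wavelet ψ j k x : ℂ)) →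
      ∫ x, g x * ∏ i, w i (x i) ∂vol d = 0 := by
  classical
  induction u using Finset.induction_on with
  | empty =>
    intro w _ hw
    choose j hj k hk using fun i => hw i (Finset.notMem_empty i)
    rw [← h0 j hj k]
    refine integral_congr_ae (Filter.Eventually.of_forall fun x => ?_)
    simp [hk, tensorWavelet]
  | insert i u hiu ih =>
    intro w hwu hw
    obtain ⟨n, hn⟩ := hwu i (Finset.mem_insert_self i u)
    have hprop : ∀ i', Measurable (w i') ∧ ∃ C : ℝ, ∀ x, ‖w i' x‖ ≤ C := by
      intro i'
      by_cases hi' : i' ∈ insert i u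
      · obtain ⟨n', hn'⟩ := hwu i' hi'
        rw [hn']
        exact ⟨(fourier n').continuous.measurable, 1, fun x => (norm_fourier_apply n' x).le⟩
      · obtain ⟨j, hj, k, hk⟩ := hw i' hi'
        rw [hk]
        obtain ⟨C, hC⟩ := h.exists_enorm_wavelet_le hj
        exact ⟨Complex.measurable_ofReal.comp (measurable_wavelet h.measurable j k), C,
          fun x => by simpa using hC k x⟩
    choose hwm C hC using hprop
    -- All other factors are absorbed into the $L_2$ function, leaving a univariate question in
    -- coordinate `i`.
    have hG := memLp_mul_prod hg (Finset.univ.erase i) hwm hC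
    have e : ∀ v : UnitAddCircle → ℂ, ∀ x : UnitAddTorus (Fin d),
        (g x * ∏ i' ∈ Finset.univ.erase i, w i' (x i')) * v (x i)
          = g x * ∏ i', Function.update w i v i' (x i') := by
      intro v x
      rw [← Finset.mul_prod_erase Finset.univ _ (Finset.mem_univ i), Function.update_self,
        mul_assoc, mul_comm (v (x i))]
      congr 2
      refine Finset.prod_congr rfl fun i' hi' => ?_
      rw [Function.update_of_ne (Finset.ne_of_mem_erase hi')]
    have := h.integral_mul_fourier_eval_eq_zero hG i (fun j hj k => ?_) n
    · simp only [e (fourier n)] at this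
      rwa [← hn, Function.update_eq_self] at this
    · simp only [e fun x => (wavelet ψ j k x : ℂ)]
      refine ih _ ?_ ?_
      · intro i' hi'
        rw [Function.update_of_ne (by rintro rfl; exact hiu hi')]
        exact hwu i' (Finset.mem_insert_of_mem hi')
      · intro i' hi'
        by_cases hc : i' = i
        · subst hc
          exact ⟨j, hj, k, by rw [Function.update_self]⟩
        · rw [Function.update_of_ne hc]
          exact hw i' (by simp [hc, hi'])

/-- The tensor wavelets are total in `L₂(𝕋ᵈ)`. -/
theorem ae_eq_zero_of_integral_mul_tensorWavelet (h : IsWavelet ψ m)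
    {g : UnitAddTorus (Fin d) → ℂ} (hg : MemLp g 2 (vol d))
    (h0 : ∀ j : Fin d → ℤ, (∀ i, -1 ≤ j i) → ∀ k,
      ∫ x, g x * (tensorWavelet ψ j k x : ℂ) ∂vol d = 0) : g =ᵐ[vol d] 0 := by
  refine ae_eq_zero_of_mFourierCoeff_eq_zero hg fun n => ?_
  rw [mFourierCoeff_eq, ← h.integral_mul_prod_eq_zero hg h0 Finset.univ
    (fun i => (fourier (-n i) : UnitAddCircle → ℂ)) (fun i _ => ⟨-n i, rfl⟩) (by simp)]
  refine integral_congr_ae (Filter.Eventually.of_forall fun x => ?_)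
  simp [UnitAddTorus.mFourier, mul_comm]

end IsWavelet

/-! ### Levels -/

/-- The multilevel `𝐣 ≥ -𝟏` with entries `a_i - 1`. -/
def shiftedLevel (a : Fin d → ℕ) (i : Fin d) : ℤ := (a i : ℤ) - 1

theorem neg_one_le_shiftedLevel (a : Fin d → ℕ) (i : Fin d) : -1 ≤ shiftedLevel a i := by
  simp only [shiftedLevel]
  omega

theorem toNat_shiftedLevel (a : Fin d → ℕ) (i : Fin d) : (shiftedLevel a i).toNat = a i - 1 := by
  simp only [shiftedLevel]; omega

theorem shiftedLevel_injective : Function.Injective (shiftedLevel (d := d)) := by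
  intro a b hab
  funext i
  have := congrFun hab i
  simp only [shiftedLevel] at this
  omega

theorem mem_levels {n : ℕ} {j : Fin d → ℤ} :
    j ∈ levels d n ↔ (∀ i, -1 ≤ j i) ∧ ∑ i, (j i).toNat ≤ n := by
  have hsum : ∑ i with 0 ≤ j i, j i = ((∑ i, (j i).toNat : ℕ) : ℤ) := by
    push_cast
    rw [Finset.sum_filter]
    refine Finset.sum_congr rfl fun i _ => ?_
    split_ifs <;> omega
  rw [levels, Finset.mem_filter, Fintype.mem_piFinset, hsum]
  constructor
  · rintro ⟨h1, h2⟩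
    exact ⟨fun i => (Finset.mem_Icc.1 (h1 i)).1, by exact_mod_cast h2⟩
  · rintro ⟨h1, h2⟩
    refine ⟨fun i => Finset.mem_Icc.2 ⟨h1 i, ?_⟩, by exact_mod_cast h2⟩
    have h3 : (j i).toNat ≤ ∑ i, (j i).toNat :=
      Finset.single_le_sum (f := fun i => (j i).toNat) (fun _ _ => Nat.zero_le _)
        (Finset.mem_univ i)
    omega

/-! ### Level projections -/

/-- The component of `f` on the level `𝐣`. -/
noncomputable def levelPart (ψ : ℝ → ℝ) (f : UnitAddTorus (Fin d) → ℂ) (j : Fin d → ℤ)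
    (x : UnitAddTorus (Fin d)) : ℂ :=
  ∑ k : (i : Fin d) → Shift (j i), coefficient ψ f j k * (tensorWavelet ψ j k x : ℂ)

theorem proj_eq_sum_levelPart (ψ : ℝ → ℝ) (n : ℕ) (f : UnitAddTorus (Fin d) → ℂ)
    (x : UnitAddTorus (Fin d)) :
    proj ψ n f x = ∑ a ∈ (levels d n).preimage shiftedLevel shiftedLevel_injective.injOn,
      levelPart ψ f (shiftedLevel a) x := by
  rw [Finset.sum_preimage shiftedLevel (levels d n) shiftedLevel_injective.injOn
    (fun j => levelPart ψ f j x)]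
  · rfl
  · intro j hj hjr
    refine absurd ⟨fun i => (j i + 1).toNat, ?_⟩ hjr
    funext i
    have := (mem_levels.1 hj).1 i
    simp only [shiftedLevel]
    omega

namespace IsWavelet

variable {ψ : ℝ → ℝ} {m : ℕ}

theorem measurable_tensorWavelet (h : IsWavelet ψ m) (j : Fin d → ℤ) (k : (i : Fin d) → Shift (j i)) :
    Measurable (tensorWavelet ψ j k) :=
  Finset.measurable_fun_prod _ fun i _ =>
    (measurable_wavelet h.measurable (j i) (k i)).comp (measurable_pi_apply i)

theorem exists_norm_tensorWavelet_le (h : IsWavelet ψ m) {j : Fin d → ℤ} (hj : ∀ i, -1 ≤ j i) :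
    ∃ C : ℝ, ∀ k x, ‖tensorWavelet ψ j k x‖ ≤ C := by
  choose C hC using fun i => h.exists_enorm_wavelet_le (hj i)
  refine ⟨∏ i, C i, fun k x => ?_⟩
  rw [tensorWavelet, norm_prod]
  exact Finset.prod_le_prod (fun _ _ => norm_nonneg _) fun i _ => hC i _ _

theorem integrable_mul_tensorWavelet (h : IsWavelet ψ m) {g : UnitAddTorus (Fin d) → ℂ}
    (hg : Integrable g (vol d)) {j : Fin d → ℤ} (hj : ∀ i, -1 ≤ j i)
    (k : (i : Fin d) → Shift (j i)) :
    Integrable (fun x => g x * (tensorWavelet ψ j k x : ℂ)) (vol d) := by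
  obtain ⟨C, hC⟩ := h.exists_norm_tensorWavelet_le hj
  refine hg.mul_bdd (c := C)
    (Complex.measurable_ofReal.comp (h.measurable_tensorWavelet j k)).aestronglyMeasurable
    (Filter.Eventually.of_forall fun x => by simpa using hC k x)

theorem measurable_levelPart (h : IsWavelet ψ m) (f : UnitAddTorus (Fin d) → ℂ) (j : Fin d → ℤ) :
    Measurable (levelPart ψ f j) :=
  Finset.measurable_fun_sum _ fun k _ =>
    (Complex.measurable_ofReal.comp (h.measurable_tensorWavelet j k)).const_mul _

theorem exists_sum_enorm_tensorWavelet_le (h : IsWavelet ψ m) (d : ℕ) : ∃ C : ℝ≥0∞, C ≠ ∞ ∧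
    ∀ j : Fin d → ℤ, (∀ i, -1 ≤ j i) → ∀ x,
      ∑ k, ‖tensorWavelet ψ j k x‖ₑ ^ 2 ≤ C * 2 ^ ∑ i, (j i).toNat := by
  obtain ⟨C, hC, hle⟩ := h.exists_sum_enorm_le
  refine ⟨C ^ d, by finiteness, fun j hj x => ?_⟩
  have e : ∑ k : (i : Fin d) → Shift (j i), ‖tensorWavelet ψ j k x‖ₑ ^ 2
      = ∏ i, ∑ k : Shift (j i), ‖wavelet ψ (j i) k (x i)‖ₑ ^ 2 := by
    rw [Finset.prod_univ_sum, Fintype.piFinset_univ]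
    refine Finset.sum_congr rfl fun k _ => ?_
    rw [tensorWavelet, Finset.prod_pow]
    congr 1
    simp only [enorm_eq_nnnorm, nnnorm_prod]
    push_cast
    rfl
  rw [e]
  refine (Finset.prod_le_prod' fun i _ => hle (j i) (hj i) (x i)).trans (le_of_eq ?_)
  rw [Finset.prod_mul_distrib, Finset.prod_pow_eq_pow_sum]
  simp

/-- Cauchy–Schwarz over the shifts; this is where passing from $L_2$ to the uniform norm costs
$2^{|\mathbf j|_1/2}$. -/
theorem exists_enorm_levelPart_le (h : IsWavelet ψ m) (d : ℕ) : ∃ C : ℝ≥0∞, C ≠ ∞ ∧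
    ∀ (f : UnitAddTorus (Fin d) → ℂ) (j : Fin d → ℤ), (∀ i, -1 ≤ j i) → ∀ x,
      ‖levelPart ψ f j x‖ₑ ≤ C * ((∑ k, ‖coefficient ψ f j k‖ₑ ^ 2) ^ (1 / 2 : ℝ) *
        (2 ^ ∑ i, (j i).toNat) ^ (1 / 2 : ℝ)) := by
  obtain ⟨C, hC, hle⟩ := h.exists_sum_enorm_tensorWavelet_le d
  refine ⟨C ^ (1 / 2 : ℝ), by finiteness, fun f j hj x => ?_⟩
  have h1 : ‖levelPart ψ f j x‖ₑ ≤ ∑ k, ‖coefficient ψ f j k‖ₑ * ‖tensorWavelet ψ j k x‖ₑ := by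
    refine (enorm_sum_le _ _).trans (le_of_eq (Finset.sum_congr rfl fun k _ => ?_))
    rw [enorm_mul, ← ofReal_norm (tensorWavelet ψ j k x : ℂ), Complex.norm_real, ofReal_norm]
  refine h1.trans ((ENNReal.inner_le_Lp_mul_Lq Finset.univ _ _ (p := 2) (q := 2)
    (by constructor <;> norm_num)).trans ?_)
  simp only [ENNReal.rpow_two]
  rw [mul_left_comm, ← ENNReal.mul_rpow_of_nonneg C _ (by norm_num : (0 : ℝ) ≤ 1 / 2)]
  exact mul_le_mul' le_rfl (ENNReal.rpow_le_rpow (z := 1 / 2) (hle j hj x) (by norm_num))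

/-! ### Biorthogonality -/

theorem integral_tensorWavelet_mul (ψ : ℝ → ℝ) (i j : Fin d → ℤ) (k : (a : Fin d) → Shift (i a))
    (l : (a : Fin d) → Shift (j a)) :
    ∫ x, tensorWavelet ψ i k x * tensorWavelet ψ j l x ∂vol d
      = ∏ a, ∫ x, wavelet ψ (i a) (k a) x * wavelet ψ (j a) (l a) x ∂vol₁ := by
  rw [← integral_fintype_prod_eq_prod (μ := fun _ : Fin d => vol₁)
    (fun a x => wavelet ψ (i a) (k a) x * wavelet ψ (j a) (l a) x)]
  simp only [tensorWavelet, Finset.prod_mul_distrib]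

theorem integral_levelPart_mul_of_ne (h : IsWavelet ψ m) (f : UnitAddTorus (Fin d) → ℂ)
    {i j : Fin d → ℤ} (hi : ∀ a, -1 ≤ i a) (hj : ∀ a, -1 ≤ j a) (hij : i ≠ j)
    (l : (a : Fin d) → Shift (j a)) :
    ∫ x, levelPart ψ f i x * (tensorWavelet ψ j l x : ℂ) ∂vol d = 0 := by
  have hint : ∀ k ∈ Finset.univ, Integrable (fun x => coefficient ψ f i k *
      ((tensorWavelet ψ i k x : ℂ) * (tensorWavelet ψ j l x : ℂ))) (vol d) := by
    intro k _
    have := h.integrable_mul_tensorWavelet (integrable_const (1 : ℂ)) hi k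
    simp only [one_mul] at this
    exact (h.integrable_mul_tensorWavelet this hj l).const_mul _
  simp only [levelPart, Finset.sum_mul, mul_assoc]
  rw [integral_finsetSum _ hint]
  refine Finset.sum_eq_zero fun k _ => ?_
  rw [integral_const_mul]
  obtain ⟨a, ha⟩ := Function.ne_iff.1 hij
  have h1 : ∫ x, ((tensorWavelet ψ i k x : ℂ) * (tensorWavelet ψ j l x : ℂ)) ∂vol d = 0 := by
    simp only [← Complex.ofReal_mul]
    rw [integral_complex_ofReal, integral_tensorWavelet_mul, Finset.prod_eq_zero (Finset.mem_univ a)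
      (h.decomposition.orthogonal _ _ (hi a) (hj a) ha _ _), Complex.ofReal_zero]
  rw [h1, mul_zero]

/-- Pairing with a wavelet applies the Gram matrix to the dual wavelets inside the coefficients,
which returns the wavelet itself, in each coordinate. -/
theorem integral_levelPart_mul_self (h : IsWavelet ψ m) {f : UnitAddTorus (Fin d) → ℂ}
    (hf : Integrable f (vol d)) {j : Fin d → ℤ} (hj : ∀ a, -1 ≤ j a)
    (l : (a : Fin d) → Shift (j a)) :
    ∫ x, levelPart ψ f j x * (tensorWavelet ψ j l x : ℂ) ∂vol d
      = ∫ x, f x * (tensorWavelet ψ j l x : ℂ) ∂vol d := by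
  have hint : ∀ k ∈ Finset.univ, Integrable (fun x => coefficient ψ f j k *
      ((tensorWavelet ψ j k x : ℂ) * (tensorWavelet ψ j l x : ℂ))) (vol d) := by
    intro k _
    have := h.integrable_mul_tensorWavelet (integrable_const (1 : ℂ)) hj k
    simp only [one_mul] at this
    exact (h.integrable_mul_tensorWavelet this hj l).const_mul _
  have hint' : ∀ k ∈ Finset.univ, Integrable (fun x =>
      (f x * (tensorDualWavelet ψ j k x : ℂ)) * ((∏ a, gram ψ (j a) (l a) (k a) : ℝ) : ℂ)) (vol d) := by
    intro k _
    choose C hC using fun i => h.exists_enorm_dualWavelet_le (hj i) (k i)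
    refine Integrable.mul_const (hf.mul_bdd (c := ∏ i, C i) ?_ ?_) _
    · exact (Complex.measurable_ofReal.comp (Finset.measurable_fun_prod _ fun i _ =>
        (h.measurable_dualWavelet (j i) (k i)).comp (measurable_pi_apply i))).aestronglyMeasurable
    · refine Filter.Eventually.of_forall fun x => ?_
      rw [Complex.norm_real, tensorDualWavelet, norm_prod]
      exact Finset.prod_le_prod (fun _ _ => norm_nonneg _) fun i _ => hC i _
  simp only [levelPart, Finset.sum_mul, mul_assoc]
  rw [integral_finsetSum _ hint]
  have e : ∀ k, ∫ x, coefficient ψ f j k *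
      ((tensorWavelet ψ j k x : ℂ) * (tensorWavelet ψ j l x : ℂ)) ∂vol d
      = ∫ x, (f x * (tensorDualWavelet ψ j k x : ℂ)) * ((∏ a, gram ψ (j a) (l a) (k a) : ℝ) : ℂ) ∂vol d := by
    intro k
    rw [integral_const_mul, integral_mul_const]
    simp only [← Complex.ofReal_mul]
    rw [integral_complex_ofReal, integral_tensorWavelet_mul]
    have : ∀ a, ∫ x, wavelet ψ (j a) (k a) x * wavelet ψ (j a) (l a) x ∂vol₁
        = gram ψ (j a) (l a) (k a) := fun a => by rw [gram_symm]; rfl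
    simp only [this]
    rfl
  simp only [e]
  rw [← integral_finsetSum _ hint']
  refine integral_congr_ae (Filter.Eventually.of_forall fun x => ?_)
  simp only [mul_assoc, ← Finset.mul_sum, ← Complex.ofReal_mul, ← Complex.ofReal_sum]
  congr 2
  have : ∀ k : (a : Fin d) → Shift (j a), tensorDualWavelet ψ j k x * ∏ a, gram ψ (j a) (l a) (k a)
      = ∏ a, gram ψ (j a) (l a) (k a) * dualWavelet ψ (j a) (k a) (x a) := by
    intro k
    rw [Finset.prod_mul_distrib, mul_comm, tensorDualWavelet]
  simp only [this]
  rw [← Fintype.piFinset_univ, ← Finset.prod_univ_sum (fun _ => Finset.univ)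
    (fun a k => gram ψ (j a) (l a) k * dualWavelet ψ (j a) k (x a)), tensorWavelet]
  exact Finset.prod_congr rfl fun a _ => h.sum_gram_mul_dualWavelet (hj a) (l a) (x a)

/-- If the level components are summable in the uniform norm, then the uniform error is at most
the sum over the levels left out. -/
theorem uniformError_le_tsum (h : IsWavelet ψ m) {f : UnitAddTorus (Fin d) → ℂ}
    (hf : MemLp f 2 (vol d)) {U : (Fin d → ℕ) → ℝ≥0∞}
    (hU : ∀ a x, ‖levelPart ψ f (shiftedLevel a) x‖ₑ ≤ U a) (hsum : ∑' a, U a ≠ ∞) (n : ℕ) :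
    uniformError ψ n f ≤ ∑' a, if ∑ i, (a i - 1) ≤ n then 0 else U a := by
  have hUa : ∀ a, U a ≠ ∞ := fun a => ((ENNReal.le_tsum a).trans_lt hsum.lt_top).ne
  have hUs : Summable fun a => (U a).toReal := ENNReal.summable_toReal hsum
  have hq : ∀ a x, ‖levelPart ψ f (shiftedLevel a) x‖ ≤ (U a).toReal := by
    intro a x
    rw [← toReal_enorm]
    exact ENNReal.toReal_mono (hUa a) (hU a x)
  have hqs : ∀ x, Summable fun a => levelPart ψ f (shiftedLevel a) x := fun x =>
    Summable.of_norm_bounded hUs fun a => hq a x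
  set F : UnitAddTorus (Fin d) → ℂ := fun x => ∑' a, levelPart ψ f (shiftedLevel a) x with hF
  have hFm : Measurable F := Measurable.tsum fun a => h.measurable_levelPart f _
  have hF2 : MemLp F 2 (vol d) := by
    refine MemLp.of_bound hFm.aestronglyMeasurable (∑' a, (U a).toReal)
      (Filter.Eventually.of_forall fun x => ?_)
    exact tsum_of_norm_bounded hUs.hasSum fun a => hq a x
  have hfi : Integrable f (vol d) := hf.integrable (by norm_num)
  have hFi : Integrable F (vol d) := hF2.integrable (by norm_num)
  -- The series of level components reproduces every pairing of `f` with a tensor wavelet, hence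
  -- equals `f` almost everywhere by totality.
  have hae : (fun x => f x - F x) =ᵐ[vol d] 0 := by
    refine h.ae_eq_zero_of_integral_mul_tensorWavelet (hf.sub hF2) fun j hj l => ?_
    simp only [sub_mul]
    rw [integral_sub (h.integrable_mul_tensorWavelet hfi hj l)
      (h.integrable_mul_tensorWavelet hFi hj l), sub_eq_zero]
    obtain ⟨C, hC⟩ := h.exists_norm_tensorWavelet_le hj
    obtain ⟨a, rfl⟩ : ∃ a, shiftedLevel a = j := by
      refine ⟨fun i => (j i + 1).toNat, ?_⟩
      funext i
      have := hj i
      simp only [shiftedLevel]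
      omega
    -- The series may be paired term by term; by orthogonality only the term of the same level
    -- survives.
    have hs := hasSum_integral_of_dominated_convergence (μ := vol d)
      (F := fun b x => levelPart ψ f (shiftedLevel b) x * (tensorWavelet ψ (shiftedLevel a) l x : ℂ))
      (f := fun x => F x * (tensorWavelet ψ (shiftedLevel a) l x : ℂ))
      (fun b _ => (U b).toReal * C)
      (fun b => ((h.measurable_levelPart f _).mul (Complex.measurable_ofReal.comp
        (h.measurable_tensorWavelet _ l))).aestronglyMeasurable)
      (fun b => Filter.Eventually.of_forall fun x => by
        rw [norm_mul, Complex.norm_real]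
        exact mul_le_mul (hq b x) (hC l x) (norm_nonneg _) ENNReal.toReal_nonneg)
      (Filter.Eventually.of_forall fun x => hUs.mul_right C)
      (integrable_const _)
      (Filter.Eventually.of_forall fun x => (hqs x).hasSum.mul_right _)
    rw [← hs.tsum_eq, tsum_eq_single a, h.integral_levelPart_mul_self hfi hj l]
    intro b hb
    exact h.integral_levelPart_mul_of_ne f (neg_one_le_shiftedLevel b) hj
      (fun hc => hb (shiftedLevel_injective hc)) l
  rw [uniformError, eLpNorm_exponent_top]
  refine essSup_le_of_ae_le _ ?_
  filter_upwards [hae] with x hx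
  have hfx : f x = F x := sub_eq_zero.1 hx
  have hmem : ∀ a : Fin d → ℕ, a ∈ (levels d n).preimage shiftedLevel shiftedLevel_injective.injOn
      ↔ ∑ i, (a i - 1) ≤ n := by
    intro a
    rw [Finset.mem_preimage, mem_levels]
    simp only [toNat_shiftedLevel]
    exact and_iff_right (neg_one_le_shiftedLevel a)
  have e : F x - proj ψ n f x
      = ∑' a, if ∑ i, (a i - 1) ≤ n then 0 else levelPart ψ f (shiftedLevel a) x := by
    have e1 : proj ψ n f x
        = ∑' a, if ∑ i, (a i - 1) ≤ n then levelPart ψ f (shiftedLevel a) x else 0 := by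
      rw [proj_eq_sum_levelPart, tsum_eq_sum
        (s := (levels d n).preimage shiftedLevel shiftedLevel_injective.injOn)]
      · exact Finset.sum_congr rfl fun a ha => (if_pos ((hmem a).1 ha)).symm
      · exact fun a ha => if_neg fun hc => ha ((hmem a).2 hc)
    rw [e1, hF, ← Summable.tsum_sub (hqs x)]
    · refine tsum_congr fun a => ?_
      split_ifs <;> simp
    · refine Summable.of_norm_bounded hUs fun a => ?_
      split_ifs
      · exact hq a x
      · simp
  change ‖f x - proj ψ n f x‖ₑ ≤ _
  rw [hfx, e]
  refine enorm_tsum_le_tsum_enorm.trans (ENNReal.tsum_le_tsum fun a => ?_)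
  split_ifs
  · simp
  · exact hU a x

end IsWavelet

/-! ### Sums over multilevels -/

theorem tsum_pi_succ (f : (Fin (d + 1) → ℕ) → ℝ≥0∞) :
    ∑' a, f a = ∑' n : ℕ, ∑' a : Fin d → ℕ, f (Fin.cons n a) := by
  rw [← ENNReal.tsum_prod, ← (Fin.consEquiv fun _ : Fin (d + 1) => ℕ).tsum_eq]
  rfl

theorem tsum_pi_prod : ∀ {d : ℕ} (g : Fin d → ℕ → ℝ≥0∞),
    ∑' a : Fin d → ℕ, ∏ i, g i (a i) = ∏ i, ∑' n, g i n := by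
  intro d
  induction d with
  | zero => intro g; simp [tsum_fintype]
  | succ d ih =>
    intro g
    rw [tsum_pi_succ, Fin.prod_univ_succ, ← ih, ← ENNReal.tsum_mul_right]
    refine tsum_congr fun n => ?_
    rw [← ENNReal.tsum_mul_left]
    refine tsum_congr fun a => ?_
    rw [Fin.prod_univ_succ]
    simp

/-- Truncated subtraction sends both $0$ and $1$ to $0$: levels $-1$ and $0$ have the same weight,
whence the factor $2$. -/
theorem tsum_comp_sub_one_le (g : ℕ → ℝ≥0∞) : ∑' n : ℕ, g (n - 1) ≤ 2 * ∑' n, g n := by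
  rw [tsum_eq_zero_add' ENNReal.summable, two_mul]
  simp only [Nat.zero_sub, Nat.add_sub_cancel]
  exact add_le_add (ENNReal.le_tsum 0) le_rfl

theorem tsum_tsum_add (g : ℕ → ℕ → ℝ≥0∞) :
    ∑' p : ℕ, ∑' q : ℕ, g (p + q) q = ∑' n : ℕ, ∑ q ∈ Finset.range (n + 1), g n q := by
  rw [← ENNReal.tsum_prod (f := fun p q => g (p + q) q),
    ← (Finset.HasAntidiagonal.sigmaAntidiagonalEquivProd (A := ℕ)).tsum_eq (fun p : ℕ × ℕ => g (p.1 + p.2) p.2), ENNReal.tsum_sigma']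
  refine tsum_congr fun n => ?_
  rw [tsum_fintype, Finset.univ_eq_attach]
  refine (Finset.sum_attach (Finset.HasAntidiagonal.antidiagonal n)
    (fun p => g (p.1 + p.2) p.2)).trans ?_
  rw [Finset.sum_congr rfl fun p hp => by rw [Finset.HasAntidiagonal.mem_antidiagonal.1 hp],
    Finset.Nat.sum_antidiagonal_eq_sum_range_succ (fun _ q => g n q), ← Finset.sum_range_reflect]
  refine Finset.sum_congr rfl fun q hq => ?_
  congr 1
  have := Finset.mem_range.1 hq
  omega

/-- A weighted form of the count that at most $2^{d+1}(q+1)^d$ levels in $d+1$ variables have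
$|\mathbf j|_1=q$. Each further variable adds a sum over at most $q+1$ values. -/
theorem tsum_level_le : ∀ (d : ℕ) (g : ℕ → ℝ≥0∞),
    ∑' a : Fin (d + 1) → ℕ, g (∑ i, (a i - 1)) ≤ 2 ^ (d + 1) * ∑' q : ℕ, (q + 1 : ℝ≥0∞) ^ d * g q := by
  intro d
  induction d with
  | zero =>
    intro g
    rw [tsum_pi_succ]
    simpa [tsum_fintype] using tsum_comp_sub_one_le g
  | succ d ih =>
    intro g
    rw [tsum_pi_succ]
    simp only [Fin.sum_univ_succ (n := d + 1), Fin.cons_zero, Fin.cons_succ]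
    calc ∑' n : ℕ, ∑' a : Fin (d + 1) → ℕ, g ((n - 1) + ∑ i, (a i - 1))
        ≤ ∑' n : ℕ, 2 ^ (d + 1) * ∑' q : ℕ, (q + 1 : ℝ≥0∞) ^ d * g ((n - 1) + q) :=
          ENNReal.tsum_le_tsum fun n => ih fun q => g ((n - 1) + q)
      _ = 2 ^ (d + 1) * ∑' n : ℕ, ∑' q : ℕ, (q + 1 : ℝ≥0∞) ^ d * g ((n - 1) + q) :=
          ENNReal.tsum_mul_left
      _ ≤ 2 ^ (d + 1) * (2 * ∑' p : ℕ, ∑' q : ℕ, (q + 1 : ℝ≥0∞) ^ d * g (p + q)) :=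
          mul_le_mul' le_rfl (tsum_comp_sub_one_le
            fun p => ∑' q : ℕ, (q + 1 : ℝ≥0∞) ^ d * g (p + q))
      _ ≤ 2 ^ (d + 1) * (2 * ∑' q : ℕ, (q + 1 : ℝ≥0∞) ^ (d + 1) * g q) := by
          refine mul_le_mul' le_rfl (mul_le_mul' le_rfl ?_)
          rw [tsum_tsum_add fun n q => (q + 1 : ℝ≥0∞) ^ d * g n]
          refine ENNReal.tsum_le_tsum fun n => ?_
          calc ∑ q ∈ Finset.range (n + 1), (q + 1 : ℝ≥0∞) ^ d * g n
              ≤ ∑ _q ∈ Finset.range (n + 1), (n + 1 : ℝ≥0∞) ^ d * g n := by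
                refine Finset.sum_le_sum fun q hq => ?_
                gcongr
                exact Nat.lt_succ_iff.1 (Finset.mem_range.1 hq)
            _ = (n + 1 : ℝ≥0∞) ^ (d + 1) * g n := by
                rw [Finset.sum_const, Finset.card_range, nsmul_eq_mul, pow_succ]
                push_cast
                ring
      _ = _ := by rw [pow_succ 2 (d + 1)]; ring

/-! ### Powers of two -/

theorem two_rpow_add (x y : ℝ) : (2 : ℝ≥0∞) ^ (x + y) = 2 ^ x * 2 ^ y :=
  ENNReal.rpow_add x y two_ne_zero ENNReal.ofNat_ne_top

theorem two_rpow_sum {ι : Type*} (s : Finset ι) (f : ι → ℝ) :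
    (2 : ℝ≥0∞) ^ (∑ i ∈ s, f i) = ∏ i ∈ s, 2 ^ f i := by
  classical
  induction s using Finset.induction_on with
  | empty => simp
  | insert i s hi ih => rw [Finset.sum_insert hi, Finset.prod_insert hi, two_rpow_add, ih]

theorem ofReal_two_rpow (x : ℝ) : ENNReal.ofReal ((2 : ℝ) ^ x) = 2 ^ x := by
  rw [← ENNReal.ofReal_rpow_of_pos two_pos, ENNReal.ofReal_ofNat]

theorem tsum_two_rpow_ne_top {t : ℝ} (ht : 0 < t) (d : ℕ) :
    ∑' p : ℕ, (p + 3 : ℝ≥0∞) ^ d * 2 ^ (-t * p) ≠ ∞ := by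
  have hr : ‖(2 : ℝ) ^ (-t)‖ < 1 := by
    rw [Real.norm_of_nonneg (by positivity)]
    exact Real.rpow_lt_one_of_one_lt_of_neg one_lt_two (by linarith)
  have h1 := summable_pow_mul_geometric_of_norm_lt_one d hr
  have h2 : Summable fun p : ℕ => ((p : ℝ) + 3) ^ d * ((2 : ℝ) ^ (-t)) ^ p := by
    have h3 := ((summable_nat_add_iff 3).2 h1).mul_left (((2 : ℝ) ^ (-t)) ^ 3)⁻¹
    refine h3.congr fun p => ?_
    have : ((2 : ℝ) ^ (-t)) ^ 3 ≠ 0 := by positivity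
    rw [pow_add]
    push_cast
    field_simp
  have h4 : ∀ p : ℕ, (p + 3 : ℝ≥0∞) ^ d * 2 ^ (-t * p)
      = ENNReal.ofReal (((p : ℝ) + 3) ^ d * ((2 : ℝ) ^ (-t)) ^ p) := by
    intro p
    rw [ENNReal.ofReal_mul (by positivity), ← Real.rpow_natCast (2 ^ (-t)), ← Real.rpow_mul two_pos.le,
      ofReal_two_rpow, ENNReal.ofReal_pow (by positivity), ENNReal.ofReal_add (by positivity)
      (by norm_num)]
    simp
  simp only [h4]
  exact h2.tsum_ofReal_ne_top

theorem tsum_two_rpow_level_ne_top {t : ℝ} (ht : 0 < t) (d : ℕ) :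
    ∑' a : Fin (d + 1) → ℕ, (2 : ℝ≥0∞) ^ (-t * (∑ i, (a i - 1) : ℕ)) ≠ ∞ := by
  refine ne_top_of_le_ne_top ?_ (tsum_level_le d fun q => (2 : ℝ≥0∞) ^ (-t * q))
  refine ENNReal.mul_ne_top (by finiteness) (ne_top_of_le_ne_top (tsum_two_rpow_ne_top ht d) ?_)
  refine ENNReal.tsum_le_tsum fun q => ?_
  gcongr
  norm_num

theorem tsum_two_rpow_tail_le (t : ℝ) (ht : 0 < t) (d : ℕ) {n : ℕ} (hn : 1 ≤ n) :
    ∑' q : ℕ, (q + 1 : ℝ≥0∞) ^ d * (if q ≤ n then 0 else (2 : ℝ≥0∞) ^ (-t * q))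
      ≤ (∑' p : ℕ, (p + 3 : ℝ≥0∞) ^ d * 2 ^ (-t * p)) * (2 ^ (-t * n) * n ^ d) := by
  rw [← ENNReal.tsum_mul_right, ← Summable.sum_add_tsum_nat_add' (k := n + 1) ENNReal.summable,
    Finset.sum_eq_zero, zero_add]
  · refine ENNReal.tsum_le_tsum fun p => ?_
    rw [if_neg (by omega)]
    -- For $q=p+n+1$ the polynomial weight splits into a factor in `p`, absorbed by the geometric
    -- series, and a power of `n`; this uses $n\ge1$ and explains the shift by $3$.
    have h1 : ((p + (n + 1) : ℕ) + 1 : ℝ≥0∞) ≤ (p + 3) * n := by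
      have : p + (n + 1) + 1 ≤ (p + 3) * n := by nlinarith
      exact_mod_cast this
    have h2 : (2 : ℝ≥0∞) ^ (-t * (p + (n + 1) : ℕ)) ≤ 2 ^ (-t * p) * 2 ^ (-t * n) := by
      rw [← two_rpow_add]
      refine ENNReal.rpow_le_rpow_of_exponent_le (by norm_num) ?_
      push_cast
      nlinarith
    refine (mul_le_mul' (pow_le_pow_left' h1 d) h2).trans (le_of_eq ?_)
    rw [mul_pow]
    ring
  · intro q hq
    rw [if_pos (Nat.lt_succ_iff.1 (Finset.mem_range.1 hq)), mul_zero]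

theorem exists_tsum_tail_le {t : ℝ} (ht : 0 < t) (d : ℕ) : ∃ C : ℝ≥0∞, C ≠ ∞ ∧ ∀ n : ℕ, 1 ≤ n →
    ∑' a : Fin (d + 1) → ℕ, (if ∑ i, (a i - 1) ≤ n then 0 else
      (2 : ℝ≥0∞) ^ (-t * (∑ i, (a i - 1) : ℕ))) ≤ C * (2 ^ (-t * n) * n ^ d) := by
  refine ⟨2 ^ (d + 1) * ∑' p : ℕ, (p + 3 : ℝ≥0∞) ^ d * 2 ^ (-t * p),
    ENNReal.mul_ne_top (by finiteness) (tsum_two_rpow_ne_top ht d), fun n hn => ?_⟩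
  have h := tsum_level_le d fun q => if q ≤ n then 0 else (2 : ℝ≥0∞) ^ (-t * q)
  rw [mul_assoc]
  exact h.trans (mul_le_mul' le_rfl (tsum_two_rpow_tail_le t ht d hn))

/-! ### Dyadic frequency blocks -/

/-- The index of the dyadic block of the frequency `n`. -/
def block (n : ℤ) : ℕ := n.natAbs.size

theorem one_add_sq_le_block (n : ℤ) : 1 + (n : ℝ) ^ 2 ≤ 4 ^ block n := by
  have h1 : n.natAbs + 1 ≤ 2 ^ block n := Nat.lt_size_self _
  have h2 : ((n.natAbs : ℝ)) ^ 2 = (n : ℝ) ^ 2 := by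
    rw [Nat.cast_natAbs, Int.cast_abs, sq_abs]
  have h3 : (n.natAbs : ℝ) + 1 ≤ 2 ^ block n := by exact_mod_cast h1
  have h4 : (4 : ℝ) ^ block n = (2 ^ block n) ^ 2 := by rw [← pow_mul, mul_comm, pow_mul]; norm_num
  rw [h4, ← h2]
  nlinarith [Nat.cast_nonneg (α := ℝ) n.natAbs]

theorem four_pow_block_le (n : ℤ) : (4 : ℝ) ^ block n ≤ 4 * (1 + (n : ℝ) ^ 2) := by
  have h2 : ((n.natAbs : ℝ)) ^ 2 = (n : ℝ) ^ 2 := by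
    rw [Nat.cast_natAbs, Int.cast_abs, sq_abs]
  rcases Nat.eq_zero_or_pos (block n) with h0 | h0
  · rw [h0]; nlinarith [sq_nonneg (n : ℝ)]
  · have h1 : 2 ^ (block n - 1) ≤ n.natAbs := Nat.lt_size.1 (by unfold block at *; omega)
    have h3 : (2 : ℝ) ^ (block n - 1) ≤ n.natAbs := by exact_mod_cast h1
    have h4 : (4 : ℝ) ^ block n = 4 * (2 ^ (block n - 1)) ^ 2 := by
      obtain ⟨b, hb⟩ := Nat.exists_eq_add_of_le' h0
      rw [hb, Nat.add_sub_cancel, ← pow_mul, mul_comm b 2, pow_mul, pow_succ]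
      norm_num [mul_comm]
    rw [h4, ← h2]
    have h5 : (0 : ℝ) < 2 ^ (block n - 1) := by positivity
    nlinarith

/-- The geometric decay rate away from the diagonal. -/
noncomputable def decay (s : ℝ) (m : ℕ) : ℝ := 2 * min s (m - s)

theorem decay_pos {s : ℝ} {m : ℕ} (hs : 0 < s) (hsm : s < m) : 0 < decay s m :=
  mul_pos two_pos (lt_min hs (by linarith))

/-- Below the block of `n` the trivial bound $1$ for the weight leaves the decay $2s$ per level.
Above it the moments gain $2m$ per level against a growth of $2s$, leaving $2(m-s)$. -/
theorem two_rpow_mul_freqWeight_le (s : ℝ) (m : ℕ) (j n : ℤ) :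
    (2 : ℝ≥0∞) ^ (2 * s * j.toNat) * ENNReal.ofReal (freqWeight m j n)
      ≤ 2 ^ (2 * s * block n) * 2 ^ (-decay s m * ((j.toNat : ℤ) - block n : ℤ).natAbs) := by
  set J := j.toNat with hJ
  set N := block n with hN
  have h4 : ∀ (x : ℝ) (k : ℕ), (2 : ℝ) ^ (2 * x * k) = ((4 : ℝ) ^ k) ^ x := by
    intro x k
    rw [show (4 : ℝ) = 2 ^ (2 : ℝ) by norm_num, ← Real.rpow_natCast, ← Real.rpow_mul two_pos.le,
      ← Real.rpow_mul two_pos.le]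
    ring_nf
  rw [← two_rpow_add]
  rcases le_total J N with hle | hle
  · have h1 : ENNReal.ofReal (freqWeight m j n) ≤ 1 := by
      rw [← ENNReal.ofReal_one]
      exact ENNReal.ofReal_le_ofReal (min_le_left _ _)
    refine (mul_le_mul' le_rfl h1).trans ?_
    rw [mul_one]
    refine ENNReal.rpow_le_rpow_of_exponent_le (by norm_num) ?_
    have h2 : (((J : ℤ) - N : ℤ).natAbs : ℝ) = N - J := by
      rw [Nat.cast_natAbs, abs_of_nonpos (by omega)]
      push_cast
      ring
    have h3 : (0 : ℝ) ≤ N - J := by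
      have : (J : ℝ) ≤ N := by exact_mod_cast hle
      linarith
    rw [h2, decay]
    nlinarith [min_le_left s (m - s), mul_le_mul_of_nonneg_right (min_le_left s (m - s)) h3]
  · have h1 : ENNReal.ofReal (freqWeight m j n) ≤ 2 ^ (2 * (m : ℝ) * (N - J)) := by
      rw [← ofReal_two_rpow]
      refine ENNReal.ofReal_le_ofReal ((min_le_right _ _).trans ?_)
      rw [mul_sub, Real.rpow_sub two_pos, h4, h4, Real.rpow_natCast, Real.rpow_natCast, ← div_pow]
      gcongr
      exact one_add_sq_le_block n
    refine (mul_le_mul' le_rfl h1).trans ?_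
    rw [← two_rpow_add]
    refine ENNReal.rpow_le_rpow_of_exponent_le (by norm_num) ?_
    have h2 : (((J : ℤ) - N : ℤ).natAbs : ℝ) = J - N := by
      rw [Nat.cast_natAbs, abs_of_nonneg (by omega)]
      push_cast
      ring
    have h3 : (0 : ℝ) ≤ J - N := by
      have : (N : ℝ) ≤ J := by exact_mod_cast hle
      linarith
    rw [h2, decay]
    nlinarith [mul_le_mul_of_nonneg_right (min_le_right s (m - s)) h3]

theorem tsum_decay_ne_top {t : ℝ} (ht : 0 < t) : ∑' z : ℤ, (2 : ℝ≥0∞) ^ (-t * z.natAbs) ≠ ∞ := by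
  have h1 : ∑' z : ℤ, (2 : ℝ≥0∞) ^ (-t * z.natAbs)
      ≤ 2 * ∑' p : ℕ, (2 : ℝ≥0∞) ^ (-t * p) := by
    rw [tsum_of_nat_of_neg_add_one ENNReal.summable ENNReal.summable, two_mul]
    refine add_le_add (le_of_eq (tsum_congr fun p => by simp)) (ENNReal.tsum_le_tsum fun p => ?_)
    refine ENNReal.rpow_le_rpow_of_exponent_le (by norm_num) ?_
    have : ((-((p : ℤ) + 1)).natAbs : ℝ) = p + 1 := by
      rw [Int.natAbs_neg]
      exact_mod_cast rfl
    rw [this]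
    nlinarith
  refine ne_top_of_le_ne_top (ENNReal.mul_ne_top (by finiteness) ?_) h1
  have := tsum_two_rpow_ne_top ht 0
  simpa using this

theorem tsum_decay_nat_le (t : ℝ) (N : ℕ) :
    ∑' J : ℕ, (2 : ℝ≥0∞) ^ (-t * ((J : ℤ) - N : ℤ).natAbs)
      ≤ ∑' z : ℤ, (2 : ℝ≥0∞) ^ (-t * z.natAbs) := by
  refine ENNReal.tsum_comp_le_tsum_of_injective (f := fun J : ℕ => (J : ℤ) - N) ?_
    (fun z : ℤ => (2 : ℝ≥0∞) ^ (-t * z.natAbs))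
  intro a b hab
  simp only at hab
  omega

/-! ### Mixed differences and Fourier coefficients -/

theorem fourier_add_apply (n : ℤ) (x y : UnitAddCircle) :
    fourier n (x + y) = fourier n x * fourier n y := by
  simp only [fourier_apply, smul_add, AddCircle.toCircle_add, Circle.coe_mul]

theorem mFourier_add_apply (n : Fin d → ℤ) (x y : UnitAddTorus (Fin d)) :
    UnitAddTorus.mFourier n (x + y) = UnitAddTorus.mFourier n x * UnitAddTorus.mFourier n y := by
  simp only [UnitAddTorus.mFourier, ContinuousMap.coe_mk, Pi.add_apply, fourier_add_apply,
    Finset.prod_mul_distrib]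

theorem mFourier_single_apply (n : Fin d → ℤ) (i : Fin d) (t : UnitAddCircle) :
    UnitAddTorus.mFourier n (Pi.single i t) = fourier (n i) t := by
  simp only [UnitAddTorus.mFourier, ContinuousMap.coe_mk]
  rw [Finset.prod_eq_single i]
  · rw [Pi.single_eq_same]
  · intro i' _ hi'
    rw [Pi.single_eq_of_ne hi', fourier_eval_zero]
  · simp

theorem fourier_natCast_mul (n : ℤ) (a : ℕ) (h : ℝ) :
    fourier n ((a * h : ℝ) : UnitAddCircle) = fourier n (h : UnitAddCircle) ^ a := by
  rw [fourier_coe_apply, fourier_coe_apply, ← Complex.exp_nat_mul]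
  congr 1
  push_cast
  ring

theorem measurePreserving_add_torus (y : UnitAddTorus (Fin d)) :
    MeasurePreserving (fun x => x + y) (vol d) (vol d) :=
  measurePreserving_add_right (vol d) y

theorem mFourierCoeff_comp_add (f : UnitAddTorus (Fin d) → ℂ) (y : UnitAddTorus (Fin d))
    (n : Fin d → ℤ) : UnitAddTorus.mFourierCoeff (fun x => f (x + y)) n
      = UnitAddTorus.mFourier n y * UnitAddTorus.mFourierCoeff f n := by
  rw [mFourierCoeff_eq, mFourierCoeff_eq, ← integral_const_mul,
    ← integral_add_right_eq_self (μ := vol d) (fun x => UnitAddTorus.mFourier n y *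
      (UnitAddTorus.mFourier (-n) x * f x)) y]
  refine integral_congr_ae (Filter.Eventually.of_forall fun x => ?_)
  have h1 : UnitAddTorus.mFourier n y * UnitAddTorus.mFourier (-n) y = 1 := by
    rw [← UnitAddTorus.mFourier_add, add_neg_cancel, UnitAddTorus.mFourier_zero,
      ContinuousMap.one_apply]
  simp only
  rw [mFourier_add_apply]
  linear_combination (-(UnitAddTorus.mFourier (-n) x * f (x + y))) * h1

theorem memLp_coordDifference (r : ℕ) (h : ℝ) (i : Fin d) {f : UnitAddTorus (Fin d) → ℂ}
    (hf : MemLp f 2 (vol d)) : MemLp (coordDifference r h i f) 2 (vol d) := by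
  unfold coordDifference
  refine memLp_finsetSum _ fun a _ => ?_
  exact (hf.comp_measurePreserving (measurePreserving_add_torus _)).const_mul _

theorem integrable_mFourier_mul {f : UnitAddTorus (Fin d) → ℂ} (hf : Integrable f (vol d))
    (n : Fin d → ℤ) : Integrable (fun x => UnitAddTorus.mFourier n x * f x) (vol d) := by
  refine hf.bdd_mul (c := 1) (UnitAddTorus.mFourier n).continuous.aestronglyMeasurable
    (Filter.Eventually.of_forall fun x => ?_)
  exact ((UnitAddTorus.mFourier n).norm_coe_le_norm x).trans UnitAddTorus.mFourier_norm.le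

/-- A translation multiplies a Fourier coefficient by a character value, and the binomial theorem
sums the resulting powers. -/
theorem mFourierCoeff_coordDifference (r : ℕ) (h : ℝ) (i : Fin d) {f : UnitAddTorus (Fin d) → ℂ}
    (hf : MemLp f 2 (vol d)) (n : Fin d → ℤ) :
    UnitAddTorus.mFourierCoeff (coordDifference r h i f) n
      = (fourier (n i) (h : UnitAddCircle) - 1) ^ r * UnitAddTorus.mFourierCoeff f n := by
  have hi : ∀ a ∈ Finset.range (r + 1), Integrable (fun x =>
      ((-1 : ℂ) ^ (r - a) * (r.choose a : ℂ)) * (UnitAddTorus.mFourier (-n) x *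
        f (x + Pi.single i ((a * h : ℝ) : UnitAddCircle)))) (vol d) := by
    intro a _
    refine (integrable_mFourier_mul ?_ (-n)).const_mul _
    exact (hf.comp_measurePreserving (measurePreserving_add_torus _)).integrable (by norm_num)
  calc UnitAddTorus.mFourierCoeff (coordDifference r h i f) n
      = ∫ x, ∑ a ∈ Finset.range (r + 1), ((-1 : ℂ) ^ (r - a) * (r.choose a : ℂ)) *
          (UnitAddTorus.mFourier (-n) x *
            f (x + Pi.single i ((a * h : ℝ) : UnitAddCircle))) ∂vol d := by
        rw [mFourierCoeff_eq]
        refine integral_congr_ae (Filter.Eventually.of_forall fun x => ?_)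
        simp only [coordDifference, Finset.mul_sum]
        exact Finset.sum_congr rfl fun a _ => by ring
    _ = ∑ a ∈ Finset.range (r + 1), ((-1 : ℂ) ^ (r - a) * (r.choose a : ℂ)) *
          (fourier (n i) (h : UnitAddCircle) ^ a * UnitAddTorus.mFourierCoeff f n) := by
        rw [integral_finsetSum _ hi]
        refine Finset.sum_congr rfl fun a _ => ?_
        have hc := mFourierCoeff_comp_add f (Pi.single i ((a * h : ℝ) : UnitAddCircle)) n
        rw [mFourierCoeff_eq, mFourier_single_apply, fourier_natCast_mul] at hc
        rw [integral_const_mul, hc]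
    _ = _ := by
        rw [sub_eq_add_neg, add_pow, Finset.sum_mul]
        exact Finset.sum_congr rfl fun a _ => by ring

theorem foldr_coordDifference (r : ℕ) (h : Fin d → ℝ) {f : UnitAddTorus (Fin d) → ℂ}
    (hf : MemLp f 2 (vol d)) (L : List (Fin d)) :
    MemLp (L.foldr (fun i g => coordDifference r (h i) i g) f) 2 (vol d) ∧
    ∀ n : Fin d → ℤ, (∀ i ∈ L, 1 ≤ ‖fourier (n i) (h i : UnitAddCircle) - 1‖ₑ) →
      ‖UnitAddTorus.mFourierCoeff f n‖ₑ ≤ ‖UnitAddTorus.mFourierCoeff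
        (L.foldr (fun i g => coordDifference r (h i) i g) f) n‖ₑ := by
  induction L with
  | nil => exact ⟨hf, fun n _ => le_rfl⟩
  | cons i L ih =>
    refine ⟨memLp_coordDifference r (h i) i ih.1, fun n hn => ?_⟩
    rw [List.foldr_cons, mFourierCoeff_coordDifference r (h i) i ih.1, enorm_mul, enorm_pow]
    refine (ih.2 n fun i' hi' => hn i' (List.mem_cons_of_mem _ hi')).trans ?_
    exact le_mul_of_one_le_left zero_le (one_le_pow₀ (hn i List.mem_cons_self))

/-- With $b$ the block of `n`, $2^{b-1}\le|n|<2^b$, so the step $2^{-(b+1)}$ places $|n|h$ between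
$1/4$ and $1/2$. The angle lies between $\pi/2$ and $\pi$, the cosine is nonpositive, and the real
part of the difference is at most $-1$. -/
theorem one_le_enorm_fourier_sub_one {n : ℤ} (hn : block n ≠ 0) :
    1 ≤ ‖fourier n (((2 : ℝ) ^ (-((block n : ℝ) + 1)) : ℝ) : UnitAddCircle) - 1‖ₑ := by
  set b := block n with hb
  set h : ℝ := (2 : ℝ) ^ (-((b : ℝ) + 1)) with hh
  have hhe : h * 2 ^ (b + 1) = 1 := by
    rw [hh, ← Real.rpow_natCast, ← Real.rpow_add two_pos]
    simp
  have hpos : 0 < h := by positivity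
  have h1 : (n.natAbs : ℝ) < 2 ^ b := by
    have : n.natAbs < 2 ^ b := Nat.lt_size_self _
    exact_mod_cast this
  have h2 : (2 : ℝ) ^ b ≤ 2 * n.natAbs := by
    have : 2 ^ (b - 1) ≤ n.natAbs := Nat.lt_size.1 (by unfold block at hb; omega)
    obtain ⟨c, hc⟩ := Nat.exists_eq_succ_of_ne_zero hn
    rw [hc, Nat.succ_sub_one] at this
    rw [hc, Nat.succ_eq_add_one, pow_succ, mul_comm]
    have : (2 : ℝ) ^ c ≤ n.natAbs := by exact_mod_cast this
    linarith
  have habs : |2 * Real.pi * n * h| = 2 * Real.pi * (n.natAbs * h) := by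
    rw [abs_mul, abs_mul, abs_of_pos (by positivity : (0 : ℝ) < 2 * Real.pi), abs_of_pos hpos,
      Nat.cast_natAbs, Int.cast_abs, mul_assoc]
  have hlow : (1 : ℝ) / 4 ≤ n.natAbs * h := by
    have : (2 : ℝ) ^ b * h ≤ 2 * n.natAbs * h := by gcongr
    rw [pow_succ] at hhe
    linarith
  have hupp : (n.natAbs : ℝ) * h ≤ 1 / 2 := by
    have : (n.natAbs : ℝ) * h ≤ 2 ^ b * h := by gcongr
    rw [pow_succ] at hhe
    linarith
  have hcos : Real.cos (2 * Real.pi * n * h) ≤ 0 := by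
    rw [← Real.cos_abs, habs]
    refine Real.cos_nonpos_of_pi_div_two_le_of_le ?_ ?_ <;> nlinarith [Real.pi_pos]
  have hre : (fourier n ((h : ℝ) : UnitAddCircle) - 1).re = Real.cos (2 * Real.pi * n * h) - 1 := by
    rw [fourier_coe_apply]
    have : (2 * Real.pi * Complex.I * n * h / (1 : ℝ) : ℂ)
        = ((2 * Real.pi * n * h : ℝ) : ℂ) * Complex.I := by push_cast; ring
    rw [this, Complex.sub_re, Complex.exp_ofReal_mul_I_re, Complex.one_re]
  rw [← ofReal_norm, ENNReal.one_le_ofReal]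
  refine le_trans ?_ (Complex.abs_re_le_norm _)
  rw [hre, abs_of_nonpos (by linarith)]
  linarith

/-- The `ℓ₂` mass of the Fourier coefficients in a dyadic block is controlled by the Besov norm. -/
theorem tsum_block_le_besovNorm {s : ℝ} (hs : 0 < s) (r : ℕ) {f : UnitAddTorus (Fin d) → ℂ}
    (hf : MemLp f 2 (vol d)) (ℓ : Fin d → ℕ) :
    (2 : ℝ≥0∞) ^ (2 * s * (∑ i, ℓ i : ℕ)) * ∑' n : {n : Fin d → ℤ // (fun i => block (n i)) = ℓ},
      ‖UnitAddTorus.mFourierCoeff f n‖ₑ ^ 2 ≤ besovNorm s r f ^ 2 := by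
  classical
  -- Block $0$ contains only the frequency $0$, which a difference of positive order annihilates;
  -- such coordinates are left undifferenced and carry weight $1$.
  set u : Finset (Fin d) := Finset.univ.filter fun i => ℓ i ≠ 0 with hu
  set h : Fin d → ℝ := fun i => (2 : ℝ) ^ (-((ℓ i : ℝ) + 1)) with hh
  have hh0 : ∀ i, 0 < h i := fun i => by simp only [hh]; positivity
  have hfold := foldr_coordDifference r h hf ((List.finRange d).filter fun i => i ∈ u)
  set g := mixedDifference r u h f with hg
  have hg2 : MemLp g 2 (vol d) := hfold.1
  have hblock : ∑' n : {n : Fin d → ℤ // (fun i => block (n i)) = ℓ},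
      ‖UnitAddTorus.mFourierCoeff f n‖ₑ ^ 2 ≤ eLpNorm g 2 (vol d) ^ 2 := by
    rw [← tsum_enorm_mFourierCoeff_sq hg2]
    refine le_trans (ENNReal.tsum_le_tsum fun n => pow_le_pow_left' (hfold.2 n ?_) 2)
      (ENNReal.tsum_comp_le_tsum_of_injective Subtype.val_injective
        fun n : Fin d → ℤ => ‖UnitAddTorus.mFourierCoeff g n‖ₑ ^ 2)
    intro i hi
    have hiu : ℓ i ≠ 0 := by
      have := List.of_mem_filter hi
      simpa [hu] using this
    have hb : block (n.1 i) = ℓ i := congrFun n.2 i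
    have := one_le_enorm_fourier_sub_one (n := n.1 i) (by rw [hb]; exact hiu)
    rwa [hb] at this
  have hsemi : ENNReal.ofReal (∏ i ∈ u, |h i| ^ (-s)) * eLpNorm g 2 (vol d) ≤ besovNorm s r f := by
    refine le_trans ?_ (Finset.single_le_sum (f := fun u => besovSeminorm s r u f)
      (fun _ _ => zero_le) (Finset.mem_univ u))
    refine le_iSup₂_of_le (f := fun (h : Fin d → ℝ) (_ : ∀ i ∈ u, 0 < |h i| ∧ |h i| ≤ 1) =>
      ENNReal.ofReal (∏ i ∈ u, |h i| ^ (-s)) * eLpNorm (mixedDifference r u h f) 2 (vol d)) h ?_ le_rfl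
    intro i _
    rw [abs_of_pos (hh0 i)]
    refine ⟨hh0 i, Real.rpow_le_one_of_one_le_of_nonpos one_le_two ?_⟩
    have : (0 : ℝ) ≤ ℓ i := Nat.cast_nonneg _
    linarith
  -- Here $|h_i|^{-s}=2^{s(\ell_i+1)}\ge2^{s\ell_i}$, and coordinates outside `u` have $\ell_i=0$.
  have hpow : (2 : ℝ≥0∞) ^ (s * (∑ i, ℓ i : ℕ)) ≤ ENNReal.ofReal (∏ i ∈ u, |h i| ^ (-s)) := by
    rw [← ofReal_two_rpow]
    refine ENNReal.ofReal_le_ofReal ?_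
    have e1 : ((∑ i, ℓ i : ℕ) : ℝ) = ∑ i ∈ u, (ℓ i : ℝ) := by
      push_cast
      rw [hu, Finset.sum_filter]
      refine Finset.sum_congr rfl fun i _ => ?_
      split_ifs with hc
      · rfl
      · rw [not_not.1 hc, Nat.cast_zero]
    rw [e1, Finset.mul_sum, Real.rpow_sum_of_pos two_pos]
    refine Finset.prod_le_prod (fun _ _ => by positivity) fun i _ => ?_
    rw [abs_of_pos (hh0 i)]
    simp only [hh]
    rw [← Real.rpow_mul two_pos.le]
    refine Real.rpow_le_rpow_of_exponent_le one_le_two ?_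
    nlinarith
  calc _ ≤ (2 : ℝ≥0∞) ^ (2 * s * (∑ i, ℓ i : ℕ)) * eLpNorm g 2 (vol d) ^ 2 :=
        mul_le_mul' le_rfl hblock
    _ = ((2 : ℝ≥0∞) ^ (s * (∑ i, ℓ i : ℕ)) * eLpNorm g 2 (vol d)) ^ 2 := by
        rw [mul_pow, pow_two (2 ^ _), ← two_rpow_add]
        congr 2
        ring
    _ ≤ _ := pow_le_pow_left' ((mul_le_mul' hpow le_rfl).trans hsemi) 2

variable {ψ : ℝ → ℝ} {m : ℕ}

/-! ### Weighted level norms -/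

/-- The `ℓ₂` norm of the wavelet coefficients of level `a - 𝟏`, weighted with `2^{s|𝐣|₁}`. -/
noncomputable def levelNorm (ψ : ℝ → ℝ) (s : ℝ) (f : UnitAddTorus (Fin d) → ℂ) (a : Fin d → ℕ) :
    ℝ≥0∞ :=
  ((2 : ℝ≥0∞) ^ (2 * s * (∑ i, (a i - 1) : ℕ)) *
    ∑ k, ‖coefficient ψ f (shiftedLevel a) k‖ₑ ^ 2) ^ (1 / 2 : ℝ)

theorem levelNorm_sq (ψ : ℝ → ℝ) (s : ℝ) (f : UnitAddTorus (Fin d) → ℂ) (a : Fin d → ℕ) :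
    levelNorm ψ s f a ^ 2 = (2 : ℝ≥0∞) ^ (2 * s * (∑ i, (a i - 1) : ℕ)) *
      ∑ k, ‖coefficient ψ f (shiftedLevel a) k‖ₑ ^ 2 := by
  rw [levelNorm, ← ENNReal.rpow_two, ← ENNReal.rpow_mul]
  norm_num

theorem sobolevNorm_sq (s : ℝ) (f : UnitAddTorus (Fin d) → ℂ) :
    sobolevNorm s f ^ 2 = ∑' k : Fin d → ℤ, ‖UnitAddTorus.mFourierCoeff f k‖ₑ ^ 2 *
      ENNReal.ofReal (∏ i, (1 + (k i : ℝ) ^ 2) ^ s) := by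
  rw [sobolevNorm, ← ENNReal.rpow_two, ← ENNReal.rpow_mul]
  norm_num

theorem le_of_sq_le_mul_sq {x y C : ℝ≥0∞} (h : x ^ 2 ≤ C * y ^ 2) : x ≤ C ^ (1 / 2 : ℝ) * y := by
  have h1 := ENNReal.rpow_le_rpow (z := 1 / 2) h (by norm_num)
  rw [ENNReal.mul_rpow_of_nonneg _ _ (by norm_num), ← ENNReal.rpow_two, ← ENNReal.rpow_two,
    ← ENNReal.rpow_mul, ← ENNReal.rpow_mul] at h1
  norm_num at h1
  simpa using h1

theorem tsum_mul_le_sqrt {ι : Type*} (x y : ι → ℝ≥0∞) :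
    ∑' a, x a * y a ≤ (∑' a, x a ^ 2) ^ (1 / 2 : ℝ) * (∑' a, y a ^ 2) ^ (1 / 2 : ℝ) := by
  rw [ENNReal.tsum_eq_iSup_sum]
  refine iSup_le fun F => ?_
  refine (ENNReal.inner_le_Lp_mul_Lq F x y (p := 2) (q := 2)
    (by constructor <;> norm_num)).trans ?_
  simp only [ENNReal.rpow_two]
  gcongr <;> exact ENNReal.sum_le_tsum F

theorem tsum_fiber {ι κ : Type*} (b : ι → κ) (f : ι → ℝ≥0∞) :
    ∑' x, f x = ∑' y, ∑' x : {x // b x = y}, f x := by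
  rw [← (Equiv.sigmaFiberEquiv b).tsum_eq, ENNReal.tsum_sigma']
  rfl

namespace IsWavelet

/-- The loss $2^{|\mathbf j|_1/2}$ against the built-in weight $2^{s|\mathbf j|_1}$ of `levelNorm`
leaves the rate $s-1/2$. -/
theorem exists_levelPart_le (h : IsWavelet ψ m) (d : ℕ) (s : ℝ) : ∃ C : ℝ≥0∞, C ≠ ∞ ∧
    ∀ (f : UnitAddTorus (Fin d) → ℂ) (a : Fin d → ℕ) (x : UnitAddTorus (Fin d)),
      ‖levelPart ψ f (shiftedLevel a) x‖ₑ
        ≤ C * (levelNorm ψ s f a * 2 ^ (-(s - 1 / 2) * (∑ i, (a i - 1) : ℕ))) := by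
  obtain ⟨C, hC, hle⟩ := h.exists_enorm_levelPart_le d
  refine ⟨C, hC, fun f a x => (hle f _ (neg_one_le_shiftedLevel a) x).trans
    (mul_le_mul' le_rfl (le_of_eq ?_))⟩
  simp only [toNat_shiftedLevel]
  rw [levelNorm, ENNReal.mul_rpow_of_nonneg _ _ (by norm_num), ← ENNReal.rpow_mul,
    ← ENNReal.rpow_natCast, ← ENNReal.rpow_mul, mul_right_comm, ← two_rpow_add, mul_comm]
  congr 2
  ring

theorem exists_levelNorm_sq_le (h : IsWavelet ψ m) (d : ℕ) (s : ℝ) : ∃ C : ℝ≥0∞, C ≠ ∞ ∧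
    ∀ f : UnitAddTorus (Fin d) → ℂ, MemLp f 2 (vol d) → ∀ a : Fin d → ℕ,
      levelNorm ψ s f a ^ 2 ≤ C * ∑' l : Fin d → ℤ,
        (∏ i, (2 : ℝ≥0∞) ^ (2 * s * (a i - 1 : ℕ)) *
          ENNReal.ofReal (freqWeight m (a i - 1 : ℕ) (l i))) *
          ‖UnitAddTorus.mFourierCoeff f l‖ₑ ^ 2 := by
  obtain ⟨C, hC, hle⟩ := h.exists_sum_coefficient_sq_le d
  refine ⟨C, hC, fun f hf a => ?_⟩
  rw [levelNorm_sq]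
  refine (mul_le_mul' le_rfl (hle f hf _ (neg_one_le_shiftedLevel a))).trans (le_of_eq ?_)
  rw [mul_left_comm, ← ENNReal.tsum_mul_left]
  congr 1
  refine tsum_congr fun l => ?_
  rw [← mul_assoc]
  congr 1
  rw [Finset.prod_mul_distrib, ← two_rpow_sum, ← Finset.mul_sum]
  push_cast
  congr 1
  refine Finset.prod_congr rfl fun i _ => ?_
  simp only [freqWeight, toNat_shiftedLevel, Int.toNat_natCast]

/-- For $s=m$ the level weight cancels the denominator $4^{jm}$ of the damping exactly, frequency by
frequency. No decay is left to sum over levels, so the bound is for one level at a time. -/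
theorem exists_levelNorm_sq_le_sobolevNorm (h : IsWavelet ψ m) (d : ℕ) : ∃ C : ℝ≥0∞, C ≠ ∞ ∧
    ∀ f : UnitAddTorus (Fin d) → ℂ, MemLp f 2 (vol d) → ∀ a : Fin d → ℕ,
      levelNorm ψ m f a ^ 2 ≤ C * sobolevNorm m f ^ 2 := by
  obtain ⟨C, hC, hle⟩ := h.exists_levelNorm_sq_le d m
  refine ⟨C, hC, fun f hf a => (hle f hf a).trans (mul_le_mul' le_rfl ?_)⟩
  rw [sobolevNorm_sq]
  refine ENNReal.tsum_le_tsum fun l => ?_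
  rw [mul_comm]
  refine mul_le_mul' le_rfl ?_
  rw [ENNReal.ofReal_prod_of_nonneg fun _ _ => by positivity]
  refine Finset.prod_le_prod' fun i _ => ?_
  rw [← ofReal_two_rpow, ← ENNReal.ofReal_mul (by positivity)]
  refine ENNReal.ofReal_le_ofReal ?_
  refine (mul_le_mul_of_nonneg_left (min_le_right _ _) (by positivity)).trans (le_of_eq ?_)
  have h4 : (2 : ℝ) ^ (2 * (m : ℝ) * (a i - 1 : ℕ)) = (4 ^ (a i - 1)) ^ m := by
    rw [show (4 : ℝ) = 2 ^ 2 by norm_num, ← pow_mul, ← pow_mul, ← Real.rpow_natCast]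
    congr 1
    push_cast
    ring
  rw [h4, Int.toNat_natCast, div_pow, Real.rpow_natCast]
  field_simp

/-- After exchanging the sums over levels and frequencies, the sum over levels factorises by
coordinates, and each factor is a two-sided geometric series centred at the block of the frequency.
-/
theorem exists_tsum_levelNorm_sq_le_sobolevNorm (h : IsWavelet ψ m) (d : ℕ) {s : ℝ} (hs : 0 < s)
    (hsm : s < m) : ∃ C : ℝ≥0∞, C ≠ ∞ ∧
    ∀ f : UnitAddTorus (Fin d) → ℂ, MemLp f 2 (vol d) →
      ∑' a : Fin d → ℕ, levelNorm ψ s f a ^ 2 ≤ C * sobolevNorm s f ^ 2 := by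
  obtain ⟨C, hC, hle⟩ := h.exists_levelNorm_sq_le d s
  set R : ℝ≥0∞ := ∑' z : ℤ, (2 : ℝ≥0∞) ^ (-decay s m * z.natAbs) with hR
  have hRt : R ≠ ∞ := tsum_decay_ne_top (decay_pos hs hsm)
  -- The $2$ accounts for levels $-1$ and $0$, the $4^s$ for comparing $4^{\text{block}}$ with
  -- $1+n^2$, and `R` is the geometric series.
  set D : ℝ≥0∞ := 2 * (ENNReal.ofReal (4 ^ s) * R) with hD
  have hDt : D ≠ ∞ := ENNReal.mul_ne_top ENNReal.ofNat_ne_top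
    (ENNReal.mul_ne_top ENNReal.ofReal_ne_top hRt)
  have hone : ∀ n : ℤ, ∑' a : ℕ, (2 : ℝ≥0∞) ^ (2 * s * (a - 1 : ℕ)) *
      ENNReal.ofReal (freqWeight m (a - 1 : ℕ) n) ≤ D * ENNReal.ofReal ((1 + (n : ℝ) ^ 2) ^ s) := by
    intro n
    refine (tsum_comp_sub_one_le fun J : ℕ => (2 : ℝ≥0∞) ^ (2 * s * J) *
      ENNReal.ofReal (freqWeight m J n)).trans ?_
    rw [hD, mul_assoc, mul_assoc]
    refine mul_le_mul' le_rfl ?_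
    refine (ENNReal.tsum_le_tsum fun J => ?_ : _ ≤ ∑' J : ℕ, (2 : ℝ≥0∞) ^ (2 * s * block n) *
      2 ^ (-decay s m * ((J : ℤ) - block n : ℤ).natAbs)).trans ?_
    · exact two_rpow_mul_freqWeight_le s m J n
    · rw [ENNReal.tsum_mul_left, mul_comm R, ← mul_assoc, ← ENNReal.ofReal_mul (by positivity)]
      refine mul_le_mul' ?_ (tsum_decay_nat_le _ _)
      rw [← ofReal_two_rpow]
      refine ENNReal.ofReal_le_ofReal ?_
      rw [← Real.mul_rpow (by norm_num) (by positivity)]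
      refine le_trans (le_of_eq ?_) (Real.rpow_le_rpow (by positivity) (four_pow_block_le n) hs.le)
      rw [show (4 : ℝ) = 2 ^ 2 by norm_num, ← pow_mul, ← Real.rpow_natCast,
        ← Real.rpow_mul two_pos.le]
      congr 1
      push_cast
      ring
  refine ⟨C * D ^ d, by finiteness, fun f hf => ?_⟩
  refine (ENNReal.tsum_le_tsum fun a => hle f hf a).trans ?_
  rw [ENNReal.tsum_mul_left, ENNReal.tsum_comm, sobolevNorm_sq, mul_assoc]
  refine mul_le_mul' le_rfl ?_
  rw [← ENNReal.tsum_mul_left]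
  refine ENNReal.tsum_le_tsum fun l => ?_
  rw [ENNReal.tsum_mul_right, mul_comm (‖_‖ₑ ^ 2), ← mul_assoc]
  refine mul_le_mul' ?_ le_rfl
  rw [tsum_pi_prod fun i (n : ℕ) => (2 : ℝ≥0∞) ^ (2 * s * (n - 1 : ℕ)) *
    ENNReal.ofReal (freqWeight m (n - 1 : ℕ) (l i))]
  refine (Finset.prod_le_prod' fun i _ => hone (l i)).trans (le_of_eq ?_)
  rw [Finset.prod_mul_distrib, Finset.prod_const, Finset.card_fin,
    ENNReal.ofReal_prod_of_nonneg fun _ _ => by positivity]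

/-- Frequencies are grouped by blocks, each controlled by the Besov norm. The bound is then a
convolution of a bounded sequence with a summable kernel, hence uniform in the level but not
summable. -/
theorem exists_levelNorm_sq_le_besovNorm (h : IsWavelet ψ m) (d : ℕ) {s : ℝ} (hs : 0 < s)
    (hsm : s < m) (r : ℕ) : ∃ C : ℝ≥0∞, C ≠ ∞ ∧
    ∀ f : UnitAddTorus (Fin d) → ℂ, MemLp f 2 (vol d) → ∀ a : Fin d → ℕ,
      levelNorm ψ s f a ^ 2 ≤ C * besovNorm s r f ^ 2 := by
  obtain ⟨C, hC, hle⟩ := h.exists_levelNorm_sq_le d s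
  set R : ℝ≥0∞ := ∑' z : ℤ, (2 : ℝ≥0∞) ^ (-decay s m * z.natAbs) with hR
  have hRt : R ≠ ∞ := tsum_decay_ne_top (decay_pos hs hsm)
  refine ⟨C * R ^ d, by finiteness, fun f hf a => (hle f hf a).trans ?_⟩
  rw [mul_assoc]
  refine mul_le_mul' le_rfl ?_
  rw [tsum_fiber fun (l : Fin d → ℤ) i => block (l i)]
  calc _ ≤ ∑' ℓ : Fin d → ℕ, (∏ i, (2 : ℝ≥0∞) ^ (-decay s m *
            (((a i - 1 : ℕ) : ℤ) - ℓ i : ℤ).natAbs)) * besovNorm s r f ^ 2 := by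
        refine ENNReal.tsum_le_tsum fun ℓ => ?_
        refine le_trans ?_ (mul_le_mul' le_rfl (tsum_block_le_besovNorm hs r hf ℓ))
        rw [← mul_assoc, ← ENNReal.tsum_mul_left]
        refine ENNReal.tsum_le_tsum fun l => mul_le_mul' ?_ le_rfl
        have e : (2 : ℝ≥0∞) ^ (2 * s * (∑ i, ℓ i : ℕ)) = ∏ i, (2 : ℝ≥0∞) ^ (2 * s * ℓ i) := by
          rw [← two_rpow_sum, ← Finset.mul_sum]
          push_cast
          rfl
        rw [e, ← Finset.prod_mul_distrib]
        refine Finset.prod_le_prod' fun i _ => ?_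
        have hl : block (l.1 i) = ℓ i := congrFun l.2 i
        have := two_rpow_mul_freqWeight_le s m ((a i - 1 : ℕ) : ℤ) (l.1 i)
        rw [hl, Int.toNat_natCast] at this
        rwa [mul_comm (2 ^ (-decay s m * _))]
    _ ≤ R ^ d * besovNorm s r f ^ 2 := by
        rw [ENNReal.tsum_mul_right]
        refine mul_le_mul' ?_ le_rfl
        rw [tsum_pi_prod fun i (n : ℕ) => (2 : ℝ≥0∞) ^ (-decay s m *
            (((a i - 1 : ℕ) : ℤ) - n : ℤ).natAbs)]
        refine (Finset.prod_le_prod' fun i _ => ?_ : _ ≤ ∏ _i : Fin d, R).trans (by simp)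
        refine le_trans (le_of_eq (tsum_congr fun n => ?_))
          (tsum_decay_nat_le (decay s m) (a i - 1))
        rw [← Int.natAbs_neg, neg_sub]

/-! ### Error bounds -/

theorem exists_uniformError_le_of_levelNorm_le (h : IsWavelet ψ m) (d : ℕ) {s : ℝ}
    (hs : 1 / 2 < s) : ∃ C : ℝ≥0∞, C ≠ ∞ ∧ ∀ n : ℕ, 1 ≤ n →
      ∀ f : UnitAddTorus (Fin (d + 1)) → ℂ, MemLp f 2 (vol (d + 1)) → ∀ M : ℝ≥0∞, M ≠ ∞ →
        (∀ a, levelNorm ψ s f a ≤ M) →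
          uniformError ψ n f ≤ C * (2 ^ (-(s - 1 / 2) * n) * n ^ d) * M := by
  obtain ⟨C, hC, hle⟩ := h.exists_levelPart_le (d + 1) s
  have ht : 0 < s - 1 / 2 := by linarith
  obtain ⟨C', hC', hle'⟩ := exists_tsum_tail_le ht d
  refine ⟨C * C', by finiteness, fun n hn f hf M hM hfM => ?_⟩
  have hU : ∀ (a : Fin (d + 1) → ℕ) x, ‖levelPart ψ f (shiftedLevel a) x‖ₑ
      ≤ (C * M) * 2 ^ (-(s - 1 / 2) * (∑ i, (a i - 1) : ℕ)) := by
    intro a x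
    refine (hle f a x).trans ?_
    rw [mul_assoc]
    exact mul_le_mul' le_rfl (mul_le_mul' (hfM a) le_rfl)
  refine (h.uniformError_le_tsum hf hU ?_ n).trans ?_
  · rw [ENNReal.tsum_mul_left]
    exact ENNReal.mul_ne_top (by finiteness) (tsum_two_rpow_level_ne_top ht d)
  · have e : ∀ a : Fin (d + 1) → ℕ, (if ∑ i, (a i - 1) ≤ n then 0 else
        (C * M) * (2 : ℝ≥0∞) ^ (-(s - 1 / 2) * (∑ i, (a i - 1) : ℕ)))
        = (C * M) * (if ∑ i, (a i - 1) ≤ n then 0 else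
          (2 : ℝ≥0∞) ^ (-(s - 1 / 2) * (∑ i, (a i - 1) : ℕ))) := by
      intro a
      split_ifs <;> simp
    simp only [e]
    rw [ENNReal.tsum_mul_left]
    refine (mul_le_mul' le_rfl (hle' n hn)).trans (le_of_eq ?_)
    ring

/-- Cauchy–Schwarz over the omitted levels, with the tail estimate at the doubled rate $2(s-1/2)$;
its square root restores the rate and halves the exponent of `n`. -/
theorem exists_uniformError_le_of_tsum_levelNorm_le (h : IsWavelet ψ m) (d : ℕ) {s : ℝ}
    (hs : 1 / 2 < s) : ∃ C : ℝ≥0∞, C ≠ ∞ ∧ ∀ n : ℕ, 1 ≤ n →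
      ∀ f : UnitAddTorus (Fin (d + 1)) → ℂ, MemLp f 2 (vol (d + 1)) → ∀ M : ℝ≥0∞, M ≠ ∞ →
        ∑' a, levelNorm ψ s f a ^ 2 ≤ M ^ 2 →
          uniformError ψ n f ≤ C * (2 ^ (-(s - 1 / 2) * n) * (n : ℝ≥0∞) ^ ((d : ℝ) / 2)) * M := by
  obtain ⟨C, hC, hle⟩ := h.exists_levelPart_le (d + 1) s
  have ht : 0 < 2 * (s - 1 / 2) := by linarith
  obtain ⟨C', hC', hle'⟩ := exists_tsum_tail_le ht d
  refine ⟨C * C' ^ (1 / 2 : ℝ), by finiteness, fun n hn f hf M hM hfM => ?_⟩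
  have hMs : (∑' a, levelNorm ψ s f a ^ 2) ^ (1 / 2 : ℝ) ≤ M := by
    have h1 := ENNReal.rpow_le_rpow (z := 1 / 2) hfM (by norm_num)
    rw [← ENNReal.rpow_two M, ← ENNReal.rpow_mul] at h1
    norm_num at h1
    simpa using h1
  have hsq : ∀ q : ℕ, ((2 : ℝ≥0∞) ^ (-(s - 1 / 2) * q)) ^ 2 = 2 ^ (-(2 * (s - 1 / 2)) * q) := by
    intro q
    rw [pow_two, ← two_rpow_add]
    congr 1
    ring
  refine (h.uniformError_le_tsum hf (hle f) ?_ n).trans ?_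
  · rw [ENNReal.tsum_mul_left]
    refine ENNReal.mul_ne_top hC (ne_top_of_le_ne_top ?_ (tsum_mul_le_sqrt _ _))
    simp only [hsq]
    exact ENNReal.mul_ne_top (ne_top_of_le_ne_top hM hMs)
      (ENNReal.rpow_ne_top_of_nonneg (by norm_num) (tsum_two_rpow_level_ne_top ht d))
  · have e : ∀ a : Fin (d + 1) → ℕ, (if ∑ i, (a i - 1) ≤ n then 0 else
        C * (levelNorm ψ s f a * (2 : ℝ≥0∞) ^ (-(s - 1 / 2) * (∑ i, (a i - 1) : ℕ))))
        = C * (levelNorm ψ s f a * (if ∑ i, (a i - 1) ≤ n then 0 else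
          (2 : ℝ≥0∞) ^ (-(s - 1 / 2) * (∑ i, (a i - 1) : ℕ)))) := by
      intro a
      split_ifs <;> simp
    simp only [e]
    rw [ENNReal.tsum_mul_left, mul_assoc, mul_assoc]
    refine mul_le_mul' le_rfl ((tsum_mul_le_sqrt _ _).trans ?_)
    rw [mul_comm, ← mul_assoc]
    refine mul_le_mul' ?_ hMs
    have e2 : ∀ a : Fin (d + 1) → ℕ, (if ∑ i, (a i - 1) ≤ n then 0 else
          (2 : ℝ≥0∞) ^ (-(s - 1 / 2) * (∑ i, (a i - 1) : ℕ))) ^ 2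
        = if ∑ i, (a i - 1) ≤ n then 0 else
          (2 : ℝ≥0∞) ^ (-(2 * (s - 1 / 2)) * (∑ i, (a i - 1) : ℕ)) := by
      intro a
      split_ifs
      · simp
      · exact hsq _
    simp only [e2]
    refine (ENNReal.rpow_le_rpow (hle' n hn) (by norm_num)).trans (le_of_eq ?_)
    rw [ENNReal.mul_rpow_of_nonneg _ _ (by norm_num), ENNReal.mul_rpow_of_nonneg _ _ (by norm_num),
      ← ENNReal.rpow_mul, ← ENNReal.rpow_natCast, ← ENNReal.rpow_mul]
    congr 3 <;> ring

end IsWavelet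

/-! ### Conversion to real constants and the three estimates -/

/-- The added $1$ makes the real constant strictly positive even if `C` is zero. -/
theorem ofReal_rate {C : ℝ≥0∞} (hC : C ≠ ∞) (t e : ℝ) (he : 0 ≤ e) (n : ℕ) :
    C * (2 ^ (-t * n) * (n : ℝ≥0∞) ^ e)
      ≤ ENNReal.ofReal ((C.toReal + 1) * (2 : ℝ) ^ (-(n : ℝ) * t) * (n : ℝ) ^ e) := by
  rw [mul_assoc, ENNReal.ofReal_mul (by positivity), ENNReal.ofReal_mul (by positivity),
    ofReal_two_rpow, ← ENNReal.ofReal_rpow_of_nonneg (by positivity) he, ENNReal.ofReal_natCast]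
  refine mul_le_mul' ?_ (le_of_eq ?_)
  · rw [ENNReal.ofReal_add (by positivity) zero_le_one, ENNReal.ofReal_toReal hC]
    exact le_self_add
  · congr 2
    ring

end HyperbolicWavelet

theorem mainTheorem8 (d m : ℕ) (hd : 1 ≤ d) (hm : 1 ≤ m) (ψ : ℝ → ℝ)
    (hψ : HyperbolicWavelet.IsWavelet ψ m) :
    (∀ s : ℝ, 1 / 2 < s → s < m →
      ∃ C : ℝ, 0 < C ∧ ∀ n : ℕ, 1 ≤ n → ∀ f : UnitAddTorus (Fin d) → ℂ,
        HyperbolicWavelet.MemSobolev s f →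
          HyperbolicWavelet.uniformError ψ n f ≤
            ENNReal.ofReal (C * (2 : ℝ) ^ (-(n : ℝ) * (s - 1 / 2)) *
              (n : ℝ) ^ (((d : ℝ) - 1) / 2)) * HyperbolicWavelet.sobolevNorm s f) ∧
    (∀ s : ℝ, 1 / 2 < s → s < m → ∀ r : ℕ, s < r →
      ∃ C : ℝ, 0 < C ∧ ∀ n : ℕ, 1 ≤ n → ∀ f : UnitAddTorus (Fin d) → ℂ,
        HyperbolicWavelet.MemBesov s r f →
          HyperbolicWavelet.uniformError ψ n f ≤
            ENNReal.ofReal (C * (2 : ℝ) ^ (-(n : ℝ) * (s - 1 / 2)) *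
              (n : ℝ) ^ ((d : ℝ) - 1)) * HyperbolicWavelet.besovNorm s r f) ∧
    (∃ C : ℝ, 0 < C ∧ ∀ n : ℕ, 1 ≤ n → ∀ f : UnitAddTorus (Fin d) → ℂ,
        HyperbolicWavelet.MemSobolev (m : ℝ) f →
          HyperbolicWavelet.uniformError ψ n f ≤
            ENNReal.ofReal (C * (2 : ℝ) ^ (-(n : ℝ) * ((m : ℝ) - 1 / 2)) *
              (n : ℝ) ^ ((d : ℝ) - 1)) * HyperbolicWavelet.sobolevNorm (m : ℝ) f) := by
  -- The dimension becomes `d + 1`, so the logarithmic exponents are `d / 2` and `d`.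
  obtain ⟨d, rfl⟩ := Nat.exists_eq_add_of_le' hd
  have hm' : (1 : ℝ) ≤ m := by exact_mod_cast hm
  have hexp : ((d + 1 : ℕ) : ℝ) - 1 = d := by push_cast; ring
  simp only [hexp]
  refine ⟨fun s hs hsm => ?_, fun s hs hsm r _ => ?_, ?_⟩
  · obtain ⟨C, hC, hle⟩ := hψ.exists_uniformError_le_of_tsum_levelNorm_le d hs
    obtain ⟨C', hC', hle'⟩ := hψ.exists_tsum_levelNorm_sq_le_sobolevNorm (d + 1) (by linarith) hsm
    refine ⟨(C * C' ^ (1 / 2 : ℝ)).toReal + 1, by positivity, fun n hn f hf => ?_⟩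
    refine le_trans ?_ (mul_le_mul' (HyperbolicWavelet.ofReal_rate (by finiteness) (s - 1 / 2)
      ((d : ℝ) / 2) (by positivity) n) le_rfl)
    refine (hle n hn f hf.1 (C' ^ (1 / 2 : ℝ) * HyperbolicWavelet.sobolevNorm s f)
      (ENNReal.mul_ne_top (by finiteness) hf.2.ne) ((hle' f hf.1).trans (le_of_eq ?_))).trans
      (le_of_eq (by ring))
    rw [mul_pow, ← ENNReal.rpow_two (C' ^ (1 / 2 : ℝ)), ← ENNReal.rpow_mul]
    norm_num
  · obtain ⟨C, hC, hle⟩ := hψ.exists_uniformError_le_of_levelNorm_le d hs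
    obtain ⟨C', hC', hle'⟩ := hψ.exists_levelNorm_sq_le_besovNorm (d + 1) (by linarith) hsm r
    refine ⟨(C * C' ^ (1 / 2 : ℝ)).toReal + 1, by positivity, fun n hn f hf => ?_⟩
    refine le_trans ?_ (mul_le_mul' (HyperbolicWavelet.ofReal_rate (by finiteness) (s - 1 / 2)
      (d : ℝ) (by positivity) n) le_rfl)
    rw [ENNReal.rpow_natCast]
    exact (hle n hn f hf.1 (C' ^ (1 / 2 : ℝ) * HyperbolicWavelet.besovNorm s r f)
      (ENNReal.mul_ne_top (by finiteness) hf.2.ne)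
      fun a => HyperbolicWavelet.le_of_sq_le_mul_sq (hle' f hf.1 a)).trans (le_of_eq (by ring))
  · obtain ⟨C, hC, hle⟩ := hψ.exists_uniformError_le_of_levelNorm_le d
      (s := (m : ℝ)) (by linarith)
    obtain ⟨C', hC', hle'⟩ := hψ.exists_levelNorm_sq_le_sobolevNorm (d + 1)
    refine ⟨(C * C' ^ (1 / 2 : ℝ)).toReal + 1, by positivity, fun n hn f hf => ?_⟩
    refine le_trans ?_ (mul_le_mul' (HyperbolicWavelet.ofReal_rate (by finiteness)
      ((m : ℝ) - 1 / 2) (d : ℝ) (by positivity) n) le_rfl)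
    rw [ENNReal.rpow_natCast]
    exact (hle n hn f hf.1 (C' ^ (1 / 2 : ℝ) * HyperbolicWavelet.sobolevNorm m f)
      (ENNReal.mul_ne_top (by finiteness) hf.2.ne)
      fun a => HyperbolicWavelet.le_of_sq_le_mul_sq (hle' f hf.1 a)).trans (le_of_eq (by ring))
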